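/- **Theorem.** Let $k,l,N,a,b$ be integers with $1\le l\le k$, $N\ge 0$, $a,b\ge 0$ and $a+b\le l$. *Configurations.* Let $C^{(k,l)}_{a,b}[N]$ be the (finite) set of sequences ${\bf a}=(a_i)_{i\in\mathbf Z}$ of non-negative integers such that $a_i=0$ for all $i<0$ and for all $i>N$, $a_0=a$, $a_1=b$, and, for all $i\in\mathbf Z$, $$a_i+a_{i+1}+a_{i+2}\le k,\qquad a_i+a_{i+1}\le l,\qquad a_{i-1}+2a_i+2a_{i+1}+a_{i+2}\le k+l .$$ Put $d({\bf a})=\sum_i i\,a_i$. *Fermionic polynomials.* Let $q$ be an indeterminate. For integers $m,n$ with $n\ge 0$ let $$\left[{m\atop n}\right]=\prod_{i=1}^n\frac{1-q^{m-n+i}}{1-q^i}\ \text{ if } n\le m,\qquad \left[{m\atop n}\right]=0\ \text{ otherwise.}$$ Put $A_{i,j}=2\min(i,j)+\max(i+j-k,0)$ for $1\le i,j\le k$ and, for ${\bf m}=(m_1,\dots,m_k)\in\mathbf Z_{\ge0}^k$, $$Q({\bf m})=\tfrac12\sum_{i,j=1}^kA_{i,j}m_im_j-\tfrac12\sum_{j=1}^kA_{j,j}m_j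 .$$ For integers $a',b'\ge 0$ with $a'+b'\le k$ set $$\chi^{(k,l)}_{a',b'}[N]=\sum_{{\bf m}}q^{Q({\bf m})+\sum_{i=1}^kr_im_i}\prod_{1\le j\le k,\ m_j\ne0}\left[{jN-\sum_{i=1}^kA_{j,i}m_i+A_{j,j}-r_j+m_j\atop m_j}\right],$$ where the sum is over all ${\bf m}\in\mathbf Z_{\ge0}^k$ with $m_{l+1}=\cdots=m_k=0$ (only finitely many terms are non-zero) and $$(r_1,\dots,r_k)=(\underbrace{0,\dots,0}_{a'},\underbrace{1,2,\dots,b'}_{b'},\underbrace{b'+2,b'+4,\dots,2k-2a'-b'}_{k-a'-b'}).$$ Further, put $\chi^{(k,l)}_{-1,b'}[N]=0$ for all $b'$, and $\chi^{(k,l)}_{a',b'}[N]=\chi^{(k,l)}_{a',k-a'}[N]$ for $a'\ge0$, $a'+b'=k+1$. *Conclusion.* In $\mathbf Q(q)$, $$\sum_{{\bf a}\in C^{(k,l)}_{a,b}[N]}q^{d({\bf a})}=\begin{cases}\chi^{(k,l)}_{a,b}[N]-\chi^{(k,l)}_{a-1,b+2}[N]-\chi^{(k,l)}_{a,b-1}[N]+\chi^{(k,l)}_{a-1,b+1}[N]&\text{if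 } b>0,\\[3pt]\chi^{(k,l)}_{a,0}[N]-\chi^{(k,l)}_{a-1,2}[N]&\text{if } b=0.\end{cases}$$ -/

import Mathlib

namespace RiggedConfig

/-! ### Configurations -/

/-- A finite configuration: a finitely supported sequence `(a_i)_{i ∈ ℤ}` of non-negative
integers. -/
abbrev Config : Type := ℤ →₀ ℕ

/-- The degree (energy) `d(a) = ∑ i, i * a_i` of a finite configuration. -/
def degree (a : Config) : ℤ := a.sum fun i n => i * (n : ℤ)

/-- `(k,3)`-admissibility: `a_i + a_{i+1} + a_{i+2} ≤ k` for all `i`. -/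
def IsAdmissible (k : ℕ) (a : Config) : Prop :=
  ∀ i : ℤ, a i + a (i + 1) + a (i + 2) ≤ k

/-- The two conditions that say that a `(k,3)`-admissible configuration is of maximal
weight `l`. They become weaker as `l` grows. -/
def IsOfMaxWeight (k l : ℕ) (a : Config) : Prop :=
  (∀ i : ℤ, a i + a (i + 1) ≤ l) ∧
    ∀ i : ℤ, a (i - 1) + 2 * a i + 2 * a (i + 1) + a (i + 2) ≤ k + l

/-- `C^{(k,l)}`: the finite `(k,3)`-admissible configurations of maximal weight at most `l`. -/
def C (k l : ℕ) : Set Config :=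
  {a | IsAdmissible k a ∧ ∃ l' ≤ l, IsOfMaxWeight k l' a}

theorem mem_C_iff {k l : ℕ} {a : Config} :
    a ∈ C k l ↔ IsAdmissible k a ∧ IsOfMaxWeight k l a := by
  constructor
  · rintro ⟨h, l', hl, h1, h2⟩
    exact ⟨h, fun i => (h1 i).trans hl, fun i => (h2 i).trans (by lia)⟩
  · rintro ⟨h, h'⟩
    exact ⟨h, l, le_rfl, h'⟩

/-- `C^{(k,l)}_{pos}`: the positively supported configurations in `C^{(k,l)}`. -/
def CPos (k l : ℕ) : Set Config := {a ∈ C k l | ∀ i : ℤ, i < 0 → a i = 0}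

/-- `C^{(k,l)}_{a,b}`: the configurations in `C^{(k,l)}_{pos}` that start with
`a_0 = a`, `a_1 = b`. -/
def CInit (k l a b : ℕ) : Set Config := {c ∈ CPos k l | c 0 = a ∧ c 1 = b}

/-- `C^{(k,l)}_{pos}[N]`: the configurations in `C^{(k,l)}_{pos}` that vanish above `N`. -/
def CBdd (k l N : ℕ) : Set Config := {c ∈ CPos k l | ∀ i : ℤ, (N : ℤ) < i → c i = 0}

/-- `C^{(k,l)}_{a,b}[N]`. -/
def CInitBdd (k l N a b : ℕ) : Set Config := CBdd k l N ∩ CInit k l a b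

/-- There are finitely many configurations in `C^{(k,l)}_{a,b}[N]`, so that their generating
function is a finite sum. -/
theorem finite_CInitBdd (k l N a b : ℕ) : (CInitBdd k l N a b).Finite := by
  refine ((Finset.Icc (0 : ℤ) N).finsupp fun _ => Finset.range (k + 1)).finite_toSet.subset ?_
  rintro c ⟨⟨⟨⟨hadm, -⟩, hpos⟩, hN⟩, -⟩
  rw [Finset.mem_coe, Finset.mem_finsupp_iff]
  refine ⟨fun i hi => ?_, fun i _ => ?_⟩
  · rw [Finsupp.mem_support_iff] at hi
    rw [Finset.mem_Icc]
    by_contra hcon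
    rcases lt_or_ge i 0 with h | h
    · exact hi (hpos i h)
    · exact hi (hN i (by lia))
  · have := hadm i
    rw [Finset.mem_range]
    lia

/-! ### Fermionic polynomials -/

/-- The indeterminate `q`, in the field of rational functions. -/
noncomputable def q : RatFunc ℚ := RatFunc.X

/-- The `q`-binomial coefficient `[m, n] = ∏_{i=1}^n (1 - q^{m-n+i}) / (1 - q^i)` if
`0 ≤ n ≤ m`, and `0` otherwise; the upper entry may be negative. -/
noncomputable def qBinom (m : ℤ) (n : ℕ) : RatFunc ℚ :=
  if (n : ℤ) ≤ m then
    ∏ i ∈ Finset.Icc 1 n, (1 - q ^ (m - (n : ℤ) + (i : ℤ))) / (1 - q ^ i)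
  else 0

/-- `A_{i,j} = 2 min(i,j) + max(i+j-k, 0)`. -/
def A (k i j : ℕ) : ℤ := 2 * min (i : ℤ) (j : ℤ) + max ((i : ℤ) + (j : ℤ) - (k : ℤ)) 0

/-- `Q(m) = ½ (A m, m) - ½ ∑_{j=1}^k A_{j,j} m_j`; the division by two is exact, see
`two_mul_Q`. -/
def Q (k : ℕ) (m : ℕ →₀ ℕ) : ℤ :=
  ((∑ i ∈ Finset.Icc 1 k, ∑ j ∈ Finset.Icc 1 k, A k i j * (m i : ℤ) * (m j : ℤ)) -
    ∑ j ∈ Finset.Icc 1 k, A k j j * (m j : ℤ)) / 2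

theorem A_comm (k i j : ℕ) : A k i j = A k j i := by
  unfold A
  rw [min_comm, add_comm (i : ℤ)]

theorem even_quadratic (k : ℕ) (m : ℕ →₀ ℕ) (s : Finset ℕ) :
    Even ((∑ i ∈ s, ∑ j ∈ s, A k i j * (m i : ℤ) * (m j : ℤ)) -
      ∑ j ∈ s, A k j j * (m j : ℤ)) := by
  classical
  induction s using Finset.induction_on with
  | empty => simp
  | insert x s hx ih =>
    have hsymm : ∑ i ∈ s, A k i x * (m i : ℤ) * (m x : ℤ)
        = ∑ j ∈ s, A k x j * (m x : ℤ) * (m j : ℤ) :=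
      Finset.sum_congr rfl fun i _ => by rw [A_comm k i x]; ring
    have hx2 : Even ((m x : ℤ) * ((m x : ℤ) - 1)) := Int.even_mul_pred_self _
    simp only [Finset.sum_insert hx, Finset.sum_add_distrib, hsymm]
    obtain ⟨u, hu⟩ := ih
    obtain ⟨v, hv⟩ := hx2
    refine ⟨u + (A k x x * v + ∑ j ∈ s, A k x j * (m x : ℤ) * (m j : ℤ)), ?_⟩
    linear_combination hu + A k x x * hv

theorem two_mul_Q (k : ℕ) (m : ℕ →₀ ℕ) :
    2 * Q k m = (∑ i ∈ Finset.Icc 1 k, ∑ j ∈ Finset.Icc 1 k, A k i j * (m i : ℤ) * (m j : ℤ)) -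
      ∑ j ∈ Finset.Icc 1 k, A k j j * (m j : ℤ) :=
  Int.mul_ediv_cancel' (even_quadratic k m _).two_dvd

/-- The vector `(r_1, …, r_k) = (0, …, 0, 1, …, b, b+2, b+4, …, 2k-2a-b)`, with `a` zeros,
then `b` entries in steps of one, then `k-a-b` entries in steps of two. -/
def rVec (a b : ℤ) (j : ℕ) : ℤ :=
  if (j : ℤ) ≤ a then 0
  else if (j : ℤ) ≤ a + b then (j : ℤ) - a
  else b + 2 * ((j : ℤ) - a - b)

/-- The index set of the fermionic sum: `m = (m_1, …, m_k)` with `m_{l+1} = ⋯ = m_k = 0`. For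
`l ≤ k` these are the finitely supported `m` that vanish outside `{1, …, l}`. -/
def multIndices (l : ℕ) : Set (ℕ →₀ ℕ) := {m | ∀ j, j ∉ Finset.Icc 1 l → m j = 0}

/-- The summand of the fermionic polynomial with vector `r` that belongs to `m`. -/
noncomputable def fermTerm (k N : ℕ) (r : ℕ → ℤ) (m : ℕ →₀ ℕ) : RatFunc ℚ :=
  q ^ (Q k m + ∑ i ∈ Finset.Icc 1 k, r i * (m i : ℤ)) *
    ∏ j ∈ Finset.Icc 1 k with m j ≠ 0,
      qBinom ((j : ℤ) * (N : ℤ) - (∑ i ∈ Finset.Icc 1 k, A k j i * (m i : ℤ)) + A k j j - r j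
        + (m j : ℤ)) (m j)

/-- Only finitely many summands are non-zero. -/
theorem finite_fermTerm (k l N : ℕ) (hlk : l ≤ k) (r : ℕ → ℤ) :
    {m ∈ multIndices l | fermTerm k N r m ≠ 0}.Finite := by
  refine ((Finset.Icc 1 k).finsupp fun j =>
    Finset.range (((j : ℤ) * (N : ℤ) + A k j j - r j).toNat + 1)).finite_toSet.subset ?_
  rintro m ⟨hm, hne⟩
  rw [Finset.mem_coe, Finset.mem_finsupp_iff]
  refine ⟨fun j hj => ?_, fun j hj => ?_⟩
  · rw [Finsupp.mem_support_iff] at hj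
    by_contra hcon
    refine hj (hm j fun h => hcon ?_)
    rw [Finset.mem_Icc] at h ⊢
    exact ⟨h.1, h.2.trans hlk⟩
  · rw [Finset.mem_range]
    by_cases h0 : m j = 0
    · lia
    have hA : ∀ i i' : ℕ, 0 ≤ A k i i' := fun i i' => by unfold A; positivity
    have hq := (Finset.prod_ne_zero_iff.1 (right_ne_zero_of_mul hne)) j
      (Finset.mem_filter.2 ⟨hj, h0⟩)
    unfold qBinom at hq
    have hle := (ite_ne_right_iff.1 hq).1
    have hsum : A k j j * (m j : ℤ) ≤ ∑ i ∈ Finset.Icc 1 k, A k j i * (m i : ℤ) :=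
      Finset.single_le_sum (f := fun i => A k j i * (m i : ℤ))
        (fun i _ => mul_nonneg (hA j i) (Int.natCast_nonneg _)) hj
    have hj1 : 1 ≤ j := (Finset.mem_Icc.1 hj).1
    have hA1 : 1 ≤ A k j j := by unfold A; lia
    have hmul : (m j : ℤ) ≤ A k j j * (m j : ℤ) :=
      le_mul_of_one_le_left (Int.natCast_nonneg _) hA1
    lia

/-- The fermionic polynomial `χ^{(k,l)}_{a,b}[N]`, for integers `a ≥ -1`, `b ≥ 0` with
`a + b ≤ k + 1`. It is `0` if `a = -1`; if `a + b = k + 1` it is understood as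
`χ^{(k,l)}_{a,k-a}[N]`. -/
noncomputable def chi (k l N : ℕ) (a b : ℤ) : RatFunc ℚ :=
  if a < 0 then 0
  else ∑ᶠ m ∈ multIndices l, fermTerm k N (rVec a (min b ((k : ℤ) - a))) m

end RiggedConfig

namespace RiggedConfig

/-! ### Piecewise linear identities for splittings -/

/-! A configuration is decomposed into particles of weights `1, …, k`, as in a rigged configuration.
For `c` in `C^{(k,l)}` but not in `C^{(k,l-1)}` some window is tight: one of the two weight
conditions is an equality there. Moving one unit to the left inside the leftmost tight window
(`mvL`) lowers the energy by one and stays in `C^{(k,l)}`. Repetition drags a particle of weight `l`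
out to the far left, where it is isolated. This defines `Ext k l c d ρ`: `c` is `d` with a particle
of weight `l` and energy `ρ` inserted. The pair `(d, ρ)` is determined by `c` (`Ext.unique`), `c` by
the pair (`Ext.inj`), and extraction is always possible (`exists_ext`).

What remains is to determine which `ρ` may occur. The tool is the carrier `kap k s`: it holds back a
part of `c`, the splitting of capacity `s`, and shifts the rest one site to the left. For `s ≤ k -
l` carriers commute with the move (`kap_mvL`), hence with extraction, and lower the energy of a
particle of weight `l` by `max (l - s) 0` (`Ext.kap`). Conversely, a particle of weight `l` that
enters from the left acts on what it passes as the carrier of capacity `k - l` followed by a shift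
by two. This gives an explicit list of all insertions (`state`, `ext_state`, `Ext.eq_state`) and
from it three bounds: the energies of successive particles of weight `l` differ by at least `A l l`
(`exists_ext_iff`); vanishing above `N` bounds the last of them by `l * N - ∑ A l j * m j`, the sum
being over the lighter particles (`Ext.zero_above_iff`, `HasContent.mass_add`); the left boundary
condition `c 0 ≤ a`, `2 * c 0 + c 1 ≤ 2 * a + b` becomes `r_l ≤ ρ` for the extracted particle and
the same condition, seen through the carriers `k - l, 0, 0`, for the rest (`Ext.inP_kapL_iff`).
These carriers raise the bound for weight `j ≤ l` by `A j l` (`rmin_append`).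

Summation over the energies is therefore independent for each weight and produces one Gaussian
binomial each (`sum_qBinom`, `sum_fermTerm`, `finsum_gSetT`). Thus `chi` counts the configurations
with that left boundary condition (`chi_eq`), and fixing `c 0 = a`, `c 1 = b` is an
inclusion-exclusion over four such sets, or two if `b = 0`. -/

theorem min_three {w a b c : ℤ} (h : w = min a (min b c)) :
    w ≤ a ∧ w ≤ b ∧ w ≤ c ∧ (w = a ∨ w = b ∨ w = c) := by omega

/-- In these lemmas `c0, c1, …` are consecutive entries of a configuration and `v0, v1, …` those of
its splitting of capacity `s`, so that `v0 + (c1 - v1)` is an entry of `kap`. This one and the next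
two are the window bounds for `kap`. -/
theorem kap_two {k l s c0 c1 c2 c3 v0 v1 v2 : ℤ}
    (h0 : v0 ≤ c0) (h01 : v0 + v1 ≤ s) (t : c0 + c1 ≤ l) (t' : c1 + c2 ≤ l)
    (f : c0 + 2 * c1 + 2 * c2 + c3 ≤ k + l)
    (r2 : v2 = min c2 (min (s - v1) (k - c1 - c2 - c3))) :
    v0 + (c1 - v1) + (v1 + (c2 - v2)) ≤ l := by
  omega

theorem kap_three {k l s c0 c1 c2 c3 c4 v0 v1 v2 v3 : ℤ} (hs : s ≤ k - l)
    (h0 : v0 ≤ c0) (h0s : v0 ≤ s) (t : c0 + c1 + c2 ≤ k)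
    (f : c1 + 2 * c2 + 2 * c3 + c4 ≤ k + l)
    (r2 : v2 ≤ k - c1 - c2 - c3)
    (r3 : v3 = min c3 (min (s - v2) (k - c2 - c3 - c4))) :
    v0 + (c1 - v1) + (v1 + (c2 - v2)) + (v2 + (c3 - v3)) ≤ k := by
  omega

theorem kap_four {k l s c0 c1 c2 c3 c4 c5 v0 v1 v2 v3 v4 : ℤ} (hs : s ≤ k - l)
    (h0 : v0 ≤ c0) (h1 : v1 ≤ c1) (h0s : v0 + v1 ≤ s)
    (t0 : c0 + c1 ≤ l) (t1 : c1 + c2 ≤ l) (t2 : c2 + c3 ≤ l)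
    (s0 : c0 + c1 + c2 ≤ k) (s1 : c1 + c2 + c3 ≤ k) (s2 : c2 + c3 + c4 ≤ k)
    (s3 : c3 + c4 + c5 ≤ k) (f0 : c0 + 2 * c1 + 2 * c2 + c3 ≤ k + l)
    (f1 : c1 + 2 * c2 + 2 * c3 + c4 ≤ k + l) (f2 : c2 + 2 * c3 + 2 * c4 + c5 ≤ k + l)
    (r1 : v1 ≤ k - c0 - c1 - c2)
    (r2 : v2 = min c2 (min (s - v1) (k - c1 - c2 - c3)))
    (r3 : v3 = min c3 (min (s - v2) (k - c2 - c3 - c4)))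
    (r4 : v4 = min c4 (min (s - v3) (k - c3 - c4 - c5))) :
    v0 + (c1 - v1) + 2 * (v1 + (c2 - v2)) + 2 * (v2 + (c3 - v3)) + (v3 + (c4 - v4)) ≤ k + l := by
  omega

theorem kap_strict {k l s c0 c1 c2 c3 c4 c5 v0 v1 v2 v3 v4 : ℤ} (hs : s ≤ k - l)
    (h0 : v0 ≤ c0) (h1 : v1 ≤ c1) (h01 : v0 + v1 ≤ s)
    (t1 : c1 + c2 < l) (t2 : c2 + c3 < l)
    (f1 : c0 + 2 * c1 + 2 * c2 + c3 < k + l) (f2 : c1 + 2 * c2 + 2 * c3 + c4 < k + l)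
    (f3 : c2 + 2 * c3 + 2 * c4 + c5 < k + l)
    (r1 : v1 ≤ k - c0 - c1 - c2)
    (r2 : v2 = min c2 (min (s - v1) (k - c1 - c2 - c3)))
    (r3 : v3 = min c3 (min (s - v2) (k - c2 - c3 - c4)))
    (r4 : v4 = min c4 (min (s - v3) (k - c3 - c4 - c5))) :
    v1 + (c2 - v2) + (v2 + (c3 - v3)) < l ∧
      v0 + (c1 - v1) + 2 * (v1 + (c2 - v2)) + 2 * (v2 + (c3 - v3)) + (v3 + (c4 - v4)) < k + l := by
  omega

/-- How the splitting of a configuration changes when the leftmost particle of maximal weight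
moves one step to the left. -/
theorem split_move {k l s b c d e f g x y z w t : ℤ} (hs : s ≤ k - l)
    (cd : c + d < l) (ef : e + f ≤ l) (de : d + e ≤ l)
    (f2 : b + 2 * c + 2 * d + e < k + l) (f4 : d + 2 * e + 2 * f + g ≤ k + l)
    (T : d + e = l ∨ c + 2 * d + 2 * e + f = k + l)
    (hy : y = min c (min (s - x) (k - b - c - d)))
    (hz : z = min d (min (s - y) (k - c - d - e)))
    (hw : w = min e (min (s - z) (k - d - e - f)))
    (ht : t = min f (min (s - w) (k - e - f - g)))
    {y' z' w' t' : ℤ}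
    (hy' : y' = min c (min (s - x) (k - b - c - (d + 1))))
    (hz' : z' = min (d + 1) (min (s - y') (k - c - (d + 1) - (e - 1))))
    (hw' : w' = min (e - 1) (min (s - z') (k - (d + 1) - (e - 1) - f)))
    (ht' : t' = min f (min (s - w') (k - (e - 1) - f - g))) :
    t' = t ∧
      ((y' = y ∧ z' = z ∧ w' = w ∧ (z = s - y ∨ z = k - c - d - e)) ∨
        (y' = y ∧ z' = z + 1 ∧ w' = w - 1 ∧ z = d ∧ d < s - y ∧ d < k - c - d - e) ∨
          (y' = y - 1 ∧ z' = z + 1 ∧ w' = w ∧ y = k - b - c - d ∧ w = k - d - e - f ∧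
            c + 2 * d + 2 * e + f = k + l)) := by
  rw [show k - c - (d + 1) - (e - 1) = k - c - d - e by ring] at hz'
  rw [show k - (d + 1) - (e - 1) - f = k - d - e - f by ring] at hw'
  have hy1 : y ≤ c := by clear * - hy; omega
  -- The extra unit on the site of `d` reaches `y` only through the last of its three bounds, which
  -- drops by one.
  have hA : y' = y ∨ (y' = y - 1 ∧ y = k - b - c - d) := by clear * - hy hy'; omega
  rcases hA with rfl | ⟨hA, hA2⟩
  · have hB : (z' = z ∧ (z = s - y' ∨ z = k - c - d - e)) ∨
        (z' = z + 1 ∧ z = d ∧ z < s - y' ∧ z < k - c - d - e) := by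
      clear * - hz hz'; omega
    rcases hB with ⟨rfl, hB2⟩ | ⟨hB, rfl, hB2, hB3⟩
    · have hC0 : w < e := by clear * - hw hB2 T cd hy1 hs; omega
      have hC : w' = w := by clear * - hw hw' hC0; omega
      have : t' = t := by
        subst hC
        have h1 : z' ≤ d ∧ z' ≤ k - c - d - e := by clear * - hz; omega
        have h2 : w' = s - z' ∨ w' = k - d - e - f := by clear * - hw hC0; omega
        clear * - h2 ht ht' h1 f4 T hs de
        rcases T with T | T <;> rcases h2 with h2 | h2 <;> omega
      exact ⟨this, .inl ⟨rfl, rfl, hC, hB2⟩⟩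
    · have T : z + e = l := by clear * - T hB3 ef; omega
      have hC : w' = w - 1 := by clear * - hw hw' hB hB3 T ef hs; omega
      have hD : w ≤ s - z := by clear * - hw; omega
      have : t' = t := by clear * - ht ht' hC hD T ef f4; omega
      exact ⟨this, .inr (.inl ⟨rfl, hB, hC, rfl, hB2, hB3⟩)⟩
  · have T : c + 2 * d + 2 * e + f = k + l := by clear * - T hA2 hy1 f2; omega
    have hB : z' = z + 1 := by clear * - hz hz' hA hA2 f2 hs; omega
    have hD : z ≤ s - y := by clear * - hz; omega
    have hC : w' = w ∧ w = k - d - e - f := by clear * - hw hw' hB hA2 T f2 hD cd; omega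
    have : t' = t := by clear * - ht ht' hC f4 hs; omega
    exact ⟨this, .inr (.inr ⟨hA, hB, hC.1, hA2, hC.2, T⟩)⟩

/-- Here `(d, e)` is the leftmost tight window of the configuration. The suffixes `one` and `two`
tell how many sites to its left the window of `kap` in question lies. The last hypothesis says that
`y` survives the move unchanged. -/
theorem kap_not_tight_two {k l s a b c d e f o x y z w : ℤ} (hs : s ≤ k - l)
    (xb : x ≤ b) (ox : o + x ≤ s) (xy : x + y ≤ s)
    (bc : b + c < l) (cd : c + d < l) (de : d + e ≤ l)
    (f1 : a + 2 * b + 2 * c + d < k + l) (f2 : b + 2 * c + 2 * d + e < k + l)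
    (f3 : c + 2 * d + 2 * e + f ≤ k + l) (oa : o ≤ a) (xE : x ≤ k - a - b - c)
    (hy : y = min c (min (s - x) (k - b - c - d)))
    (hz : z = min d (min (s - y) (k - c - d - e)))
    (hw : w = min e (min (s - z) (k - d - e - f)))
    (hy' : y = min c (min (s - x) (k - b - c - (d + 1)))) :
    x + (c - y) + (y + (d - z)) < l ∧
      o + (b - x) + 2 * (x + (c - y)) + 2 * (y + (d - z)) + (z + (e - w)) < k + l := by
  omega

theorem kap_not_tight_one {k l s b c d e f g x y w t : ℤ} (hs : s ≤ k - l)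
    (xy : x + y ≤ s) (cd : c + d < l) (ef : e + f ≤ l) (de : d + e ≤ l)
    (f2 : b + 2 * c + 2 * d + e < k + l) (f3 : c + 2 * d + 2 * e + f ≤ k + l)
    (f4 : d + 2 * e + 2 * f + g ≤ k + l)
    (T : d + e = l ∨ c + 2 * d + 2 * e + f = k + l)
    (hy : y = min c (min (s - x) (k - b - c - d)))
    (hw : w = min e (min (s - d) (k - d - e - f)))
    (ht : t = min f (min (s - w) (k - e - f - g)))
    (hB2 : d < s - y) (hB3 : d < k - c - d - e) :
    (y + (d - d) + (d + (e - w)) < l ∧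
        x + (c - y) + 2 * (y + (d - d)) + 2 * (d + (e - w)) + (w + (f - t)) < k + l) ∧
      d + (e - w) + (w + (f - t)) = l := by
  omega

theorem kap_tight_one {k l s b c d e f g x y z w t : ℤ} (hs : s ≤ k - l)
    (xb : x ≤ b) (x0 : 0 ≤ x) (w0 : 0 ≤ w) (y0 : 0 ≤ y) (z0 : 0 ≤ z) (t0 : 0 ≤ t) (zd : z ≤ d)
    (bc : b + c < l) (cd : c + d < l) (ef : e + f ≤ l) (de : d + e ≤ l)
    (f2 : b + 2 * c + 2 * d + e < k + l) (f3 : c + 2 * d + 2 * e + f ≤ k + l)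
    (f4 : d + 2 * e + 2 * f + g ≤ k + l)
    (T : d + e = l ∨ c + 2 * d + 2 * e + f = k + l)
    (yc : y ≤ c) (ys : y ≤ s - x) (yE : y ≤ k - b - c - (d + 1)) (hy : y = c ∨ y = s - x)
    (hz2 : z ≤ s - y) (hz3 : z ≤ k - c - d - e)
    (hw : w = min e (min (s - z) (k - d - e - f)))
    (ht : t = min f (min (s - w) (k - e - f - g)))
    (hB2 : z = s - y ∨ z = k - c - d - e) (hl : y + (d - z) + (z + (e - w)) ≤ l)
    (hf : x + (c - y) + 2 * (y + (d - z)) + 2 * (z + (e - w)) + (w + (f - t)) ≤ k + l) :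
    y + (d - z) + (z + (e - w)) = l ∨
      x + (c - y) + 2 * (y + (d - z)) + 2 * (z + (e - w)) + (w + (f - t)) = k + l := by
  by_contra hh
  push Not at hh
  have h1 := lt_of_le_of_ne hl hh.1
  have h2 := lt_of_le_of_ne hf hh.2
  clear hh hl hf
  obtain ⟨b1, b2, b3, b4⟩ := min_three hw
  obtain ⟨c1, c2, c3, c4⟩ := min_three ht
  clear hw ht
  rcases T with T | T <;> rcases hB2 with hB2 | hB2 <;> rcases b4 with b4 | b4 | b4 <;> omega

theorem kap_tight_two {k l s a b c d e f o x y z w : ℤ} (hs : s ≤ k - l)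
    (oa : o ≤ a) (bc : b + c < l) (cd : c + d < l)
    (f1 : a + 2 * b + 2 * c + d < k + l) (f2 : b + 2 * c + 2 * d + e < k + l)
    (T : c + 2 * d + 2 * e + f = k + l)
    (hx : x = min b (min (s - o) (k - a - b - c)))
    (yE : y = k - b - c - d) (ys : y ≤ s - x)
    (hz : z = min d (min (s - y) (k - c - d - e)))
    (hw : w = k - d - e - f) (ws : w ≤ s - z) :
    x + (c - y) + (y + (d - z)) = l ∨
      o + (b - x) + 2 * (x + (c - y)) + 2 * (y + (d - z)) + (z + (e - w)) = k + l := by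
  obtain ⟨a1, a2, a3, a4⟩ := min_three hx
  obtain ⟨b1, b2, b3, b4⟩ := min_three hz
  clear hx hz
  rcases a4 with a4 | a4 | a4 <;> rcases b4 with b4 | b4 | b4 <;> omega

/-! ### Configurations as integer sequences -/

/-- The configurations of maximal weight at most `l`, as integer valued sequences. -/
structure InC (k l : ℤ) (c : ℤ → ℤ) : Prop where
  fin : c.support.Finite
  nn : ∀ i, 0 ≤ c i
  three : ∀ i, c i + c (i + 1) + c (i + 2) ≤ k
  two : ∀ i, c i + c (i + 1) ≤ l
  four : ∀ i, c i + 2 * c (i + 1) + 2 * c (i + 2) + c (i + 3) ≤ k + l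

/-- One of the two weight conditions is an equality at the window `(p, p+1)`. -/
def Tight (k l : ℤ) (c : ℤ → ℤ) (p : ℤ) : Prop :=
  c p + c (p + 1) = l ∨ c (p - 1) + 2 * c p + 2 * c (p + 1) + c (p + 2) = k + l

/-- `p` is the leftmost tight window. -/
def IsFirst (k l : ℤ) (c : ℤ → ℤ) (p : ℤ) : Prop :=
  Tight k l c p ∧ ∀ q < p, ¬ Tight k l c q

/-- Move one unit from `p + 1` to `p`. -/
def mvL (c : ℤ → ℤ) (p : ℤ) : ℤ → ℤ :=
  fun i => if i = p then c i + 1 else if i = p + 1 then c i - 1 else c i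

theorem mvL_self (c : ℤ → ℤ) (p : ℤ) : mvL c p p = c p + 1 := by simp [mvL]

theorem mvL_succ (c : ℤ → ℤ) (p : ℤ) : mvL c p (p + 1) = c (p + 1) - 1 := by simp [mvL]

theorem mvL_of_ne {c : ℤ → ℤ} {p i : ℤ} (h : i ≠ p) (h' : i ≠ p + 1) : mvL c p i = c i := by
  simp [mvL, h, h']

theorem IsFirst.unique {k l p q : ℤ} {c : ℤ → ℤ} (hp : IsFirst k l c p) (hq : IsFirst k l c q) :
    p = q := by
  rcases lt_trichotomy p q with h | h | h
  · exact absurd hp.1 (hq.2 p h)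
  · exact h
  · exact absurd hq.1 (hp.2 q h)

theorem exists_zero_below {c : ℤ → ℤ} (h : c.support.Finite) : ∃ lo, ∀ i ≤ lo, c i = 0 := by
  obtain ⟨b, hb⟩ := h.bddBelow
  refine ⟨b - 1, fun i hi => ?_⟩
  by_contra hc
  have := hb (Function.mem_support.2 hc)
  omega

theorem exists_zero_above {c : ℤ → ℤ} (h : c.support.Finite) : ∃ hi, ∀ i ≥ hi, c i = 0 := by
  obtain ⟨b, hb⟩ := h.bddAbove
  refine ⟨b + 1, fun i hi => ?_⟩
  by_contra hc
  have := hb (Function.mem_support.2 hc)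
  omega

theorem not_tight_iff {k l p : ℤ} {c : ℤ → ℤ} (h : InC k l c) : ¬ Tight k l c p ↔
    c p + c (p + 1) < l ∧ c (p - 1) + 2 * c p + 2 * c (p + 1) + c (p + 2) < k + l := by
  have h1 := h.two p
  have h2 := h.four (p - 1)
  rw [show p - 1 + 1 = p by ring, show p - 1 + 2 = p + 1 by ring, show p - 1 + 3 = p + 2 by ring] at h2
  unfold Tight
  omega

theorem tight_shift {k l p : ℤ} {c : ℤ → ℤ} : Tight k l c (p + 1) ↔
    c (p + 1) + c (p + 2) = l ∨ c p + 2 * c (p + 1) + 2 * c (p + 2) + c (p + 3) = k + l := by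
  unfold Tight
  rw [show p + 1 - 1 = p by ring, show p + 1 + 1 = p + 2 by ring, show p + 1 + 2 = p + 3 by ring]

theorem not_tight_shift {k l p : ℤ} {c : ℤ → ℤ} (h : InC k l c) : ¬ Tight k l c (p + 1) ↔
    c (p + 1) + c (p + 2) < l ∧ c p + 2 * c (p + 1) + 2 * c (p + 2) + c (p + 3) < k + l := by
  have h1 := h.two (p + 1)
  have h2 := h.four p
  rw [show p + 1 + 1 = p + 2 by ring] at h1
  rw [tight_shift]
  omega

theorem inC_pred_iff {k l : ℤ} {c : ℤ → ℤ} :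
    InC k (l - 1) c ↔ InC k l c ∧ ∀ p, ¬ Tight k l c p := by
  constructor
  · intro h
    have h' : InC k l c := ⟨h.fin, h.nn, h.three, fun i => (h.two i).trans (by omega),
      fun i => (h.four i).trans (by omega)⟩
    refine ⟨h', fun p => ?_⟩
    obtain ⟨q, rfl⟩ : ∃ q, p = q + 1 := ⟨p - 1, by ring⟩
    rw [not_tight_shift h']
    have h1 := h.two (q + 1)
    have h2 := h.four q
    rw [show q + 1 + 1 = q + 2 by ring] at h1
    omega
  · rintro ⟨h, ht⟩
    refine ⟨h.fin, h.nn, h.three, fun i => ?_, fun i => ?_⟩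
    · have := ((not_tight_iff h).1 (ht i)).1
      omega
    · have := ((not_tight_shift h).1 (ht (i + 1))).2
      omega

theorem InC.mono {k l l' : ℤ} {c : ℤ → ℤ} (h : InC k l c) (hl : l ≤ l') : InC k l' c :=
  ⟨h.fin, h.nn, h.three, fun i => (h.two i).trans hl, fun i => (h.four i).trans (by omega)⟩

theorem InC.nonneg {k l : ℤ} {c : ℤ → ℤ} (h : InC k l c) : 0 ≤ k ∧ 0 ≤ l := by
  obtain ⟨lo, hlo⟩ := exists_zero_below h.fin
  have h1 := h.three (lo - 2)
  have h2 := h.two (lo - 2)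
  simp only [hlo (lo - 2) (by omega), hlo (lo - 2 + 1) (by omega), hlo (lo - 2 + 2) (by omega)] at h1 h2
  omega

theorem exists_isFirst {k l p : ℤ} {c : ℤ → ℤ} (h : InC k l c) (hl : 1 ≤ l) (hp : Tight k l c p) :
    ∃ p, IsFirst k l c p := by
  classical
  obtain ⟨lo, hlo⟩ := exists_zero_below h.fin
  have hk := h.nonneg.1
  -- Far to the left all sums vanish, and `0` is neither `l` nor `k + l` because `1 ≤ l`.
  have hb : ∀ q, Tight k l c q → lo - 2 ≤ q := by
    intro q hq
    by_contra hlt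
    unfold Tight at hq
    rw [hlo q (by omega), hlo (q + 1) (by omega), hlo (q - 1) (by omega), hlo (q + 2) (by omega)] at hq
    omega
  obtain ⟨m, hm, hmin⟩ := Int.exists_least_of_bdd (P := Tight k l c) ⟨lo - 2, hb⟩ ⟨p, hp⟩
  exact ⟨m, hm, fun q hq hqt => by have := hmin q hqt; omega⟩

/-- All constraints near a leftmost tight window `q + 3`. -/
theorem InC.four' {k l : ℤ} {c : ℤ → ℤ} (h : InC k l c) (q : ℤ) :
    0 ≤ c q ∧ c q + c (q + 1) ≤ l ∧ c q + c (q + 1) + c (q + 2) ≤ k ∧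
      c q + 2 * c (q + 1) + 2 * c (q + 2) + c (q + 3) ≤ k + l :=
  ⟨h.nn q, h.two q, h.three q, h.four q⟩

/-- If `c (p + 1) = 0`, then equality in the first condition would force `c p = l` and make the
window `p - 1` tight. In the second condition the sum splits as `c (p - 1) + c p < l` plus `c p + c
(p + 2) ≤ k`, so equality is impossible. -/
theorem IsFirst.one_le {k l p : ℤ} {c : ℤ → ℤ} (h : InC k l c) (hp : IsFirst k l c p) :
    1 ≤ c (p + 1) := by
  obtain ⟨q, rfl⟩ : ∃ q, p = q + 2 := ⟨p - 2, by ring⟩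
  have h1 := hp.1
  have h2 := hp.2 (q + 1) (by omega)
  rw [not_tight_shift h] at h2
  rw [show q + 2 = q + 1 + 1 by ring, tight_shift] at h1
  have h3 := h.four' q
  have h4 := h.four' (q + 1)
  have h5 := h.four' (q + 2)
  have h6 := h.four' (q + 3)
  simp only [add_assoc, Int.reduceAdd] at *
  omega

/-- Each sum that grows under the move grows by one only. The two- and four-term sums that grow
belong to the windows `p - 1` and `p - 2`, which are not tight. For the three-term sum ending at
`p`, strictness follows from these windows together with tightness at `p`. -/
theorem InC.mvL {k l p : ℤ} {c : ℤ → ℤ} (h : InC k l c) (hp : IsFirst k l c p) :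
    InC k l (mvL c p) := by
  have h1 := hp.1
  have hone := hp.one_le h
  have h2 := (not_tight_iff h).1 (hp.2 (p - 1) (by omega))
  have h3 := (not_tight_iff h).1 (hp.2 (p - 2) (by omega))
  obtain ⟨q, rfl⟩ : ∃ q, p = q + 4 := ⟨p - 4, by ring⟩
  unfold Tight at h1
  have key : ∀ i, RiggedConfig.mvL c (q + 4) i =
      if i = q + 4 then c (q + 4) + 1 else if i = q + 5 then c (q + 5) - 1 else c i := by
    intro i
    unfold RiggedConfig.mvL
    rw [show q + 4 + 1 = q + 5 by ring]
    split_ifs with h1 h2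
    · rw [h1]
    · rw [h2]
    · rfl
  have g1 := h.four' (q + 1)
  have g2 := h.four' (q + 2)
  have g3 := h.four' (q + 3)
  have g4 := h.four' (q + 4)
  have g5 := h.four' (q + 5)
  have g6 := h.four' (q + 6)
  simp only [add_assoc, add_sub_assoc, Int.reduceAdd, Int.reduceSub] at *
  refine ⟨?_, fun i => ?_, fun i => ?_, fun i => ?_, fun i => ?_⟩
  · refine (h.fin.union (Set.finite_singleton (q + 4))).subset fun i hi => ?_
    by_contra hc
    simp only [Set.mem_union, Function.mem_support, Set.mem_singleton_iff, not_or, not_not] at hc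
    rw [Function.mem_support, key, if_neg hc.2] at hi
    split_ifs at hi with h5
    · subst h5; omega
    · exact hi hc.1
  · rw [key]
    have := h.nn i
    split_ifs <;> omega
  · have := h.three i
    rw [key, key, key]
    by_cases e1 : i = q + 2
    · subst e1; simp only [add_assoc, Int.reduceAdd] at *
      simp; omega
    by_cases e2 : i = q + 3
    · subst e2; simp only [add_assoc, Int.reduceAdd] at *
      simp; omega
    by_cases e2 : i = q + 4
    · subst e2; simp only [add_assoc, Int.reduceAdd] at *
      simp; omega
    by_cases e2 : i = q + 5
    · subst e2; simp only [add_assoc, Int.reduceAdd] at *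
      simp; omega
    rw [if_neg (by omega), if_neg (by omega), if_neg (by omega), if_neg (by omega),
      if_neg (by omega), if_neg (by omega)]
    exact this
  · have := h.two i
    rw [key, key]
    by_cases e2 : i = q + 3
    · subst e2; simp only [add_assoc, Int.reduceAdd] at *
      simp; omega
    by_cases e2 : i = q + 4
    · subst e2; simp only [add_assoc, Int.reduceAdd] at *
      simp; omega
    by_cases e2 : i = q + 5
    · subst e2; simp only [add_assoc, Int.reduceAdd] at *
      simp; omega
    rw [if_neg (by omega), if_neg (by omega), if_neg (by omega), if_neg (by omega)]
    exact this
  · have := h.four i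
    rw [key, key, key, key]
    by_cases e1 : i = q + 1
    · subst e1; simp only [add_assoc, Int.reduceAdd] at *
      simp; omega
    by_cases e1 : i = q + 2
    · subst e1; simp only [add_assoc, Int.reduceAdd] at *
      simp; omega
    by_cases e2 : i = q + 3
    · subst e2; simp only [add_assoc, Int.reduceAdd] at *
      simp; omega
    by_cases e2 : i = q + 4
    · subst e2; simp only [add_assoc, Int.reduceAdd] at *
      simp; omega
    by_cases e2 : i = q + 5
    · subst e2; simp only [add_assoc, Int.reduceAdd] at *
      simp; omega
    rw [if_neg (by omega), if_neg (by omega), if_neg (by omega), if_neg (by omega),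
      if_neg (by omega), if_neg (by omega), if_neg (by omega), if_neg (by omega)]
    exact this

/-- Both sums at the window `p` give `p` and `p + 1` equal weight. Consequently the leftmost tight
window never moves to the right. -/
theorem tight_mvL {k l p : ℤ} {c : ℤ → ℤ} (h : Tight k l c p) : Tight k l (mvL c p) p := by
  unfold Tight at *
  rw [mvL_self, mvL_succ, mvL_of_ne (by omega) (by omega), mvL_of_ne (by omega) (by omega)]
  omega

theorem add_one_add_one (i : ℤ) : i + 1 + 1 = i + 2 := by ring
theorem add_one_add_two (i : ℤ) : i + 1 + 2 = i + 3 := by ring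
theorem add_one_add_three (i : ℤ) : i + 1 + 3 = i + 4 := by ring
theorem add_two_add_one (i : ℤ) : i + 2 + 1 = i + 3 := by ring
theorem add_two_add_two (i : ℤ) : i + 2 + 2 = i + 4 := by ring
theorem add_two_add_three (i : ℤ) : i + 2 + 3 = i + 5 := by ring
theorem add_three_add_one (i : ℤ) : i + 3 + 1 = i + 4 := by ring
theorem add_three_add_two (i : ℤ) : i + 3 + 2 = i + 5 := by ring
theorem add_three_add_three (i : ℤ) : i + 3 + 3 = i + 6 := by ring

/-! ### Injectivity of the move -/

/-- If the two moves took place at windows `p < p'`, then `c` would be tight at `p` while `c'` is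
not. -/
theorem mvL_inj {k l p p' : ℤ} {c c' : ℤ → ℤ} (h : InC k l c) (h' : InC k l c')
    (hp : IsFirst k l c p) (hp' : IsFirst k l c' p') (he : mvL c p = mvL c' p') : c = c' := by
  wlog hlt : p ≤ p' generalizing c c' p p'
  · exact (this h' h hp' hp he.symm (by omega)).symm
  rcases hlt.eq_or_lt with rfl | hlt
  · funext i
    have := congrFun he i
    unfold mvL at this
    split_ifs at this <;> omega
  exfalso
  have ht := (not_tight_iff h').1 (hp'.2 p hlt)
  have hT := hp.1
  have hT' := hp'.1
  unfold Tight at hT hT'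
  have e : ∀ i, c i = (if i = p' then c' i + 1 else if i = p' + 1 then c' i - 1 else c' i) -
      (if i = p then 1 else if i = p + 1 then -1 else 0) := by
    intro i
    have := congrFun he i
    unfold mvL at this
    split_ifs at this ⊢ <;> omega
  -- For `p' > p + 2` the change made at `p'` does not reach the window `p`, and the one made at `p`
  -- leaves its sums unchanged, so `c'` would be tight at `p` as well. Only `p' = p + 1` and `p' = p
  -- + 2` need the constraints.
  by_cases h3 : p + 2 < p'
  · rw [e p, e (p + 1), e (p - 1), e (p + 2)] at hT
    rw [if_neg (by omega), if_neg (by omega), if_pos rfl, if_neg (by omega), if_neg (by omega),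
      if_neg (by omega), if_pos rfl, if_neg (by omega), if_neg (by omega), if_neg (by omega),
      if_neg (by omega), if_neg (by omega), if_neg (by omega), if_neg (by omega),
      if_neg (by omega)] at hT
    omega
  obtain ⟨q, rfl⟩ : ∃ q, p = q + 1 := ⟨p - 1, by ring⟩
  have a0 := h.four' q
  have a1 := h.four' (q + 1)
  have a2 := h.four' (q + 2)
  have a3 := h.four' (q + 3)
  have b0 := h'.four' q
  have b1 := h'.four' (q + 1)
  have b2 := h'.four' (q + 2)
  have b3 := h'.four' (q + 3)
  simp only [add_assoc, add_sub_assoc, Int.reduceAdd, Int.reduceSub, add_zero] at *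
  have e0 := e q
  have e1 := e (q + 1)
  have e2 := e (q + 2)
  have e3 := e (q + 3)
  have e4 := e (q + 4)
  have e5 := e (q + 5)
  have e6 := e (q + 6)
  obtain rfl | rfl : p' = q + 2 ∨ p' = q + 3 := by omega
  · simp only [add_assoc, add_sub_assoc, Int.reduceAdd, Int.reduceSub, add_zero] at *
    simp at e0 e1 e2 e3 e4 e5 e6
    omega
  · simp only [add_assoc, add_sub_assoc, Int.reduceAdd, Int.reduceSub, add_zero] at *
    simp at e0 e1 e2 e3 e4 e5 e6
    omega

/-! ### Splittings -/

/-- `v` is the splitting of `c` with capacity `s`. -/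
structure IsSplit (k s : ℤ) (c v : ℤ → ℤ) : Prop where
  succ : ∀ i, v (i + 1) = min (c (i + 1)) (min (s - v i) (k - c i - c (i + 1) - c (i + 2)))
  zero : ∃ lo, ∀ i ≤ lo, v i = 0

/-- The recursion runs from left to right and looks one site ahead: `v i` depends on the entries of
`c` up to `i + 1`. -/
theorem IsSplit.eq_of_le {k s j : ℤ} {c c' v v' : ℤ → ℤ} (h : IsSplit k s c v)
    (h' : IsSplit k s c' v') (hc : ∀ i ≤ j + 1, c i = c' i) : ∀ i ≤ j, v i = v' i := by
  obtain ⟨lo, hlo⟩ := h.zero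
  obtain ⟨lo', hlo'⟩ := h'.zero
  intro i hi
  by_cases hil : i ≤ min lo lo'
  · rw [hlo i (by omega), hlo' i (by omega)]
  have := Int.leInduction (m := min lo lo') (motive := fun n _ => n ≤ j → v n = v' n)
    (fun _ => by rw [hlo _ (by omega), hlo' _ (by omega)])
    (fun n _ ih hn => by
      rw [h.succ, h'.succ, ih (by omega), hc n (by omega), hc (n + 1) (by omega),
        hc (n + 2) (by omega)]) i (by omega)
  exact this hi

theorem IsSplit.unique {k s : ℤ} {c v v' : ℤ → ℤ} (h : IsSplit k s c v) (h' : IsSplit k s c v') :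
    v = v' :=
  funext fun i => h.eq_of_le h' (j := i) (fun _ _ => rfl) i le_rfl

theorem IsSplit.eq_of_ge {k s j : ℤ} {c c' v v' : ℤ → ℤ} (h : IsSplit k s c v)
    (h' : IsSplit k s c' v') (hj : v j = v' j) (hc : ∀ i ≥ j, c i = c' i) :
    ∀ i ≥ j, v i = v' i := by
  intro i hi
  refine Int.leInduction (m := j) (motive := fun n _ => v n = v' n) hj (fun n hn ih => ?_) i hi
  rw [h.succ, h'.succ, ih, hc n (by omega), hc (n + 1) (by omega), hc (n + 2) (by omega)]

/-- The values of a splitting, started at `lo`. -/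
def splAux (k s : ℤ) (c : ℤ → ℤ) (lo : ℤ) : ℕ → ℤ
  | 0 => 0
  | n + 1 => min (c (lo + n + 1)) (min (s - splAux k s c lo n)
      (k - c (lo + n) - c (lo + n + 1) - c (lo + n + 2)))

theorem exists_isSplit {k l s : ℤ} {c : ℤ → ℤ} (h : InC k l c) (hs : 0 ≤ s) :
    ∃ v, IsSplit k s c v := by
  obtain ⟨lo, hlo⟩ := exists_zero_below h.fin
  refine ⟨fun i => splAux k s c lo (i - lo).toNat, ⟨fun i => ?_, lo, fun i hi => ?_⟩⟩
  · by_cases hi : lo ≤ i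
    · obtain ⟨n, rfl⟩ : ∃ n : ℕ, i = lo + n := ⟨(i - lo).toNat, by omega⟩
      rw [show (lo + (n : ℤ) + 1 - lo).toNat = n + 1 by omega,
        show (lo + (n : ℤ) - lo).toNat = n by omega]
      rfl
    -- Before the start both values are the default `0`; this satisfies the recursion because `c`
    -- vanishes there and the other two bounds are non-negative.
    · rw [show (i + 1 - lo).toNat = 0 by omega, show (i - lo).toNat = 0 by omega,
        hlo i (by omega), hlo (i + 1) (by omega)]
      have := h.three i
      rw [hlo i (by omega), hlo (i + 1) (by omega)] at this
      simp only [splAux]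
      omega
  · simp only [show (i - lo).toNat = 0 by omega, splAux]

open Classical in
/-- The splitting of `c` with capacity `s`. -/
noncomputable def spl (k s : ℤ) (c : ℤ → ℤ) : ℤ → ℤ :=
  if h : ∃ v, IsSplit k s c v then h.choose else 0

theorem InC.isSplit {k l s : ℤ} {c : ℤ → ℤ} (h : InC k l c) (hs : 0 ≤ s) :
    IsSplit k s c (spl k s c) := by
  have := exists_isSplit h hs
  rw [spl, dif_pos this]
  exact this.choose_spec

theorem IsSplit.bounds {k l s : ℤ} {c v : ℤ → ℤ} (hv : IsSplit k s c v) (h : InC k l c)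
    (hs : 0 ≤ s) (i : ℤ) : 0 ≤ v i ∧ v i ≤ s := by
  obtain ⟨lo, hlo⟩ := hv.zero
  by_cases hi : i ≤ lo
  · rw [hlo i hi]; omega
  refine Int.leInduction (m := lo) (motive := fun n _ => 0 ≤ v n ∧ v n ≤ s)
    (by rw [hlo lo le_rfl]; omega) (fun n _ ih => ?_) i (by omega)
  have := hv.succ n
  have := h.nn (n + 1)
  have := h.three n
  omega

theorem IsSplit.facts {k l s : ℤ} {c v : ℤ → ℤ} (hv : IsSplit k s c v) (h : InC k l c)
    (hs : 0 ≤ s) (i : ℤ) : 0 ≤ v i ∧ v i ≤ c i ∧ v i + v (i + 1) ≤ s ∧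
      v (i + 1) ≤ k - c i - c (i + 1) - c (i + 2) ∧
      v (i + 1) = min (c (i + 1)) (min (s - v i) (k - c i - c (i + 1) - c (i + 2))) := by
  have h1 := hv.bounds h hs i
  have h2 := hv.succ i
  have h3 := hv.succ (i - 1)
  rw [show i - 1 + 1 = i by ring] at h3
  omega

/-- Move the part of `c` that is not in the splitting one step to the left. -/
noncomputable def kap (k s : ℤ) (c : ℤ → ℤ) : ℤ → ℤ :=
  fun i => spl k s c i + (c (i + 1) - spl k s c (i + 1))

theorem InC.kap {k l s : ℤ} {c : ℤ → ℤ} (h : InC k l c) (hs : 0 ≤ s) (hsl : s ≤ k - l) :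
    InC k l (kap k s c) := by
  have hv := h.isSplit hs
  set v := spl k s c with hvd
  have key : ∀ i, RiggedConfig.kap k s c i = v i + (c (i + 1) - v (i + 1)) := fun i => rfl
  refine ⟨?_, fun i => ?_, fun i => ?_, fun i => ?_, fun i => ?_⟩
  · refine (h.fin.union (h.fin.image (· - 1))).subset fun i hi => ?_
    by_contra hc
    simp only [Set.mem_union, Function.mem_support, Set.mem_image, not_or, not_not, not_exists,
      not_and] at hc
    have h1 := hc.1
    have h2 : c (i + 1) = 0 := by
      by_contra h3
      exact hc.2 (i + 1) h3 (by ring)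
    rw [Function.mem_support, key] at hi
    have := hv.facts h hs i
    have := hv.facts h hs (i + 1)
    omega
  · rw [key]
    have := hv.facts h hs i
    have := hv.facts h hs (i + 1)
    omega
  · rw [key, key, key]
    have a0 := hv.facts h hs i
    have a1 := hv.facts h hs (i + 1)
    have a2 := hv.facts h hs (i + 2)
    have b0 := h.three i
    have b1 := h.four (i + 1)
    simp only [add_one_add_one, add_one_add_two, add_one_add_three, add_two_add_one, add_two_add_two,
      add_two_add_three, add_three_add_one, add_three_add_two, add_three_add_three] at *
    exact kap_three hsl a0.2.1 (by omega) b0 b1 a1.2.2.2.1 a2.2.2.2.2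
  · rw [key, key]
    have a0 := hv.facts h hs i
    have a1 := hv.facts h hs (i + 1)
    have b0 := h.two i
    have b1 := h.two (i + 1)
    have b2 := h.four i
    simp only [add_one_add_one, add_one_add_two, add_one_add_three, add_two_add_one, add_two_add_two,
      add_two_add_three, add_three_add_one, add_three_add_two, add_three_add_three] at *
    exact kap_two a0.2.1 a0.2.2.1 b0 b1 b2 a1.2.2.2.2
  · rw [key, key, key, key]
    have a0 := hv.facts h hs i
    have a1 := hv.facts h hs (i + 1)
    have a2 := hv.facts h hs (i + 2)
    have a3 := hv.facts h hs (i + 3)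
    have b0 := h.four' i
    have b1 := h.four' (i + 1)
    have b2 := h.four' (i + 2)
    have b3 := h.four' (i + 3)
    simp only [add_one_add_one, add_one_add_two, add_one_add_three, add_two_add_one, add_two_add_two,
      add_two_add_three, add_three_add_one, add_three_add_two, add_three_add_three] at *
    exact kap_four hsl a0.2.1 a1.2.1 a0.2.2.1 b0.2.1 b1.2.1 b2.2.1 b0.2.2.1 b1.2.2.1 b2.2.2.1
      b3.2.2.1 b0.2.2.2 b1.2.2.2 b2.2.2.2 a0.2.2.2.1 a1.2.2.2.2 a2.2.2.2.2 a3.2.2.2.2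

/-- A window of `kap k s c` is not tight if the three windows of `c` that it sees are not. -/
theorem not_tight_kap {k l s p : ℤ} {c : ℤ → ℤ} (h : InC k l c) (hs : 0 ≤ s) (hsl : s ≤ k - l)
    (h0 : ¬ Tight k l c p) (h1 : ¬ Tight k l c (p + 1)) (h2 : ¬ Tight k l c (p + 2)) :
    ¬ Tight k l (kap k s c) p := by
  have hv := h.isSplit hs
  obtain ⟨i, rfl⟩ : ∃ i, p = i + 1 := ⟨p - 1, by ring⟩
  rw [not_tight_shift (h.kap hs hsl)]
  rw [show i + 1 + 2 = i + 2 + 1 by ring, not_tight_shift h] at h2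
  rw [not_tight_shift h] at h0 h1
  have a0 := hv.facts h hs i
  have a1 := hv.facts h hs (i + 1)
  have a2 := hv.facts h hs (i + 2)
  have a3 := hv.facts h hs (i + 3)
  unfold RiggedConfig.kap
  simp only [add_one_add_one, add_one_add_two, add_one_add_three, add_two_add_one, add_two_add_two,
      add_two_add_three, add_three_add_one, add_three_add_two, add_three_add_three] at *
  exact kap_strict hsl a0.2.1 a1.2.1 a0.2.2.1 h0.1 h1.1 h0.2 h1.2 h2.2 a0.2.2.2.1 a1.2.2.2.2
      a2.2.2.2.2 a3.2.2.2.2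

/-- Splitting off a carrier commutes with moving the leftmost particle of maximal weight. -/
theorem kap_mvL {k l s p : ℤ} {c : ℤ → ℤ} (h : InC k l c) (hs : 0 ≤ s) (hsl : s ≤ k - l)
    (hp : IsFirst k l c p) :
    ∃ p', p - 2 ≤ p' ∧ p' ≤ p ∧ IsFirst k l (kap k s c) p' ∧
      kap k s (mvL c p) = mvL (kap k s c) p' := by
  have h' := h.mvL hp
  have hv := h.isSplit hs
  have hv' := h'.isSplit hs
  have hK := h.kap hs hsl
  obtain ⟨q, rfl⟩ : ∃ q, p = q + 3 := ⟨p - 3, by ring⟩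
  have T := hp.1
  have n1 := (not_tight_shift h).1 (hp.2 (q + 1) (by omega))
  have n2 := (not_tight_shift h).1 (hp.2 (q + 1 + 1) (by omega))
  have n0 := (not_tight_shift h).1 (hp.2 (q - 1 + 1) (by omega))
  have n1' := (not_tight_shift h).1 (hp.2 (q + 1) (by omega))
  rw [show q + 3 = q + 2 + 1 by ring, tight_shift] at T
  have a0 := hv.facts h hs q
  have a1 := hv.facts h hs (q + 1)
  have a2 := hv.facts h hs (q + 2)
  have a3 := hv.facts h hs (q + 3)
  have a4 := hv.facts h hs (q + 4)
  have a5 := hv.facts h hs (q + 5)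
  have b0 := h.four' q
  have b1 := h.four' (q + 1)
  have b2 := h.four' (q + 2)
  have b3 := h.four' (q + 3)
  have b4 := h.four' (q + 4)
  have r1 := hv'.succ (q + 1)
  have r2 := hv'.succ (q + 2)
  have r3 := hv'.succ (q + 3)
  have r4 := hv'.succ (q + 4)
  have hle := hv.eq_of_le hv' (j := q + 1)
    fun i hi => (mvL_of_ne (c := c) (p := q + 3) (by omega) (by omega)).symm
  have hge := hv.eq_of_ge hv' (j := q + 5) (hc := fun i hi =>
    (mvL_of_ne (c := c) (p := q + 3) (by omega) (by omega)).symm)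
  have hx' := hle (q + 1) le_rfl
  have m0 := mvL_self c (q + 3)
  have m1 := mvL_succ c (q + 3)
  have m2 : mvL c (q + 3) (q + 1) = c (q + 1) := mvL_of_ne (by omega) (by omega)
  have m3 : mvL c (q + 3) (q + 2) = c (q + 2) := mvL_of_ne (by omega) (by omega)
  have m4 : mvL c (q + 3) (q + 5) = c (q + 5) := mvL_of_ne (by omega) (by omega)
  have m5 : mvL c (q + 3) (q + 6) = c (q + 6) := mvL_of_ne (by omega) (by omega)
  -- A window `r ≤ q` of `kap` sees the windows `r`, `r + 1`, `r + 2` of `c`, all to the left of the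
  -- tight one.
  have hnt : ∀ r ≤ q, ¬ Tight k l (kap k s c) r := fun r hr =>
    not_tight_kap h hs hsl (hp.2 _ (by omega)) (hp.2 _ (by omega)) (hp.2 _ (by omega))
  have key : ∀ i, kap k s c i = spl k s c i + (c (i + 1) - spl k s c (i + 1)) := fun i => rfl
  have key' : ∀ i, kap k s (mvL c (q + 3)) i =
    spl k s (mvL c (q + 3)) i + (mvL c (q + 3) (i + 1) - spl k s (mvL c (q + 3)) (i + 1)) :=
    fun i => rfl
  have k0 := key q
  have k1 := key (q + 1)
  have k2 := key (q + 2)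
  have k3 := key (q + 3)
  have k4 := key (q + 4)
  have k1' := key' (q + 1)
  have k2' := key' (q + 2)
  have k3' := key' (q + 3)
  have k4' := key' (q + 4)
  have t0 := @not_tight_shift k l q _ hK
  have t1 := @not_tight_shift k l (q + 1) _ hK
  have t2 := @tight_shift k l q (kap k s c)
  have t3 := @tight_shift k l (q + 1) (kap k s c)
  have t4 := @tight_shift k l (q + 2) (kap k s c)
  have d1 := hK.four' q
  have d2 := hK.four' (q + 1)
  have d3 := hK.four' (q + 2)
  have low : ∀ i ≤ q, kap k s (mvL c (q + 3)) i = kap k s c i := fun i hi => by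
    rw [key, key', hle i (by omega), hle (i + 1) (by omega), mvL_of_ne (by omega) (by omega)]
  have high : spl k s c (q + 5) = spl k s (mvL c (q + 3)) (q + 5) → ∀ i ≥ q + 5,
      kap k s (mvL c (q + 3)) i = kap k s c i := fun e i hi => by
    rw [key, key', hge e i (by omega), hge e (i + 1) (by omega), mvL_of_ne (by omega) (by omega)]
  have e3 : q - 1 + 1 = q := by ring
  have e4 : q - 1 + 2 = q + 1 := by ring
  have e5 : q - 1 + 3 = q + 2 := by ring
  simp only [add_one_add_one, add_one_add_two, add_one_add_three, add_two_add_one,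
    add_two_add_two, add_two_add_three, add_three_add_one, add_three_add_two,
    add_three_add_three, e3, e4, e5] at *
  have e1 : q + 4 + 1 = q + 5 := by ring
  have e2 : q + 4 + 2 = q + 6 := by ring
  simp only [e1, e2] at *
  clear e1 e2 e3 e4 e5
  rw [m2, m3, m0, ← hx'] at r1
  rw [m3, m0, m1] at r2
  rw [m0, m1, m4] at r3
  rw [m1, m4, m5] at r4
  rw [m3, ← hx'] at k1'
  rw [m0] at k2'
  rw [m1] at k3'
  rw [m4] at k4'
  have hfin : ∀ p', (∀ i, q < i → i < q + 5 → kap k s (mvL c (q + 3)) i = mvL (kap k s c) p' i) →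
      spl k s c (q + 5) = spl k s (mvL c (q + 3)) (q + 5) → q < p' → p' < q + 4 →
      kap k s (mvL c (q + 3)) = mvL (kap k s c) p' := by
    intro p' hp1 hp2 hp3 hp4
    funext i
    rcases le_or_gt i q with hi | hi
    · rw [low i hi, mvL_of_ne (by omega) (by omega)]
    rcases le_or_gt (q + 5) i with hi' | hi'
    · rw [high hp2 i hi', mvL_of_ne (by omega) (by omega)]
    exact hp1 i hi hi'
  obtain ⟨ht, hcase⟩ := split_move hsl n2.1 b4.2.1 b3.2.1 n2.2 b3.2.2.2 T a1.2.2.2.2 a2.2.2.2.2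
    a3.2.2.2.2 a4.2.2.2.2 r1 r2 r3 r4
  have hs4 : ∀ i, q < i → i < q + 5 → i = q + 1 ∨ i = q + 2 ∨ i = q + 3 ∨ i = q + 4 := by
    intro i; omega
  -- The moved unit is either outside the splitting, and then `kap` shows the move one site further
  -- left; or it belongs to the splitting, and the move is seen in place; or it pushes a unit of the
  -- splitting one site to the right, and the net effect on `kap` is a move two sites further left.
  rcases hcase with ⟨hy, hz, hw, hB⟩ | ⟨hy, hz, hw, hd, hB1, hB2⟩ | ⟨hy, hz, hw, hyE, hwE, T4⟩
  · rw [hy] at r1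
    refine ⟨q + 2, by omega, by omega, ⟨?_, fun r hr => ?_⟩, hfin _ ?_ ht.symm (by omega) (by omega)⟩
    · rw [t3, k1, k2, k3, k4]
      rw [k1, k2, k3, k4] at d2
      rw [k2, k3] at d3
      have z3 := min_three a2.2.2.2.2
      have z1 := min_three r1
      exact kap_tight_one hsl a1.2.1 a1.1 a4.1 a2.1 a3.1 a5.1 a3.2.1 n1.1 n2.1 b4.2.1 b3.2.1 n2.2
        b2.2.2.2 b3.2.2.2 T a2.2.1 z1.2.1 z1.2.2.1 (by clear * - a1 z1; omega) z3.2.1 z3.2.2.1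
        a3.2.2.2.2 a4.2.2.2.2 hB d3.2.1 d2.2.2.2
    · rcases (show r ≤ q ∨ r = q + 1 by omega) with hr | rfl
      · exact hnt r hr
      · rw [t0, k0, k1, k2, k3]
        exact kap_not_tight_two hsl a1.2.1 a0.2.2.1 a1.2.2.1 n1.1 n2.1 b3.2.1 n1.2 n2.2
          b2.2.2.2 a0.2.1 a0.2.2.2.1 a1.2.2.2.2 a2.2.2.2.2 a3.2.2.2.2 r1
    · rintro i hi1 hi2
      simp only [mvL]
      rcases hs4 i hi1 hi2 with rfl | rfl | rfl | rfl <;> split_ifs <;> omega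
  · rw [hy] at r1
    refine ⟨q + 3, by omega, by omega, ⟨?_, fun r hr => ?_⟩, hfin _ ?_ ht.symm (by omega) (by omega)⟩
    · have := (kap_not_tight_one hsl a1.2.2.1 n2.1 b4.2.1 b3.2.1 n2.2 b2.2.2.2 b3.2.2.2 T
        a1.2.2.2.2 (hd ▸ a3.2.2.2.2) a4.2.2.2.2 hB1 hB2).2
      rw [t4, k3, k4, hd]
      exact .inl this
    · rcases (show r ≤ q ∨ r = q + 1 ∨ r = q + 2 by omega) with hr | rfl | rfl
      · exact hnt r hr
      · rw [t0, k0, k1, k2, k3]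
        exact kap_not_tight_two hsl a1.2.1 a0.2.2.1 a1.2.2.1 n1.1 n2.1 b3.2.1 n1.2 n2.2
          b2.2.2.2 a0.2.1 a0.2.2.2.1 a1.2.2.2.2 a2.2.2.2.2 a3.2.2.2.2 r1
      · have := (kap_not_tight_one hsl a1.2.2.1 n2.1 b4.2.1 b3.2.1 n2.2 b2.2.2.2 b3.2.2.2 T
          a1.2.2.2.2 (hd ▸ a3.2.2.2.2) a4.2.2.2.2 hB1 hB2).1
        rw [t1, k1, k2, k3, k4, hd]
        exact this
    · rintro i hi1 hi2
      simp only [mvL]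
      rcases hs4 i hi1 hi2 with rfl | rfl | rfl | rfl <;> split_ifs <;> omega
  · refine ⟨q + 1, by omega, by omega, ⟨?_, fun r hr => hnt r (by omega)⟩,
      hfin _ ?_ ht.symm (by omega) (by omega)⟩
    · rw [t2, k0, k1, k2, k3]
      exact kap_tight_two hsl a0.2.1 n1.1 n2.1 n1.2 n2.2 T4 a0.2.2.2.2 hyE
        (by clear * - a1; omega) a2.2.2.2.2 hwE (by clear * - a3; omega)
    · rintro i hi1 hi2
      simp only [mvL]
      rcases hs4 i hi1 hi2 with rfl | rfl | rfl | rfl <;> split_ifs <;> omega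

/-! ### Extraction of a particle -/

/-- The isolated particle of weight `l` and energy `t`. -/
def free (l t : ℤ) : ℤ → ℤ :=
  fun i => if i = t / l then l - t % l else if i = t / l + 1 then t % l else 0

theorem free_apply {l m y t : ℤ} (hl : 1 ≤ l) (hy : 0 ≤ y) (hyl : y ≤ l) (ht : t = l * m + y)
    (i : ℤ) : free l t i = if i = m then l - y else if i = m + 1 then y else 0 := by
  subst ht
  unfold free
  rcases hyl.eq_or_lt with rfl | hyl
  · rw [show y * m + y = y * (m + 1) by ring, Int.mul_ediv_cancel_left _ (by omega),
      Int.mul_emod_right]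
    split_ifs <;> omega
  · rw [show l * m + y = y + l * m by ring, Int.add_mul_ediv_left _ _ (by omega),
      Int.add_mul_emod_self_left, Int.ediv_eq_zero_of_lt hy hyl, Int.emod_eq_of_lt hy hyl, zero_add]

theorem free_nonneg {l : ℤ} (hl : 1 ≤ l) (t i : ℤ) : 0 ≤ free l t i := by
  have := Int.emod_nonneg t (show l ≠ 0 by omega)
  have := Int.emod_lt_of_pos t (show 0 < l by omega)
  unfold free
  split_ifs <;> omega

theorem exists_div (l t : ℤ) (hl : 1 ≤ l) :
    ∃ z, 0 ≤ z ∧ z < l ∧ t = l * (t / l) + z :=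
  ⟨t % l, Int.emod_nonneg t (by omega), Int.emod_lt_of_pos t (by omega),
    (Int.mul_ediv_add_emod t l).symm⟩

/-- The window is `(t - 1) / l` and not `t / l` because for `l ∣ t` the particle sits wholly on the
site `t / l`, and the window ending there is already tight. -/
theorem free_move {k l t : ℤ} {c : ℤ → ℤ} (hl : 1 ≤ l) (hlk : l ≤ k)
    (hc : ∀ i ≤ (t - 1) / l + 1, c i = 0) :
    IsFirst k l (c + free l t) ((t - 1) / l) ∧
      mvL (c + free l t) ((t - 1) / l) = c + free l (t - 1) := by
  obtain ⟨z, hz0, hzl, hz⟩ := exists_div l (t - 1) hl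
  set P := (t - 1) / l
  have h1 := free_apply (t := t) (y := z + 1) hl (by omega) (by omega)
    (show t = l * P + (z + 1) by omega)
  have h2 := free_apply (t := t - 1) hl hz0 hzl.le hz
  refine ⟨⟨?_, fun q hq => ?_⟩, ?_⟩
  · refine .inl ?_
    simp only [Pi.add_apply, h1, hc P (by omega), hc (P + 1) le_rfl]
    simp
  · simp only [Tight, Pi.add_apply, h1, hc q (by omega), hc (q + 1) (by omega),
      hc (q - 1) (by omega), hc (q + 2) (by omega)]
    split_ifs <;> omega
  · funext i
    simp only [mvL, Pi.add_apply, h1, h2]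
    split_ifs <;> omega

/-- `Ext k l c c' ρ`: the configuration `c` is obtained from `c'` by inserting a particle of
weight `l` and energy `ρ`. -/
inductive Ext (k l : ℤ) : (ℤ → ℤ) → (ℤ → ℤ) → ℤ → Prop
  | free (c : ℤ → ℤ) (t : ℤ) (h : InC k l (c + free l t)) (hc : ∀ i ≤ t / l + 3, c i = 0) :
      Ext k l (c + RiggedConfig.free l t) c t
  | step (c d : ℤ → ℤ) (p ρ : ℤ) (h : InC k l c) (hp : IsFirst k l c p)
      (he : Ext k l (mvL c p) d ρ) : Ext k l c d (ρ + 1)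

theorem sub_one_ediv_le {l t : ℤ} (hl : 1 ≤ l) : (t - 1) / l ≤ t / l :=
  Int.ediv_le_ediv (by omega) (by omega)

theorem Ext.inC {k l ρ : ℤ} {c d : ℤ → ℤ} (h : Ext k l c d ρ) : InC k l c := by
  cases h <;> assumption

theorem Ext.isFirst {k l ρ : ℤ} {c d : ℤ → ℤ} (hl : 1 ≤ l) (hlk : l ≤ k) (h : Ext k l c d ρ) :
    ∃ p, IsFirst k l c p := by
  cases h with
  | free _ _ h hc =>
    have := sub_one_ediv_le (t := ρ) hl
    exact ⟨_, (free_move hl hlk fun i hi => hc i (by omega)).1⟩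
  | step _ _ p _ _ hp => exact ⟨p, hp⟩

theorem Ext.move {k l ρ p : ℤ} {c d : ℤ → ℤ} (hl : 1 ≤ l) (hlk : l ≤ k) (h : Ext k l c d ρ)
    (hp : IsFirst k l c p) : Ext k l (mvL c p) d (ρ - 1) := by
  cases h with
  | free _ _ h hc =>
    have h1 := sub_one_ediv_le (t := ρ) hl
    obtain ⟨h2, h3⟩ := free_move (k := k) (c := d) (t := ρ) hl hlk fun i hi => hc i (by omega)
    have h4 := h.mvL hp
    rw [hp.unique h2, h3] at h4 ⊢
    exact .free _ _ h4 fun i hi => hc i (by omega)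
  | step _ _ p' ρ' _ hp' he =>
    rw [hp.unique hp', add_sub_cancel_right]
    exact he

theorem free_inj_aux {l t t' : ℤ} {d d' : ℤ → ℤ} (hl : 1 ≤ l) (hd : ∀ i ≤ t / l + 3, d i = 0)
    (hd' : ∀ i ≤ t' / l + 3, d' i = 0) (h : d + free l t = d' + free l t') (hle : t / l ≤ t' / l) :
    d = d' ∧ t = t' := by
  obtain ⟨z, hz0, hzl, hz⟩ := exists_div l t hl
  obtain ⟨z', hz0', hzl', hz'⟩ := exists_div l t' hl
  have h1 := free_apply hl hz0 hzl.le hz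
  have h2 := free_apply hl hz0' hzl'.le hz'
  set m := t / l
  set m' := t' / l
  have e1 := congrFun h m
  have e2 := congrFun h (m + 1)
  simp only [Pi.add_apply, h1, h2, hd m (by omega), hd (m + 1) (by omega), hd' m (by omega),
    hd' (m + 1) (by omega)] at e1 e2
  have hm : m = m' := by
    by_contra hne
    rw [if_pos trivial, if_neg (by omega), if_neg (by omega)] at e1
    omega
  have hzz : z = z' := by
    rw [← hm] at e1
    simp at e1
    omega
  have htt : t = t' := by rw [hz, hz', hm, hzz]
  rw [htt] at h
  exact ⟨add_right_cancel h, htt⟩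

theorem free_inj {l t t' : ℤ} {d d' : ℤ → ℤ} (hl : 1 ≤ l) (hd : ∀ i ≤ t / l + 3, d i = 0)
    (hd' : ∀ i ≤ t' / l + 3, d' i = 0) (h : d + free l t = d' + free l t') : d = d' ∧ t = t' := by
  rcases le_total (t / l) (t' / l) with hle | hle
  · exact free_inj_aux hl hd hd' h hle
  · obtain ⟨h1, h2⟩ := free_inj_aux hl hd' hd h.symm hle
    exact ⟨h1.symm, h2.symm⟩

/-- The two constructors overlap, since a free particle can also be moved. Every move is forced by
the uniqueness of the leftmost tight window, so two derivations can be compared move by move until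
both particles are free; there the energies and remainders can be read off. -/
theorem Ext.unique {k l ρ ρ' : ℤ} {c d d' : ℤ → ℤ} (hl : 1 ≤ l) (hlk : l ≤ k)
    (h : Ext k l c d ρ) (h' : Ext k l c d' ρ') : d = d' ∧ ρ = ρ' := by
  induction h generalizing d' ρ' with
  | free d t h hc =>
    generalize he : d + RiggedConfig.free l t = c at h'
    induction h' generalizing t with
    | free d' t' h' hc' => exact free_inj hl hc hc' he
    | step c d' p ρ hin hp h' ih =>
      have h1 := sub_one_ediv_le (t := t) hl
      obtain ⟨h2, h3⟩ := free_move (k := k) (c := d) (t := t) hl hlk fun i hi => hc i (by omega)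
      rw [he] at h2 h3
      obtain ⟨e1, e2⟩ := ih (t - 1) (by rw [← h3]; exact hin.mvL h2) (fun i hi => hc i (by omega))
        (by rw [hp.unique h2, h3])
      exact ⟨e1, by omega⟩
  | step c d p ρ hin hp h ih =>
    obtain ⟨e1, e2⟩ := ih (h'.move hl hlk hp)
    exact ⟨e1, by omega⟩

/-- Two insertions of equal energy into `d` are moved left in parallel until they coincide as free
particles; `mvL_inj` then leads back up. -/
theorem Ext.inj {k l ρ : ℤ} {c c' d : ℤ → ℤ} (hl : 1 ≤ l) (hlk : l ≤ k)
    (h : Ext k l c d ρ) (h' : Ext k l c' d ρ) : c = c' := by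
  induction h generalizing c' with
  | free d t h hc =>
    induction h' with
    | free => rfl
    | step c' d ρ p hin hp h' ih =>
      have h1 := sub_one_ediv_le (t := p + 1) hl
      obtain ⟨h2, h3⟩ := free_move (k := k) (c := d) (t := p + 1) hl hlk
        fun i hi => hc i (by omega)
      rw [add_sub_cancel_right] at h1 h2 h3
      have h4 := h.mvL h2
      rw [h3] at h4
      exact mvL_inj h hin h2 hp (h3.trans (ih h4 fun i hi => hc i (by omega)))
  | step c d p ρ hin hp h ih =>
    obtain ⟨p', hp'⟩ := h'.isFirst hl hlk
    have := h'.move hl hlk hp'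
    rw [add_sub_cancel_right] at this
    exact mvL_inj hin h'.inC hp hp' (ih this)

/-- The constructor asks for a wide gap, so that carriers do not mix the particle with the rest. A
gap reaching just beyond the particle suffices: move it far to the left and come back. -/
theorem ext_free {k l t : ℤ} {c : ℤ → ℤ} (hl : 1 ≤ l) (hlk : l ≤ k)
    (h : InC k l (c + free l t)) (hc : ∀ i ≤ (t - 1) / l + 1, c i = 0) :
    Ext k l (c + free l t) c t := by
  have key : ∀ (n : ℕ) (t : ℤ), InC k l (c + free l t) → (∀ i ≤ (t - 1) / l + 1, c i = 0) →
      (∀ i ≤ (t - n) / l + 3, c i = 0) → Ext k l (c + free l t) c t := by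
    intro n
    induction n with
    | zero =>
      intro t h _ hc'
      simp only [Nat.cast_zero, sub_zero] at hc'
      exact .free _ _ h hc'
    | succ n ih =>
      intro t h hc hc'
      obtain ⟨h2, h3⟩ := free_move (k := k) (c := c) (t := t) hl hlk hc
      have h4 := h.mvL h2
      rw [h3] at h4
      have h5 := sub_one_ediv_le (t := t - 1) hl
      have h6 := ih (t - 1) h4 (fun i hi => hc i (by omega)) fun i hi => hc' i (by
        rwa [show t - ((n + 1 : ℕ) : ℤ) = t - 1 - n by push_cast; ring])
      rw [← h3] at h6
      have := Ext.step _ _ _ _ h h2 h6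
      rwa [sub_add_cancel] at this
  -- After `2 * l + 1` moves the required zero range `(t - (2 * l + 1)) / l + 3` is exactly `(t - 1)
  -- / l + 1`.
  refine key (2 * l + 1).toNat t h hc fun i hi => hc i ?_
  rw [show t - ((2 * l + 1).toNat : ℤ) = t - 1 + l * (-2) by omega,
    Int.add_mul_ediv_left _ _ (by omega)] at hi
  omega

theorem mass_of_tight_of_zero {k l p : ℤ} {c : ℤ → ℤ} (hl : 1 ≤ l) (h : InC k l c)
    (hp : Tight k l c p) (hc : ∀ i ≤ p, c i = 0) : c (p + 1) = l := by
  unfold Tight at hp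
  have h1 := h.three p
  have h2 := h.two (p + 1)
  have h3 := h.nn (p + 1)
  rw [hc p le_rfl] at hp h1
  rw [hc (p - 1) (by omega)] at hp
  rw [add_one_add_one] at h2
  have h4 := h.two p
  rw [hc p le_rfl] at h4
  omega

/-- A move either shifts the leftmost tight window to the left or keeps it and lowers `c (p + 1)`,
so the pair `(p - lo, c (p + 1))` decreases lexicographically. Once `p ≤ lo`, nothing lies to the
left and all `l` units sit on the site `p + 1`. -/
theorem exists_ext {k l : ℤ} {c : ℤ → ℤ} (hl : 1 ≤ l) (hlk : l ≤ k) (h : InC k l c)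
    (hc : ¬ InC k (l - 1) c) : ∃ d ρ, Ext k l c d ρ := by
  have hp : ∃ p, IsFirst k l c p := by
    rw [inC_pred_iff] at hc
    push Not at hc
    obtain ⟨p, hp⟩ := hc h
    exact exists_isFirst h hl hp
  obtain ⟨p, hp⟩ := hp
  obtain ⟨lo, hlo⟩ := exists_zero_below h.fin
  clear hc
  have key : ∀ (n m : ℕ) (c : ℤ → ℤ) (p : ℤ), InC k l c → IsFirst k l c p →
      (∀ i ≤ lo, c i = 0) → p - lo ≤ n → c (p + 1) ≤ m → ∃ d ρ, Ext k l c d ρ := by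
    intro n
    induction n with
    | zero =>
      intro m c p h hp hlo hn _
      have h1 := mass_of_tight_of_zero hl h hp.1 fun i hi => hlo i (by simp at hn; omega)
      have h2 := free_apply (l := l) (m := p + 1) (y := 0) (t := l * (p + 1)) hl le_rfl (by omega)
        (by ring)
      have h3 : c = (fun i => if i = p + 1 then 0 else c i) + free l (l * (p + 1)) := by
        funext i
        simp only [Pi.add_apply, h2]
        split_ifs with h4 <;> simp [h4, h1]
      have h5 := ext_free (k := k) (l := l) (t := l * (p + 1))
        (c := fun i => if i = p + 1 then 0 else c i) hl hlk (by rw [← h3]; exact h) (by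
          intro i hi
          rw [show l * (p + 1) - 1 = l - 1 + l * p by ring, Int.add_mul_ediv_left _ _ (by omega),
            Int.ediv_eq_zero_of_lt (by omega) (by omega)] at hi
          split_ifs with h6
          · rfl
          · exact hlo i (by simp at hn; omega))
      rw [← h3] at h5
      exact ⟨_, _, h5⟩
    | succ n ihn =>
      intro m
      induction m with
      | zero =>
        intro c p h hp hlo hn hm
        have := hp.one_le h
        simp at hm
        omega
      | succ m ihm =>
        intro c p h hp hlo hn hm
        by_cases hpl : p ≤ lo
        · exact ihn (m + 1) c p h hp hlo (by omega) hm
        have hin := h.mvL hp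
        obtain ⟨p', hp'⟩ := exists_isFirst hin hl (tight_mvL hp.1)
        have hle : p' ≤ p := by
          by_contra hlt
          exact hp'.2 p (by omega) (tight_mvL hp.1)
        have hlo' : ∀ i ≤ lo, mvL c p i = 0 := fun i hi => by
          rw [mvL_of_ne (by omega) (by omega), hlo i hi]
        have hex : ∃ d ρ, Ext k l (mvL c p) d ρ := by
          rcases hle.eq_or_lt with rfl | hlt
          · exact ihm _ p' hin hp' hlo' hn (by rw [mvL_succ]; push_cast at hm; omega)
          · exact ihn (mvL c p (p' + 1)).toNat _ p' hin hp' hlo' (by push_cast at hn; omega)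
              (by omega)
        obtain ⟨d, ρ, he⟩ := hex
        exact ⟨d, ρ + 1, .step _ _ _ _ h hp he⟩
  exact key (p - lo).toNat (c (p + 1)).toNat c p h hp hlo (by omega) (by omega)

theorem InC.of_le {k l : ℤ} {c d : ℤ → ℤ} (h : InC k l c) (h0 : ∀ i, 0 ≤ d i)
    (hd : ∀ i, d i ≤ c i) : InC k l d := by
  refine ⟨h.fin.subset fun i hi => ?_, h0, fun i => ?_, fun i => ?_, fun i => ?_⟩
  · rw [Function.mem_support] at hi ⊢
    have := h0 i
    have := hd i
    omega
  · have := h.three i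
    have := hd i
    have := hd (i + 1)
    have := hd (i + 2)
    omega
  · have := h.two i
    have := hd i
    have := hd (i + 1)
    omega
  · have := h.four i
    have := hd i
    have := hd (i + 1)
    have := hd (i + 2)
    have := hd (i + 3)
    omega

theorem inC_of_add_free {k l t : ℤ} {d : ℤ → ℤ} (hl : 1 ≤ l) (h : InC k l (d + free l t))
    (hd : ∀ i ≤ t / l + 3, d i = 0) : InC k l d := by
  refine h.of_le (fun i => ?_) fun i => ?_
  · have h1 := h.nn i
    rcases le_or_gt i (t / l + 3) with hi | hi
    · rw [hd i hi]
    · have : free l t i = 0 := by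
        unfold free
        rw [if_neg (by omega), if_neg (by omega)]
      rw [Pi.add_apply, this, add_zero] at h1
      exact h1
  · have := free_nonneg hl t i
    rw [Pi.add_apply]
    omega

theorem Ext.inC_right {k l ρ : ℤ} {c d : ℤ → ℤ} (hl : 1 ≤ l) (h : Ext k l c d ρ) :
    InC k l d := by
  induction h with
  | free d t h hc => exact inC_of_add_free hl h hc
  | step _ _ _ _ _ _ _ ih => exact ih

theorem Ext.not_pred {k l ρ : ℤ} {c d : ℤ → ℤ} (hl : 1 ≤ l) (hlk : l ≤ k) (h : Ext k l c d ρ) :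
    ¬ InC k (l - 1) c := by
  intro h'
  obtain ⟨p, hp⟩ := h.isFirst hl hlk
  exact (inC_pred_iff.1 h').2 p hp.1

/-! ### Carriers and extraction -/

/-- The carrier holds `min l s` units of the isolated particle; the other `max (l - s) 0` units each
move one site to the left. The gap keeps the remainder `d` unaffected. -/
theorem kap_add_free {k l s t : ℤ} {d : ℤ → ℤ} (hl : 1 ≤ l) (hs : 0 ≤ s) (hsl : s ≤ k - l)
    (h : InC k l (d + free l t)) (hd : ∀ i ≤ t / l + 3, d i = 0) :
    kap k s (d + free l t) = kap k s d + free l (t - max (l - s) 0) := by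
  have h' := inC_of_add_free hl h hd
  have hv := h'.isSplit hs
  have hk := h'.nonneg.1
  obtain ⟨y, hy0, hyl, hy⟩ := exists_div l t hl
  have hf := free_apply hl hy0 hyl.le hy
  set m := t / l with hm
  have hv0 : ∀ i ≤ m + 3, spl k s d i = 0 := fun i hi => by
    have := hv.facts h' hs i
    have := hd i hi
    omega
  -- The capacity is spent on the site `m` first and then on `m + 1`. The third bound in the
  -- recursion is at least `k - l ≥ s` there and plays no role.
  set w : ℤ → ℤ := fun i => if i = m then min (l - y) s else
    if i = m + 1 then min y (s - min (l - y) s) else 0 with hw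
  have hsp : spl k s (d + free l t) = spl k s d + w := by
    refine (h.isSplit hs).unique ⟨fun i => ?_, ?_⟩
    · simp only [Pi.add_apply, hf, hw]
      rcases le_or_gt i (m + 2) with hi | hi
      · have h1 := hd i (by omega)
        have h2 := hd (i + 1) (by omega)
        have h3 := hv0 i (by omega)
        have h4 := hv0 (i + 1) (by omega)
        have h5 := h'.three i
        rw [h1, h2, h3, h4]
        rw [h1, h2] at h5
        rcases le_or_gt i (m + 1) with hi' | hi'
        · rw [hd (i + 2) (by omega)]
          split_ifs <;> omega
        · split_ifs <;> omega
      · have := hv.succ i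
        split_ifs <;> omega
    · refine ⟨m - 1, fun i hi => ?_⟩
      rw [Pi.add_apply, hv0 i (by omega)]
      simp only [hw]
      split_ifs <;> omega
  have key : kap k s (d + free l t) = kap k s d +
      fun i => w i + (free l t (i + 1) - w (i + 1)) := by
    funext i
    simp only [kap, hsp, Pi.add_apply]
    ring
  rw [key]
  congr 1
  funext i
  rcases le_or_gt l s with h1 | h1
  · rw [show t - max (l - s) 0 = t by omega, hf, hf]
    simp only [hw]
    split_ifs <;> omega
  · rw [show t - max (l - s) 0 = t - l + s by omega, hf]
    rcases le_or_gt (y + s) l with h2 | h2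
    · rw [free_apply (t := t - l + s) (m := m - 1) hl (show 0 ≤ y + s by omega) h2 (by linarith)]
      simp only [hw]
      split_ifs <;> omega
    · rw [free_apply (t := t - l + s) (m := m) (y := y + s - l) hl (by omega) (by omega)
        (by linarith)]
      simp only [hw]
      split_ifs <;> omega

/-- The loss of energy is computed once, for a free particle, and is carried along the moves by
`kap_mvL`. -/
theorem Ext.kap {k l s ρ : ℤ} {c d : ℤ → ℤ} (hl : 1 ≤ l) (hlk : l ≤ k) (hs : 0 ≤ s)
    (hsl : s ≤ k - l) (h : Ext k l c d ρ) :
    Ext k l (kap k s c) (kap k s d) (ρ - max (l - s) 0) := by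
  induction h with
  | free d t h hc =>
    have h' := inC_of_add_free hl h hc
    have hK := h.kap hs hsl
    rw [kap_add_free hl hs hsl h hc] at hK ⊢
    refine ext_free hl hlk hK fun i hi => ?_
    have h1 := sub_one_ediv_le (t := t - max (l - s) 0) hl
    have h2 : (t - max (l - s) 0) / l ≤ t / l := Int.ediv_le_ediv (by omega) (by omega)
    have h3 := (h'.isSplit hs).facts h' hs i
    have h4 := (h'.isSplit hs).facts h' hs (i + 1)
    have h5 := hc i (by omega)
    have h6 := hc (i + 1) (by omega)
    simp only [RiggedConfig.kap]
    omega
  | step c d p ρ hin hp h ih =>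
    obtain ⟨p', -, -, hp', he⟩ := kap_mvL hin hs hsl hp
    rw [he] at ih
    have := Ext.step _ _ _ _ (hin.kap hs hsl) hp' ih
    rwa [show ρ - max (l - s) 0 + 1 = ρ + 1 - max (l - s) 0 by ring] at this

/-! ### Weighted sums -/

/-- The sum of `w i * c i`. -/
noncomputable def wsum (w c : ℤ → ℤ) : ℤ := ∑ᶠ i, w i * c i

theorem finite_support_mul {c : ℤ → ℤ} (w : ℤ → ℤ) (h : c.support.Finite) :
    (fun i => w i * c i).support.Finite :=
  h.subset fun i hi => by
    rw [Function.mem_support] at hi ⊢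
    exact right_ne_zero_of_mul hi

theorem wsum_add {w c d : ℤ → ℤ} (hc : c.support.Finite) (hd : d.support.Finite) :
    wsum w (c + d) = wsum w c + wsum w d := by
  unfold wsum
  rw [← finsum_add_distrib (finite_support_mul w hc) (finite_support_mul w hd)]
  exact finsum_congr fun i => by rw [Pi.add_apply]; ring

theorem wsum_single (w : ℤ → ℤ) (p x : ℤ) : wsum w (Pi.single p x) = w p * x := by
  unfold wsum
  rw [finsum_eq_single _ p fun i hi => by simp [Pi.single_eq_of_ne hi]]
  simp

theorem finite_support_single (p x : ℤ) : (Pi.single p x : ℤ → ℤ).support.Finite :=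
  (Set.finite_singleton p).subset (Pi.support_single_subset)

theorem wsum_mvL {w c : ℤ → ℤ} (h : c.support.Finite) (p : ℤ) :
    wsum w (mvL c p) = wsum w c + w p - w (p + 1) := by
  have : mvL c p = c + (Pi.single p 1 + Pi.single (p + 1) (-1)) := by
    funext i
    simp only [mvL, Pi.add_apply, Pi.single_apply]
    split_ifs <;> omega
  rw [this, wsum_add h, wsum_add, wsum_single, wsum_single]
  · ring
  · exact finite_support_single _ _
  · exact finite_support_single _ _
  · exact ((finite_support_single _ _).union (finite_support_single _ _)).subset
      (Function.support_add _ _)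

theorem finite_support_free (l t : ℤ) : (free l t).support.Finite :=
  ((Set.finite_singleton (t / l)).union (Set.finite_singleton (t / l + 1))).subset fun i hi => by
    rw [Function.mem_support] at hi
    by_contra hc
    simp only [Set.mem_union, Set.mem_singleton_iff, not_or] at hc
    rw [free, if_neg hc.1, if_neg hc.2] at hi
    exact hi rfl

theorem wsum_free (w : ℤ → ℤ) (l t : ℤ) :
    wsum w (free l t) = w (t / l) * (l - t % l) + w (t / l + 1) * (t % l) := by
  have : free l t = Pi.single (t / l) (l - t % l) + Pi.single (t / l + 1) (t % l) := by
    funext i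
    simp only [free, Pi.add_apply, Pi.single_apply]
    split_ifs <;> omega
  rw [this, wsum_add (finite_support_single _ _) (finite_support_single _ _), wsum_single,
    wsum_single]

/-- The total number of particles, counted with weight. -/
noncomputable def mass (c : ℤ → ℤ) : ℤ := wsum 1 c

/-- The energy. -/
noncomputable def deg (c : ℤ → ℤ) : ℤ := wsum id c

theorem Ext.mass_eq {k l ρ : ℤ} {c d : ℤ → ℤ} (hl : 1 ≤ l) (h : Ext k l c d ρ) :
    mass c = mass d + l := by
  induction h with
  | free d t h hc =>
    unfold mass
    rw [wsum_add (inC_of_add_free hl h hc).fin (finite_support_free _ _), wsum_free]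
    simp
  | step c d p ρ hin hp h ih =>
    unfold mass at ih ⊢
    rw [wsum_mvL hin.fin] at ih
    simpa using ih

theorem Ext.deg_eq {k l ρ : ℤ} {c d : ℤ → ℤ} (hl : 1 ≤ l) (h : Ext k l c d ρ) :
    deg c = deg d + ρ := by
  induction h with
  | free d t h hc =>
    unfold deg
    rw [wsum_add (inC_of_add_free hl h hc).fin (finite_support_free _ _), wsum_free]
    have := Int.mul_ediv_add_emod t l
    simp only [id]
    linear_combination this
  | step c d p ρ hin hp h ih =>
    unfold deg at ih ⊢
    rw [wsum_mvL hin.fin] at ih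
    simp only [id] at ih
    omega

theorem mass_nonneg {k l : ℤ} {c : ℤ → ℤ} (h : InC k l c) : 0 ≤ mass c :=
  finsum_nonneg fun i => by simpa using h.nn i

theorem finite_support_spl {k l s : ℤ} {c : ℤ → ℤ} (h : InC k l c) (hs : 0 ≤ s) :
    (spl k s c).support.Finite :=
  h.fin.subset fun i hi => by
    have := (h.isSplit hs).facts h hs i
    rw [Function.mem_support] at hi ⊢
    omega

theorem wsum_comp_succ (w c : ℤ → ℤ) :
    wsum w (fun i => c (i + 1)) = wsum (fun i => w (i - 1)) c := by
  have := finsum_comp_equiv (Equiv.addRight (1 : ℤ)) (f := fun i => w (i - 1) * c i)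
  unfold wsum
  rw [← this]
  exact finsum_congr fun i => by simp

theorem wsum_kap {k l s : ℤ} {w c : ℤ → ℤ} (h : InC k l c) (hs : 0 ≤ s) :
    wsum w (kap k s c) = wsum w (spl k s c) + wsum (fun i => w (i - 1)) (c - spl k s c) := by
  rw [← wsum_comp_succ, ← wsum_add (finite_support_spl h hs)]
  · rfl
  · refine ((h.fin.union (finite_support_spl h hs)).image (· - 1)).subset fun i hi => ?_
    refine ⟨i + 1, ?_, by ring⟩
    rw [Function.mem_support, Pi.sub_apply] at hi
    by_contra hc
    simp only [Set.mem_union, Function.mem_support, not_or, not_not] at hc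
    rw [hc.1, hc.2] at hi
    exact hi rfl

theorem wsum_sub {w c d : ℤ → ℤ} (hc : c.support.Finite) (hd : d.support.Finite) :
    wsum w (c - d) = wsum w c - wsum w d := by
  have := wsum_add (w := w) (c := c - d) (d := d)
    ((hc.union hd).subset (Function.support_sub _ _)) hd
  rw [sub_add_cancel] at this
  omega

/-- Every unit outside the splitting moves one site to the left. -/
theorem deg_kap {k l s : ℤ} {c : ℤ → ℤ} (h : InC k l c) (hs : 0 ≤ s) :
    deg (kap k s c) = deg c - mass (c - spl k s c) := by
  have h1 := wsum_sub (w := id) h.fin (finite_support_spl h hs)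
  unfold deg mass
  rw [wsum_kap h hs]
  have h2 : wsum (fun i => id (i - 1)) (c - spl k s c) =
      wsum id (c - spl k s c) - wsum 1 (c - spl k s c) := by
    have hf : (c - spl k s c).support.Finite :=
      (h.fin.union (finite_support_spl h hs)).subset (Function.support_sub _ _)
    unfold wsum
    rw [← finsum_sub_distrib (finite_support_mul _ hf) (finite_support_mul _ hf)]
    exact finsum_congr fun i => by simp; ring
  rw [h2, h1]
  ring

/-! ### Configurations with an inserted particle -/

/-- The configuration with the inserted particle passing the site `n`. -/
noncomputable def state (k l : ℤ) (c : ℤ → ℤ) (n y : ℤ) : ℤ → ℤ := fun j =>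
  if j ≤ n - 3 then kap k (k - l) c (j + 2)
  else if j = n - 2 then l - (c n - spl k (k - l) c n) - y
  else if j = n - 1 then y
  else c j

/-- The largest admissible `y` in `state k l c n y`. -/
noncomputable def stateEnd (k l : ℤ) (c : ℤ → ℤ) (n : ℤ) : ℤ :=
  l - c n - (c (n + 1) - spl k (k - l) c (n + 1))

/-- While the particle passes the site `n`, the entry `y` runs from `c (n - 1)` to `stateEnd k l c
n`. This is the stage `n`; its length is non-negative, but it may be zero. -/
theorem le_stateEnd {k l : ℤ} {c : ℤ → ℤ} (hlk : l ≤ k) (h : InC k l c) (n : ℤ) :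
    c (n - 1) ≤ stateEnd k l c n := by
  have hv := h.isSplit (s := k - l) (by omega)
  obtain ⟨n, rfl⟩ : ∃ m, n = m + 1 := ⟨n - 1, by ring⟩
  have h0 := hv.facts h (by omega) n
  have h1 := hv.facts h (by omega) (n + 1)
  have h2 := h.four' n
  rw [add_sub_cancel_right, stateEnd]
  simp only [add_one_add_one, add_one_add_two] at *
  omega

/-- The stages fit together: at the last value of `y` the entry at `n - 2` has become an entry of
the shifted `kap`. -/
theorem state_end (k l : ℤ) (c : ℤ → ℤ) (n : ℤ) :
    state k l c n (stateEnd k l c n) = state k l c (n + 1) (c n) := by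
  funext j
  unfold state stateEnd
  by_cases h1 : j ≤ n - 3
  · rw [if_pos h1, if_pos (by omega)]
  rw [if_neg h1]
  by_cases h2 : j = n - 2
  · rw [if_pos h2, if_pos (by omega), h2, kap]
    rw [show n - 2 + 2 = n by ring]
    ring
  rw [if_neg h2, if_neg (show ¬ j ≤ n + 1 - 3 by omega)]
  by_cases h3 : j = n - 1
  · rw [if_pos h3, if_pos (by omega)]
    ring
  rw [if_neg h3, if_neg (by omega)]
  split_ifs with h4
  · rw [h4]
    congr 1
    ring
  · rfl

theorem state_aux {k l a b c d e f p q x y z w t : ℤ} (hlk : l ≤ k)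
    (hp : 0 ≤ p ∧ p ≤ a ∧ p + q ≤ k - l)
    (hqb : q ≤ b) (hq : 0 ≤ q) (hqE : q ≤ k - a - b - c)
    (ab : a + b < l) (bc : b + c < l) (cd : c + d < l) (de : d + e ≤ l)
    (d0 : 0 ≤ d) (c0 : 0 ≤ c) (x0 : 0 ≤ x) (z0 : 0 ≤ z) (w0 : 0 ≤ w)
    (f1 : a + 2 * b + 2 * c + d < k + l) (f2 : b + 2 * c + 2 * d + e < k + l)
    (f3 : c + 2 * d + 2 * e + f ≤ k + l)
    (hx : x = min c (min (k - l - q) (k - b - c - d)))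
    (hz : z = min d (min (k - l - x) (k - c - d - e)))
    (hw : w = min e (min (k - l - z) (k - d - e - f)))
    (ht : t = l - (d - z) - y)
    (hy : c ≤ y) (hy' : y ≤ l - d - (e - w)) :
    0 ≤ t ∧ q + (c - x) + (x + (d - z)) ≤ l ∧ x + (d - z) + t ≤ l ∧ t + y ≤ l ∧ y + d ≤ l ∧
      q + (c - x) + (x + (d - z)) + t ≤ k ∧ x + (d - z) + t + y ≤ k ∧ t + y + d ≤ k ∧
      y + d + e ≤ k ∧
      p + (b - q) + 2 * (q + (c - x)) + 2 * (x + (d - z)) + t ≤ k + l ∧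
      q + (c - x) + 2 * (x + (d - z)) + 2 * t + y ≤ k + l ∧
      x + (d - z) + 2 * t + 2 * y + d ≤ k + l ∧ t + 2 * y + 2 * d + e ≤ k + l ∧
      y + 2 * d + 2 * e + f ≤ k + l ∧
      (c < y → (t + y = l ∨ x + (d - z) + 2 * t + 2 * y + d = k + l) ∧
        (x + (d - z) + t < l ∧ q + (c - x) + 2 * (x + (d - z)) + 2 * t + y < k + l) ∧
        (q + (c - x) + (x + (d - z)) < l ∧
          p + (b - q) + 2 * (q + (c - x)) + 2 * (x + (d - z)) + t < k + l)) := by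
  subst ht
  refine ⟨?_, ?_, ?_, ?_, ?_, ?_, ?_, ?_, ?_, ?_, ?_, ?_, ?_, ?_, fun hcy => ⟨?_, ⟨?_, ?_⟩, ?_, ?_⟩⟩
  all_goals omega

/-- The values of a state near the inserted particle. -/
theorem state_values (k l : ℤ) (c : ℤ → ℤ) (m y : ℤ) :
    (∀ j ≤ m + 2, state k l c (m + 5) y j = kap k (k - l) c (j + 2)) ∧
      state k l c (m + 5) y (m + 3) = l - (c (m + 5) - spl k (k - l) c (m + 5)) - y ∧
      state k l c (m + 5) y (m + 4) = y ∧ ∀ j ≥ m + 5, state k l c (m + 5) y j = c j := by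
  refine ⟨fun j hj => ?_, ?_, ?_, fun j hj => ?_⟩ <;> unfold state
  · rw [if_pos (by omega)]
  · rw [if_neg (by omega), if_pos (by omega)]
  · rw [if_neg (by omega), if_neg (by omega), if_pos (by omega)]
  · rw [if_neg (by omega), if_neg (by omega), if_neg (by omega)]

/-- Strictness `c (n - 1) < y` is needed because at equality the particle is still at the end of the
preceding stage, whose tight window may lie further left. -/
theorem state_inC_and_isFirst {k l n y : ℤ} {c : ℤ → ℤ} (hlk : l ≤ k) (h : InC k l c)
    (hn : ∀ q < n, ¬ Tight k l c q) (hy : c (n - 1) ≤ y) (hy' : y ≤ stateEnd k l c n) :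
    InC k l (state k l c n y) ∧ (c (n - 1) < y → IsFirst k l (state k l c n y) (n - 2)) := by
  have hs : 0 ≤ k - l := by omega
  have hv := h.isSplit hs
  have hK := h.kap hs le_rfl
  obtain ⟨m, rfl⟩ : ∃ m, n = m + 5 := ⟨n - 5, by ring⟩
  obtain ⟨s1, s2, s3, s4⟩ := state_values k l c m y
  set S := state k l c (m + 5) y
  have K : ∀ i, kap k (k - l) c i = spl k (k - l) c i + (c (i + 1) - spl k (k - l) c (i + 1)) :=
    fun i => rfl
  have a2 := hv.facts h hs (m + 2)
  have a3 := hv.facts h hs (m + 3)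
  have a4 := hv.facts h hs (m + 4)
  have a5 := hv.facts h hs (m + 5)
  have a6 := hv.facts h hs (m + 6)
  have w1 := (not_tight_shift h).1 (hn (m + 1 + 1) (by omega))
  have w2 := (not_tight_shift h).1 (hn (m + 2 + 1) (by omega))
  have w3 := (not_tight_shift h).1 (hn (m + 3 + 1) (by omega))
  have b3 := h.four' (m + 3)
  have b4 := h.four' (m + 4)
  have b5 := h.four' (m + 5)
  have s10 := s1 m (by omega)
  have s11 := s1 (m + 1) (by omega)
  have s12 := s1 (m + 2) (by omega)
  have s50 := s4 (m + 5) (by omega)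
  have s51 := s4 (m + 6) (by omega)
  have s52 := s4 (m + 7) (by omega)
  have e : m + 5 - 1 = m + 4 := by ring
  rw [e] at hy ⊢
  clear e
  rw [K] at s10 s11 s12
  unfold stateEnd at hy'
  simp only [add_assoc, Int.reduceAdd] at s10 s11 s12 hy'
  have T2 := @tight_shift k l (m + 2) S
  have T1 := @tight_shift k l (m + 1) S
  have T0 := @tight_shift k l m S
  simp only [add_one_add_one, add_one_add_two, add_one_add_three, add_two_add_one,
    add_two_add_two, add_two_add_three, add_three_add_one, add_three_add_two,
    add_three_add_three] at *
  have e1 : m + 4 + 1 = m + 5 := by ring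
  have e2 : m + 4 + 2 = m + 6 := by ring
  have e3 : m + 4 + 3 = m + 7 := by ring
  have e4 : m + 5 + 1 = m + 6 := by ring
  have e5 : m + 5 + 2 = m + 7 := by ring
  rw [e4, e5] at a5 b5
  rw [e1, e2, e3] at b4
  rw [e1, e2] at a4
  clear e1 e2 e3 e4 e5
  obtain ⟨r1, r2, r3, r4, r5, r6, r7, r8, r9, r10, r11, r12, r13, r14, r15⟩ := state_aux hlk
    ⟨a2.1, a2.2.1, a2.2.2.1⟩ a3.2.1 a3.1 a2.2.2.2.1 w1.1 w2.1 w3.1 b5.2.1 b5.1 b4.1 a4.1 a5.1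
    a6.1 w2.2 w3.2 b4.2.2.2 a3.2.2.2.2 a4.2.2.2.2 a5.2.2.2.2 s2 hy hy'
  rw [← s12] at r2 r3 r6 r7 r10 r11 r12 r15
  rw [← s11] at r2 r6 r10 r11 r15
  rw [← s10] at r10 r15
  rw [show m + 5 - 2 = m + 3 by ring]
  have hin : InC k l S := by
    refine ⟨?_, fun i => ?_, fun i => ?_, fun i => ?_, fun i => ?_⟩
    · refine ((hK.fin.image (· - 2)).union
        ((Set.finite_Icc (m + 3) (m + 4)).union h.fin)).subset fun i hi => ?_
      rw [Function.mem_support] at hi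
      rcases le_or_gt i (m + 2) with h1 | h1
      · rw [s1 i h1] at hi
        exact .inl ⟨i + 2, hi, by ring⟩
      rcases le_or_gt (m + 5) i with h2 | h2
      · rw [s4 i h2] at hi
        exact .inr (.inr hi)
      · exact .inr (.inl ⟨by omega, by omega⟩)
    · rcases le_or_gt i (m + 2) with h1 | h1
      · rw [s1 i h1]
        exact hK.nn _
      rcases le_or_gt (m + 5) i with h2 | h2
      · rw [s4 i h2]
        exact h.nn i
      · obtain rfl | rfl : i = m + 3 ∨ i = m + 4 := by omega
        · exact r1
        · rw [s3]
          exact b4.1.trans hy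
    · rcases le_or_gt i m with h1 | h1
      · have := hK.three (i + 2)
        rw [s1 i (by omega), s1 (i + 1) (by omega), s1 (i + 2) (by omega),
          show i + 1 + 2 = i + 2 + 1 by ring]
        exact this
      rcases le_or_gt (m + 5) i with h2 | h2
      · rw [s4 i (by omega), s4 (i + 1) (by omega), s4 (i + 2) (by omega)]
        exact h.three i
      · obtain rfl | rfl | rfl | rfl : i = m + 1 ∨ i = m + 2 ∨ i = m + 3 ∨ i = m + 4 := by omega
        all_goals simp only [add_assoc, Int.reduceAdd]
        all_goals clear * - r6 r7 r8 r9 s3 s50 s51; omega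
    · rcases le_or_gt i (m + 1) with h1 | h1
      · have := hK.two (i + 2)
        rw [s1 i (by omega), s1 (i + 1) (by omega), show i + 1 + 2 = i + 2 + 1 by ring]
        exact this
      rcases le_or_gt (m + 5) i with h2 | h2
      · rw [s4 i (by omega), s4 (i + 1) (by omega)]
        exact h.two i
      · obtain rfl | rfl | rfl : i = m + 2 ∨ i = m + 3 ∨ i = m + 4 := by omega
        all_goals simp only [add_assoc, Int.reduceAdd]
        all_goals clear * - r3 r4 r5 s3 s50; omega
    · rcases le_or_gt i (m - 1) with h1 | h1
      · have := hK.four (i + 2)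
        rw [s1 i (by omega), s1 (i + 1) (by omega), s1 (i + 2) (by omega), s1 (i + 3) (by omega),
          show i + 1 + 2 = i + 2 + 1 by ring, show i + 3 + 2 = i + 2 + 3 by ring]
        exact this
      rcases le_or_gt (m + 5) i with h2 | h2
      · rw [s4 i (by omega), s4 (i + 1) (by omega), s4 (i + 2) (by omega), s4 (i + 3) (by omega)]
        exact h.four i
      · obtain rfl | rfl | rfl | rfl | rfl :
          i = m ∨ i = m + 1 ∨ i = m + 2 ∨ i = m + 3 ∨ i = m + 4 := by omega
        all_goals simp only [add_assoc, Int.reduceAdd]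
        all_goals clear * - r10 r11 r12 r13 r14 s3 s50 s51 s52; omega
  refine ⟨hin, fun hlt => ?_⟩
  obtain ⟨t1, ⟨t2, t3⟩, t4, t5⟩ := r15 hlt
  refine ⟨?_, fun q hq => ?_⟩
  · rw [T2, s3, s50]
    exact t1
  · rcases le_or_gt q m with h1 | h1
    · have := not_tight_kap h hs le_rfl (hn (q + 2) (by omega)) (hn (q + 2 + 1) (by omega))
        (hn (q + 2 + 2) (by omega))
      rw [not_tight_iff hK] at this
      rw [not_tight_iff hin, s1 q (by omega), s1 (q + 1) (by omega), s1 (q - 1) (by omega),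
        s1 (q + 2) (by omega), show q + 1 + 2 = q + 2 + 1 by ring,
        show q - 1 + 2 = q + 2 - 1 by ring]
      exact this
    obtain rfl | rfl : q = m + 1 ∨ q = m + 2 := by omega
    · rw [T0]
      clear * - t4 t5
      omega
    · rw [T1, s3]
      clear * - t2 t3
      omega

theorem mvL_state {k l n y : ℤ} (c : ℤ → ℤ) :
    mvL (state k l c n y) (n - 2) = state k l c n (y - 1) := by
  obtain ⟨m, rfl⟩ : ∃ m, n = m + 5 := ⟨n - 5, by ring⟩
  funext j
  unfold mvL state
  split_ifs <;> omega

/-! ### Energies of states -/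

/-- The sum of the entries of `c` at sites below `n`. -/
noncomputable def cum (c : ℤ → ℤ) (n : ℤ) : ℤ := wsum (fun i => if i < n then 1 else 0) c

theorem cum_succ {c : ℤ → ℤ} (h : c.support.Finite) (n : ℤ) : cum c (n + 1) = cum c n + c n := by
  unfold cum wsum
  rw [← finsum_eq_single (f := fun i => if i = n then c i else 0) n (fun i hi => if_neg hi)
    |>.trans (if_pos rfl), ← finsum_add_distrib (finite_support_mul _ h)]
  · refine finsum_congr fun i => ?_
    beta_reduce
    rcases lt_trichotomy i n with hi | hi | hi
    · rw [if_pos hi, if_pos (by omega), if_neg (by omega), add_zero]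
    · rw [if_pos (show i < n + 1 by omega), if_neg (show ¬ i < n by omega), if_pos hi, zero_mul,
        one_mul, zero_add]
    · rw [if_neg (by omega), if_neg (by omega), if_neg (by omega), add_zero]
  · refine (Set.finite_singleton n).subset fun i hi => ?_
    by_contra hc
    exact hi (if_neg hc)

theorem cum_eq_zero {c : ℤ → ℤ} {n : ℤ} (h : ∀ i < n, c i = 0) : cum c n = 0 := by
  refine finsum_eq_zero_of_forall_eq_zero fun i => ?_
  beta_reduce
  split_ifs with hi
  · rw [h i hi, mul_zero]
  · exact zero_mul _

theorem cum_eq_mass {c : ℤ → ℤ} {n : ℤ} (h : ∀ i ≥ n, c i = 0) : cum c n = mass c := by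
  unfold cum mass wsum
  refine finsum_congr fun i => ?_
  beta_reduce
  split_ifs with hi
  · rfl
  · rw [h i (by omega), mul_zero, mul_zero]

/-- The energy of the inserted particle when it starts to pass the site `n`. -/
noncomputable def stateStart (k l : ℤ) (c : ℤ → ℤ) (n : ℤ) : ℤ :=
  (n - 2) * l + c (n - 1) - 2 * cum c n - cum (c - spl k (k - l) c) (n + 1)

theorem finite_support_sub_spl {k l s : ℤ} {c : ℤ → ℤ} (h : InC k l c) (hs : 0 ≤ s) :
    (c - spl k s c).support.Finite :=
  (h.fin.union (finite_support_spl h hs)).subset (Function.support_sub _ _)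

theorem stateStart_succ {k l : ℤ} {c : ℤ → ℤ} (hlk : l ≤ k) (h : InC k l c) (n : ℤ) :
    stateStart k l c (n + 1) = stateStart k l c n + stateEnd k l c n - c (n - 1) := by
  unfold stateStart stateEnd
  rw [cum_succ h.fin, cum_succ (finite_support_sub_spl h (by omega)) (n + 1), add_sub_cancel_right,
    Pi.sub_apply]
  ring

theorem stateStart_eq {k l : ℤ} {c : ℤ → ℤ} (hlk : l ≤ k) (h : InC k l c) {n : ℤ}
    (hn : ∀ i ≤ n, c i = 0) : stateStart k l c n = (n - 2) * l := by
  unfold stateStart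
  rw [hn _ (by omega), cum_eq_zero fun i hi => hn i hi.le, cum_eq_zero fun i hi => ?_]
  · ring
  · have := (h.isSplit (s := k - l) (by omega)).facts h (by omega) i
    have := hn i (by omega)
    rw [Pi.sub_apply]
    omega

theorem state_eq_free {k l n y : ℤ} {c : ℤ → ℤ} (hl : 1 ≤ l) (hlk : l ≤ k) (h : InC k l c)
    (hn : ∀ i ≤ n, c i = 0) (hy : 0 ≤ y) (hyl : y ≤ l) :
    state k l c n y = c + free l ((n - 2) * l + y) := by
  have hv : ∀ i ≤ n, spl k (k - l) c i = 0 := fun i hi => by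
    have := (h.isSplit (s := k - l) (by omega)).facts h (by omega) i
    have := hn i hi
    omega
  funext j
  rw [Pi.add_apply, free_apply (m := n - 2) hl hy hyl (by ring)]
  unfold state kap
  by_cases h1 : j ≤ n - 3
  · rw [if_pos h1, hv _ (by omega), hv _ (by omega), hn j (by omega), hn _ (by omega),
      if_neg (by omega), if_neg (by omega)]
    rfl
  rw [if_neg h1, hn n le_rfl, hv n le_rfl]
  by_cases h2 : j = n - 2
  · rw [if_pos h2, if_pos h2, hn j (by omega)]
    ring
  rw [if_neg h2, if_neg h2]
  by_cases h3 : j = n - 1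
  · rw [if_pos h3, if_pos (by omega), hn j (by omega), zero_add]
  · rw [if_neg h3, if_neg (by omega), add_zero]

/-- Inside a stage each move lowers `y` by one (`mvL_state`), between stages the descriptions agree
(`state_end`), and far to the left the state is a free particle. Hence an induction on `n`, and on
`y` inside each stage. -/
theorem ext_state {k l n y : ℤ} {c : ℤ → ℤ} (hl : 1 ≤ l) (hlk : l ≤ k) (h : InC k l c)
    (hn : ∀ q < n, ¬ Tight k l c q) (hy : c (n - 1) ≤ y) (hy' : y ≤ stateEnd k l c n) :
    Ext k l (state k l c n y) c (stateStart k l c n + (y - c (n - 1))) := by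
  obtain ⟨lo, hlo⟩ := exists_zero_below h.fin
  have base : ∀ n ≤ lo, ∀ y, (∀ q < n, ¬ Tight k l c q) → c (n - 1) ≤ y → y ≤ stateEnd k l c n →
      Ext k l (state k l c n y) c (stateStart k l c n + (y - c (n - 1))) := by
    intro n hnl y hn hy hy'
    have hin := (state_inC_and_isFirst hlk h hn hy hy').1
    have h0 : c (n - 1) = 0 := hlo _ (by omega)
    have hyl : y ≤ l := by
      have h1 := (h.isSplit (s := k - l) (by omega)).facts h (by omega) (n + 1)
      have h2 := h.nn n
      unfold stateEnd at hy'
      omega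
    rw [h0] at hy
    rw [state_eq_free hl hlk h (fun i hi => hlo i (by omega)) hy hyl] at hin ⊢
    rw [stateStart_eq hlk h (fun i hi => hlo i (by omega)), h0, sub_zero]
    refine ext_free hl hlk hin fun i hi => hlo i ?_
    have : ((n - 2) * l + y - 1) / l ≤ n - 2 := by
      have : (n - 2) * l + y - 1 < (n - 2 + 1) * l := by linarith
      have := Int.ediv_lt_of_lt_mul (show 0 < l by omega) this
      omega
    omega
  rcases le_or_gt n lo with hnl | hnl
  · exact base n hnl y hn hy hy'
  refine Int.leInduction (m := lo) (motive := fun n _ => ∀ y, (∀ q < n, ¬ Tight k l c q) →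
    c (n - 1) ≤ y → y ≤ stateEnd k l c n →
      Ext k l (state k l c n y) c (stateStart k l c n + (y - c (n - 1)))) (base lo le_rfl)
    (fun n _ ih => ?_) n hnl.le y hn hy hy'
  intro y hn hy hy'
  obtain ⟨m, rfl⟩ : ∃ m : ℕ, y = c n + m := ⟨(y - c n).toNat, by
    rw [add_sub_cancel_right] at hy; omega⟩
  clear hy
  induction m with
  | zero =>
    have := ih (stateEnd k l c n) (fun q hq => hn q (by omega)) (le_stateEnd hlk h n) le_rfl
    rw [state_end] at this
    rw [stateStart_succ hlk h, Nat.cast_zero, add_zero, add_sub_cancel_right, sub_self, add_zero]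
    rwa [← add_sub_assoc] at this
  | succ m ihm =>
    have h1 := ihm (by push_cast at hy'; omega)
    obtain ⟨h2, h3⟩ := state_inC_and_isFirst (y := c n + (m + 1 : ℕ)) hlk h hn
      (by rw [add_sub_cancel_right]; omega) hy'
    rw [add_sub_cancel_right] at h3
    have h4 := h3 (by push_cast; omega)
    rw [show c n + (m : ℤ) = c n + (m + 1 : ℕ) - 1 by push_cast; ring, ← mvL_state] at h1
    have := Ext.step _ _ _ _ h2 h4 h1
    convert this using 1
    push_cast
    ring

/-- Each stage starts at the energy at which the previous one ends, and far to the left stages have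
length `l`; so the stages cover all small energies without gaps. -/
theorem exists_state {k l n ρ : ℤ} {c : ℤ → ℤ} (hl : 1 ≤ l) (hlk : l ≤ k) (h : InC k l c)
    (hρ : ρ ≤ stateStart k l c (n + 1)) :
    ∃ n' ≤ n, ∃ y, c (n' - 1) ≤ y ∧ y ≤ stateEnd k l c n' ∧
      ρ = stateStart k l c n' + (y - c (n' - 1)) := by
  obtain ⟨lo, hlo⟩ := exists_zero_below h.fin
  have base : ∀ n ≤ lo - 2, ∀ ρ ≤ stateStart k l c (n + 1), ∃ n' ≤ n, ∃ y, c (n' - 1) ≤ y ∧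
      y ≤ stateEnd k l c n' ∧ ρ = stateStart k l c n' + (y - c (n' - 1)) := by
    intro n hn ρ hρ
    rw [stateStart_eq hlk h fun i hi => hlo i (by omega)] at hρ
    obtain ⟨z, hz0, hzl, hz⟩ := exists_div l (ρ - 1) hl
    have h1 : (ρ - 1) / l + 2 ≤ n := by
      have : ρ - 1 < (n + 1 - 2) * l := by omega
      have := Int.ediv_lt_of_lt_mul (show 0 < l by omega) this
      omega
    refine ⟨(ρ - 1) / l + 2, h1, z + 1, ?_, ?_, ?_⟩
    · rw [hlo _ (by omega)]
      omega
    · have h2 := (h.isSplit (s := k - l) (by omega)).facts h (by omega) ((ρ - 1) / l + 2 + 1)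
      have h3 := hlo ((ρ - 1) / l + 2 + 1) (by omega)
      have h4 := hlo ((ρ - 1) / l + 2) (by omega)
      unfold stateEnd
      omega
    · rw [stateStart_eq hlk h fun i hi => hlo i (by omega), hlo _ (by omega)]
      linarith
  rcases le_or_gt n (lo - 2) with hnl | hnl
  · exact base n hnl ρ hρ
  refine Int.leInduction (m := lo - 2) (motive := fun n _ => ∀ ρ ≤ stateStart k l c (n + 1),
    ∃ n' ≤ n, ∃ y, c (n' - 1) ≤ y ∧ y ≤ stateEnd k l c n' ∧
      ρ = stateStart k l c n' + (y - c (n' - 1))) (base _ le_rfl) (fun n _ ih => ?_) n hnl.le ρ hρ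
  intro ρ hρ
  rcases le_or_gt ρ (stateStart k l c (n + 1)) with h1 | h1
  · obtain ⟨n', h2, h3⟩ := ih ρ h1
    exact ⟨n', by omega, h3⟩
  · refine ⟨n + 1, le_rfl, c (n + 1 - 1) + (ρ - stateStart k l c (n + 1)), by omega, ?_, by ring⟩
    rw [stateStart_succ hlk h] at hρ
    omega

/-! ### The maximal energy of an inserted particle -/

/-- The arithmetic behind `stuck`. The numbers `r1` and `r2` are the entries at `n - 2` and `n - 1`
of the state at the end of stage `n`, followed by `d, e, f, …`. The three negated conjunctions say
that no admissible predecessor arises by pushing a unit to the right at the windows `n - 2`, `n -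
1`, `n`; the last also uses that this window would be the leftmost tight one. -/
theorem stuck_aux {k l b c d e f g h x z w t r : ℤ} (hlk : l ≤ k)
    (bc : b + c < l) (cd : c + d < l) (de : d + e ≤ l) (fe : f + e ≤ l) (fg : f + g ≤ l)
    (c0 : 0 ≤ c) (d0 : 0 ≤ d) (e0 : 0 ≤ e) (f0 : 0 ≤ f) (g0 : 0 ≤ g)
    (xc : 0 ≤ x ∧ x ≤ c) (z0 : 0 ≤ z) (w0 : 0 ≤ w) (t0 : 0 ≤ t)
    (f2 : b + 2 * c + 2 * d + e < k + l) (f3 : c + 2 * d + 2 * e + f ≤ k + l)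
    (f4 : d + 2 * e + 2 * f + g ≤ k + l)
    (hxE : x ≤ k - b - c - d)
    (hz : z = min d (min (k - l - x) (k - c - d - e)))
    (hw : w = min e (min (k - l - z) (k - d - e - f)))
    (ht : t = min f (min (k - l - w) (k - e - f - g)))
    (hr : r = min g (min (k - l - t) (k - f - g - h)))
    (hR'' : d + e < l → c + 2 * d + 2 * e + f < k + l → e + f + (g - r) = l)
    (hR : c < l - d - (e - w)) (hR' : d + e + (f - t) = l)
    {r1 r2 : ℤ} (h1 : r1 = l - (d - z) - (l - d - (e - w))) (h2 : r2 = l - d - (e - w)) :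
    ¬ (r2 + 1 + d ≤ l ∧ r1 - 1 + 2 * (r2 + 1) + 2 * d + e ≤ k + l ∧
      r2 + 1 + 2 * d + 2 * e + f ≤ k + l) ∧
    ¬ (d + 1 + e ≤ l ∧ r2 - 1 + 2 * (d + 1) + 2 * e + f ≤ k + l ∧
      d + 1 + 2 * e + 2 * f + g ≤ k + l) ∧
    ¬ (r1 + r2 < l ∧ x + (d - z) + 2 * r1 + 2 * r2 + (d - 1) < k + l ∧ r2 + d - 1 < l ∧ d - 1 + 2 * (e + 1) + 2 * f + g ≤ k + l ∧
      e + 1 + 2 * f + 2 * g + h ≤ k + l ∧ e + 1 + f ≤ l ∧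
      r1 + 2 * r2 + 2 * (d - 1) + e + 1 < k + l ∧
      (d + e = l ∨ r2 + 2 * (d - 1) + 2 * (e + 1) + f = k + l)) := by
  refine ⟨?_, ?_, ?_⟩
  · clear hr hR''; omega
  · clear hr hR''; omega
  · rintro ⟨a1, a2, a3, a4, a5, a6, a7, a8⟩
    subst h1 h2
    have hzd : z < d := by clear * - a1; omega
    obtain ⟨z1, z2, z3, z4⟩ := min_three hz
    obtain ⟨w1, w2, w3, w4⟩ := min_three hw
    obtain ⟨t1, t2, t3, t4⟩ := min_three ht
    obtain ⟨r1, r2, r3, r4⟩ := min_three hr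
    have hz' : z = k - l - x := by
      clear hz hw ht hr hR'' r1 r2 r3 r4 t4
      rcases z4 with z4 | z4 | z4 <;> omega
    have hlt : d + e < l := by
      clear hz hw ht hr hR'' r1 r2 r3 r4 z4
      omega
    have hlt' : c + 2 * d + 2 * e + f < k + l := by
      clear hz hw ht hr hR'' r1 r2 r3 r4 z4 t4 w4
      omega
    have := hR'' hlt hlt'
    clear hz hw ht hr hR'' z4
    rcases w4 with w4 | w4 | w4 <;> rcases t4 with t4 | t4 | t4 <;>
      rcases r4 with r4 | r4 | r4 <;> omega

/-- At a tight window of `c` the next stage has length zero: the inserted particle makes no progress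
there. -/
theorem eq_stateEnd_of_tight {k l p : ℤ} {c : ℤ → ℤ} (hlk : l ≤ k) (h : InC k l c)
    (hp : Tight k l c p) : c p = stateEnd k l c (p + 1) := by
  have hs : 0 ≤ k - l := by omega
  have hv := h.isSplit hs
  obtain ⟨m, rfl⟩ : ∃ m, p = m + 1 := ⟨p - 1, by ring⟩
  rw [tight_shift] at hp
  have h0 := hv.facts h hs m
  have h1 := hv.facts h hs (m + 1)
  have h2 := hv.facts h hs (m + 2)
  have h3 := hv.facts h hs (m + 3)
  have b0 := h.four' m
  have b1 := h.four' (m + 1)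
  have b2 := h.four' (m + 2)
  unfold stateEnd
  simp only [add_one_add_one, add_one_add_two, add_one_add_three, add_two_add_one,
    add_two_add_two, add_two_add_three, add_three_add_one, add_three_add_two] at *
  obtain ⟨x1, x2, x3, x4⟩ := min_three h2.2.2.2.2
  obtain ⟨y1, y2, y3, y4⟩ := min_three h3.2.2.2.2
  have h1' := h1.2.2.2.1
  have h0' := h0.2.2
  clear h2 h3 hv h
  rcases hp with hp | hp
  · omega
  · rcases x4 with x4 | x4 | x4 <;> omega

/-- If stage `n` has positive length and the stages after it are empty up to the tight window of
`c`, then the end of stage `n` is not the result of any move, so the particle cannot advance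
further. -/
theorem stuck {k l n q : ℤ} {b c : ℤ → ℤ} (hlk : l ≤ k) (h : InC k l c)
    (hn : ∀ q < n, ¬ Tight k l c q) (hR : c (n - 1) < stateEnd k l c n)
    (hR' : c n = stateEnd k l c (n + 1))
    (hR'' : ¬ Tight k l c n → c (n + 1) = stateEnd k l c (n + 2)) (hb : InC k l b)
    (hq : IsFirst k l b q) : mvL b q ≠ state k l c n (stateEnd k l c n) := by
  intro he
  have hs : 0 ≤ k - l := by omega
  have hv := h.isSplit hs
  obtain ⟨hin, hfirst⟩ := state_inC_and_isFirst hlk h hn hR.le le_rfl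
  have hfirst := hfirst hR
  have hbq := tight_mvL hq.1
  rw [he] at hbq
  -- The window `q` stays tight under the move, so it is not to the left of the leftmost tight
  -- window `n - 2` of the state.
  have hle : n - 2 ≤ q := by
    by_contra hlt
    exact hfirst.2 q (by omega) hbq
  have hbS : ∀ j, b j = state k l c n (stateEnd k l c n) j +
      (if j = q then -1 else if j = q + 1 then 1 else 0) := fun j => by
    rw [← he]
    unfold mvL
    split_ifs <;> omega
  obtain ⟨m, rfl⟩ : ∃ m, n = m + 5 := ⟨n - 5, by ring⟩
  obtain ⟨s1, s2, s3, s4⟩ := state_values k l c m (stateEnd k l c (m + 5))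
  set S := state k l c (m + 5) (stateEnd k l c (m + 5))
  have e : m + 5 - 2 = m + 3 := by ring
  rw [e] at hfirst hle
  have e : m + 5 - 1 = m + 4 := by ring
  rw [e] at hR
  -- For `q > n` the configuration `b` agrees with the state on all sites up to `n`, so its window
  -- `n - 2` would be tight, although `q` is the leftmost one.
  have hgt : q ≤ m + 5 := by
    by_contra hgt
    refine hq.2 (m + 3) (by omega) ?_
    have ht := hfirst.1
    unfold Tight at ht ⊢
    have : ∀ j ≤ m + 5, b j = S j := fun j hj => by
      rw [hbS, if_neg (by omega), if_neg (by omega), add_zero]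
    rw [this _ (by omega), this _ (by omega), this _ (by omega), this _ (by omega)]
    exact ht
  have w1 := (not_tight_shift h).1 (hn (m + 1 + 1) (by omega))
  have w2 := (not_tight_shift h).1 (hn (m + 2 + 1) (by omega))
  have w3 := (not_tight_shift h).1 (hn (m + 3 + 1) (by omega))
  have s12 := s1 (m + 2) le_rfl
  have s50 := s4 (m + 5) (by omega)
  have s51 := s4 (m + 6) (by omega)
  have s52 := s4 (m + 7) (by omega)
  have s53 := s4 (m + 8) (by omega)
  have s54 := s4 (m + 9) (by omega)
  have a3 := hv.facts h hs (m + 3)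
  have a4 := hv.facts h hs (m + 4)
  have a5 := hv.facts h hs (m + 5)
  have a6 := hv.facts h hs (m + 6)
  have a7 := hv.facts h hs (m + 7)
  have a8 := hv.facts h hs (m + 8)
  have b4 := h.four' (m + 4)
  have b5 := h.four' (m + 5)
  have b6 := h.four' (m + 6)
  have b7 := h.four' (m + 7)
  have b8 := h.nn (m + 8)
  have K : kap k (k - l) c (m + 2 + 2) = spl k (k - l) c (m + 4) +
    (c (m + 5) - spl k (k - l) c (m + 5)) := by
      simp only [kap, add_assoc, Int.reduceAdd]
  rw [K] at s12
  have hR3 : c (m + 5) + c (m + 6) < l →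
      c (m + 4) + 2 * c (m + 5) + 2 * c (m + 6) + c (m + 7) < k + l →
      c (m + 5 + 1) = stateEnd k l c (m + 5 + 2) := fun g1 g2 => by
    have := @not_tight_shift k l (m + 4) c h
    simp only [add_assoc, Int.reduceAdd] at this hR''
    simp only [add_assoc, Int.reduceAdd]
    exact hR'' (this.2 (by omega))
  have g2 := hb.four' (m + 2)
  have g3 := hb.four' (m + 3)
  have g4 := hb.four' (m + 4)
  have g5 := hb.four' (m + 5)
  have g6 := hb.four' (m + 6)
  unfold stateEnd at *
  simp only [add_one_add_one, add_one_add_two, add_one_add_three, add_two_add_one,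
    add_two_add_two, add_two_add_three, add_three_add_one, add_three_add_two,
    add_three_add_three, show m + 4 + 1 = m + 5 by ring, show m + 4 + 2 = m + 6 by ring,
    show m + 4 + 3 = m + 7 by ring, show m + 5 + 1 = m + 6 by ring,
    show m + 5 + 2 = m + 7 by ring, show m + 5 + 3 = m + 8 by ring,
    show m + 6 + 1 = m + 7 by ring, show m + 6 + 2 = m + 8 by ring,
    show m + 6 + 3 = m + 9 by ring, show m + 7 + 1 = m + 8 by ring,
    show m + 7 + 2 = m + 9 by ring] at *
  have := stuck_aux (f := c (m + 7)) (g := c (m + 8)) (h := c (m + 9)) hlk w2.1 w3.1 b5.2.1 (by linarith [b6.2.1]) b7.2.1 b4.1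
    b5.1 b6.1 b7.1 b8 ⟨a4.1, a4.2.1⟩ a5.1 a6.1 a7.1 w3.2 b4.2.2.2 b5.2.2.2 a3.2.2.2.1
    a4.2.2.2.2 a5.2.2.2.2 a6.2.2.2.2 a7.2.2.2.2
    (fun x1 x2 => by have := hR3 x1 x2; omega) hR (by omega) s2 s3
  obtain ⟨n1, n2, n3⟩ := this
  have v3 := hbS (m + 3)
  have v4 := hbS (m + 4)
  have v5 := hbS (m + 5)
  have v6 := hbS (m + 6)
  have v7 := hbS (m + 7)
  have v8 := hbS (m + 8)
  have v9 := hbS (m + 9)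
  have v2 := hbS (m + 2)
  rw [s50] at v5
  rw [s51] at v6
  rw [s52] at v7
  rw [s53] at v8
  rw [s54] at v9
  rw [s12] at v2
  clear hbS s1 s2 s3 s4 s12 s50 s51 s52 s53 s54 hv h hin hfirst
  obtain rfl | rfl | rfl : q = m + 3 ∨ q = m + 4 ∨ q = m + 5 := by omega
  · simp [add_assoc] at v2 v3 v4 v5 v6 v7 v8 v9
    refine n1 ⟨?_, ?_, ?_⟩
    · clear * - v3 v4 v5 v6 v7 g4; omega
    · clear * - v3 v4 v5 v6 v7 g3; omega
    · clear * - v3 v4 v5 v6 v7 g4; omega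
  · simp [add_assoc] at v2 v3 v4 v5 v6 v7 v8 v9
    refine n2 ⟨?_, ?_, ?_⟩
    · clear * - v4 v5 v6 v7 v8 g5; omega
    · clear * - v4 v5 v6 v7 v8 g4; omega
    · clear * - v4 v5 v6 v7 v8 g5; omega
  · simp [add_assoc] at v2 v3 v4 v5 v6 v7 v8 v9
    have t3 := (not_tight_shift hb).1 (hq.2 (m + 2 + 1) (by omega))
    have t4 := (not_tight_shift hb).1 (hq.2 (m + 3 + 1) (by omega))
    have t5 := hq.1
    rw [show m + 5 = m + 4 + 1 by ring, tight_shift] at t5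
    simp only [add_assoc, Int.reduceAdd] at t3 t4 t5
    refine n3 ⟨?_, ?_, ?_, ?_, ?_, ?_, ?_, ?_⟩
    · clear * - v3 v4 t3; omega
    · clear * - v2 v3 v4 v5 t3; omega
    · clear * - v4 v5 t4; omega
    · clear * - v5 v6 v7 v8 g5; omega
    · clear * - v6 v7 v8 v9 g6; omega
    · clear * - v6 v7 g6; omega
    · clear * - v3 v4 v5 v6 t4; omega
    · clear * - v4 v5 v6 v7 t5; omega

/-- A further stage of length zero. It is needed when the leftmost tight window jumps by two sites
in one move. -/
theorem range_zero_aux {k l a b c d e f o x y z w : ℤ} (hlk : l ≤ k)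
    (oa : o ≤ a) (o0 : 0 ≤ o) (x0 : 0 ≤ x) (y0 : 0 ≤ y) (z0 : 0 ≤ z) (w0 : 0 ≤ w)
    (ab : a + b < l) (bc : b + c < l) (cd : c + d ≤ l) (de : d + e ≤ l) (f0 : 0 ≤ f)
    (hx : x = min b (min (k - l - o) (k - a - b - c)))
    (hy : y = min c (min (k - l - x) (k - b - c - d)))
    (hz : z = min d (min (k - l - y) (k - c - d - e)))
    (hw : w = min e (min (k - l - z) (k - d - e - f)))
    (h1 : a + 2 * b + 2 * c + d = k + l) (h2 : b + 2 * c + 2 * d + e ≤ k + l)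
    (h3 : d + e = l ∨ c + 2 * d + 2 * e + f = k + l) :
    c = l - d - (e - w) := by
  obtain ⟨x1, x2, x3, x4⟩ := min_three hx
  obtain ⟨y1, y2, y3, y4⟩ := min_three hy
  obtain ⟨z1, z2, z3, z4⟩ := min_three hz
  obtain ⟨w1, w2, w3, w4⟩ := min_three hw
  clear hx hy hz hw
  rcases h3 with h3 | h3 <;> rcases x4 with x4 | x4 | x4 <;> rcases y4 with y4 | y4 | y4 <;>
    rcases z4 with z4 | z4 | z4 <;> rcases w4 with w4 | w4 | w4 <;> omega

theorem cum_congr {c d : ℤ → ℤ} {n : ℤ} (h : ∀ i < n, c i = d i) : cum c n = cum d n := by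
  refine finsum_congr fun i => ?_
  beta_reduce
  split_ifs with hi
  · rw [h i hi]
  · simp

theorem cum_sub {c d : ℤ → ℤ} (hc : c.support.Finite) (hd : d.support.Finite) (n : ℤ) :
    cum (c - d) n = cum c n - cum d n := wsum_sub hc hd

/-- The splittings of a configuration and its move agree away from the moving particle, and have
the same total. -/
theorem cum_spl_mvL {k l s p : ℤ} {c : ℤ → ℤ} (h : InC k l c) (hs : 0 ≤ s) (hsl : s ≤ k - l)
    (hp : IsFirst k l c p) : cum (spl k s (mvL c p)) (p + 2) = cum (spl k s c) (p + 2) := by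
  have h' := h.mvL hp
  have hv := h.isSplit hs
  have hv' := h'.isSplit hs
  have f' := finite_support_spl h' hs
  have f := finite_support_spl h hs
  obtain ⟨q, rfl⟩ : ∃ q, p = q + 3 := ⟨p - 3, by ring⟩
  have T := hp.1
  have n2 := (not_tight_shift h).1 (hp.2 (q + 1 + 1) (by omega))
  rw [show q + 3 = q + 2 + 1 by ring, tight_shift] at T
  have a1 := hv.facts h hs (q + 1)
  have a2 := hv.facts h hs (q + 2)
  have a3 := hv.facts h hs (q + 3)
  have a4 := hv.facts h hs (q + 4)
  have b3 := h.four' (q + 3)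
  have b4 := h.four' (q + 4)
  have r1 := hv'.succ (q + 1)
  have r2 := hv'.succ (q + 2)
  have r3 := hv'.succ (q + 3)
  have r4 := hv'.succ (q + 4)
  have hle := hv.eq_of_le hv' (j := q + 1)
    fun i hi => (mvL_of_ne (c := c) (p := q + 3) (by omega) (by omega)).symm
  have hx' := hle (q + 1) le_rfl
  have m0 := mvL_self c (q + 3)
  have m1 := mvL_succ c (q + 3)
  have m2 : mvL c (q + 3) (q + 1) = c (q + 1) := mvL_of_ne (by omega) (by omega)
  have m3 : mvL c (q + 3) (q + 2) = c (q + 2) := mvL_of_ne (by omega) (by omega)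
  have m4 : mvL c (q + 3) (q + 5) = c (q + 5) := mvL_of_ne (by omega) (by omega)
  have m5 : mvL c (q + 3) (q + 6) = c (q + 6) := mvL_of_ne (by omega) (by omega)
  have e1 : q + 4 + 1 = q + 5 := by ring
  have e2 : q + 4 + 2 = q + 6 := by ring
  have e3 : q + 4 + 3 = q + 7 := by ring
  simp only [add_one_add_one, add_one_add_two, add_one_add_three, add_two_add_one,
    add_two_add_two, add_two_add_three, add_three_add_one, add_three_add_two,
    add_three_add_three, e1, e2, e3] at *
  rw [m2, m3, m0, ← hx'] at r1
  rw [m3, m0, m1] at r2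
  rw [m0, m1, m4] at r3
  rw [m1, m4, m5] at r4
  have hcase := (split_move hsl n2.1 b4.2.1 b3.2.1 n2.2 b3.2.2.2 T a1.2.2.2.2 a2.2.2.2.2
    a3.2.2.2.2 a4.2.2.2.2 r1 r2 r3 r4).2
  rw [show q + 5 = q + 2 + 1 + 1 + 1 by ring, cum_succ f', cum_succ f', cum_succ f', cum_succ f,
    cum_succ f, cum_succ f, cum_congr fun i hi => (hle i (by omega)).symm]
  simp only [add_one_add_one, add_one_add_two, add_two_add_one,
    add_two_add_two, add_three_add_one]
  clear * - hcase
  omega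

/-- The unit that arrives at `p` counts `+1` through `c p` and `-2` through `cum c (p + 1)`. The
last term is unchanged, as the splitting keeps its total below `p + 2`. -/
theorem stateStart_mvL_self {k l p : ℤ} {c : ℤ → ℤ} (hlk : l ≤ k) (h : InC k l c)
    (hp : IsFirst k l c p) :
    stateStart k l (mvL c p) (p + 1) = stateStart k l c (p + 1) - 1 := by
  have hs : 0 ≤ k - l := by omega
  have h' := h.mvL hp
  unfold stateStart
  rw [add_sub_cancel_right, add_one_add_one, mvL_self, cum_sub h'.fin (finite_support_spl h' hs),
    cum_sub h.fin (finite_support_spl h hs), cum_spl_mvL h hs le_rfl hp]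
  have h1 : cum (mvL c p) (p + 1) = cum c (p + 1) + 1 := by
    unfold cum
    rw [wsum_mvL h.fin, if_pos (by omega), if_neg (by omega), sub_zero]
  have h2 : cum (mvL c p) (p + 2) = cum c (p + 2) := by
    unfold cum
    rw [wsum_mvL h.fin, if_pos (by omega), if_pos (by omega)]
    ring
  rw [h1, h2]
  ring

/-- The new leftmost tight window `p'` is `p`, `p - 1` or `p - 2`, and the stages between `p' + 1`
and `p + 1` have length zero, so that `stateStart` takes the same value at both. -/
theorem stateStart_mvL {k l p p' : ℤ} {c : ℤ → ℤ} (hlk : l ≤ k) (h : InC k l c)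
    (hp : IsFirst k l c p) (hp' : IsFirst k l (mvL c p) p') :
    stateStart k l (mvL c p) (p' + 1) = stateStart k l c (p + 1) - 1 := by
  have hs : 0 ≤ k - l := by omega
  have h' := h.mvL hp
  rw [← stateStart_mvL_self hlk h hp]
  have hle : p' ≤ p := by
    by_contra hlt
    exact hp'.2 p (by omega) (tight_mvL hp.1)
  have hge : p - 2 ≤ p' := by
    by_contra hlt
    refine hp.2 p' (by omega) ?_
    have := hp'.1
    unfold Tight at this ⊢
    simpa only [mvL_of_ne (c := c) (p := p) (i := p') (by omega) (by omega),
      mvL_of_ne (c := c) (p := p) (i := p' + 1) (by omega) (by omega),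
      mvL_of_ne (c := c) (p := p) (i := p' - 1) (by omega) (by omega),
      mvL_of_ne (c := c) (p := p) (i := p' + 2) (by omega) (by omega)] using this
  have hz := eq_stateEnd_of_tight hlk h' hp'.1
  have h1 := stateStart_succ hlk h' (p' + 1)
  rw [add_sub_cancel_right, hz, add_one_add_one] at h1
  obtain rfl | rfl | rfl : p' = p ∨ p = p' + 1 ∨ p = p' + 2 := by omega
  · rfl
  · rw [add_one_add_one]
    omega
  · have h2 := stateStart_succ hlk h' (p' + 2)
    rw [add_two_add_one] at h2 ⊢
    have key : mvL c (p' + 2) (p' + 1) = stateEnd k l (mvL c (p' + 2)) (p' + 2) := by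
      obtain ⟨q, rfl⟩ : ∃ q, p' = q + 1 := ⟨p' - 1, by ring⟩
      have T := hp.1
      have n1 := (not_tight_shift h).1 (hp.2 (q + 1) (by omega))
      have n2 := (not_tight_shift h).1 (hp.2 (q + 1 + 1) (by omega))
      have n0 := (not_tight_iff h).1 (hp.2 q (by omega))
      have T' := hp'.1
      set d := mvL c (q + 1 + 2) with hd
      have T3 : Tight k l d (q + 1 + 2) := tight_mvL hp.1
      rw [show q + 1 + 2 = q + 2 + 1 by ring, tight_shift] at T3
      rw [tight_shift] at T'
      have hv := h'.isSplit hs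
      have a0 := hv.facts h' hs q
      have a1 := hv.facts h' hs (q + 1)
      have a2 := hv.facts h' hs (q + 2)
      have a3 := hv.facts h' hs (q + 3)
      have a4 := hv.facts h' hs (q + 4)
      have b0 := h'.four' q
      have b1 := h'.four' (q + 1)
      have b2 := h'.four' (q + 2)
      have b3 := h'.four' (q + 3)
      have b5 := h'.nn (q + 5)
      have e0 : d q = c q := mvL_of_ne (by omega) (by omega)
      have e1 : d (q + 1) = c (q + 1) := mvL_of_ne (by omega) (by omega)
      have e2 : d (q + 2) = c (q + 2) := mvL_of_ne (by omega) (by omega)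
      have e4 : q + 4 + 1 = q + 5 := by ring
      unfold stateEnd
      simp only [add_one_add_one, add_one_add_two, add_one_add_three, add_two_add_one,
        add_two_add_two, add_two_add_three, add_three_add_one, add_three_add_two,
        add_three_add_three, e4] at *
      refine range_zero_aux hlk a0.2.1 a0.1 a1.1 a2.1 a3.1 a4.1 (by omega) (by omega)
        b2.2.1 b3.2.1 b5 a0.2.2.2.2 a1.2.2.2.2 a2.2.2.2.2 a3.2.2.2.2 ?_ b1.2.2.2 T3
      clear * - T' n1 e1 e2
      omega
    rw [show p' + 2 - 1 = p' + 1 by ring, key] at h2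
    omega

/-- The energy of an inserted particle is bounded by the energy of the next one. -/
theorem Ext.stateStart_eq {k l p ρ : ℤ} {c d : ℤ → ℤ} (hl : 1 ≤ l) (hlk : l ≤ k)
    (he : Ext k l c d ρ) (hp : IsFirst k l c p) :
    stateStart k l c (p + 1) = ρ - (2 * l + max (2 * l - k) 0) := by
  induction he generalizing p with
  | free d t h hc =>
    have hs : 0 ≤ k - l := by omega
    have hle := sub_one_ediv_le (t := t) hl
    obtain ⟨h2, -⟩ := free_move (k := k) (c := d) (t := t) hl hlk fun i hi => hc i (by omega)
    rw [hp.unique h2]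
    obtain ⟨z, hz0, hzl, hz⟩ := exists_div l (t - 1) hl
    set P := (t - 1) / l
    have h1 := free_apply (t := t) (y := z + 1) hl (by omega) (by omega)
      (show t = l * P + (z + 1) by omega)
    have hv := h.isSplit hs
    set c := d + RiggedConfig.free l t
    have e : ∀ i ≤ P + 3, c i = if i = P then l - (z + 1) else if i = P + 1 then z + 1 else 0 :=
      fun i hi => by
        show d i + RiggedConfig.free l t i = _
        rw [h1, hc i (by omega), zero_add]
    have e0 : ∀ i < P, c i = 0 := fun i hi => by
      rw [e i (by omega), if_neg (by omega), if_neg (by omega)]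
    have e1 := e P (by omega)
    have e2 := e (P + 1) (by omega)
    have e3 := e (P + 2) (by omega)
    have e4 := e (P + 3) (by omega)
    have em := e0 (P - 1) (by omega)
    rw [if_pos rfl] at e1
    rw [if_neg (by omega), if_pos rfl] at e2
    rw [if_neg (by omega), if_neg (by omega)] at e3 e4
    have v0 : ∀ i < P, spl k (k - l) c i = 0 := fun i hi => by
      have := hv.facts h hs i
      have := e0 i hi
      omega
    have vm := hv.facts h hs (P - 1)
    have v1 := hv.facts h hs P
    have vm' := v0 (P - 1) (by omega)
    rw [show P - 1 + 1 = P by ring, show P - 1 + 2 = P + 1 by ring] at vm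
    unfold stateStart
    rw [add_sub_cancel_right, cum_succ h.fin, cum_eq_zero e0, cum_sub h.fin
      (finite_support_spl h hs), cum_succ h.fin,
      cum_succ h.fin, cum_eq_zero e0, cum_succ (finite_support_spl h hs),
      cum_succ (finite_support_spl h hs), cum_eq_zero v0, e1, e2]
    -- The splitting of capacity `k - l` holds `min l (k - l)` units of the free particle; this is
    -- the origin of the term `max (2 * l - k) 0`.
    have hu : spl k (k - l) c P + spl k (k - l) c (P + 1) = min l (k - l) := by omega
    have : (P + 1 - 2) * l = t - (z + 1) - l := by linarith
    omega
  | step c d q ρ hin hq he ih =>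
    obtain rfl := hp.unique hq
    obtain ⟨p', hp'⟩ := he.isFirst hl hlk
    have := ih hp'
    rw [stateStart_mvL hlk hin hp hp'] at this
    omega

theorem Ext.lower {k l ρ : ℤ} {c d : ℤ → ℤ} (hl : 1 ≤ l) (hlk : l ≤ k) (h : Ext k l c d ρ)
    (m : ℕ) : ∃ c', Ext k l c' d (ρ - m) := by
  induction m with
  | zero => exact ⟨c, by simpa using h⟩
  | succ m ih =>
    obtain ⟨c', h'⟩ := ih
    obtain ⟨p, hp⟩ := h'.isFirst hl hlk
    refine ⟨mvL c' p, ?_⟩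
    have := h'.move hl hlk hp
    rwa [show ρ - (m + 1 : ℕ) = ρ - m - 1 by push_cast; ring]

theorem stateStart_mono {k l m n : ℤ} {c : ℤ → ℤ} (hlk : l ≤ k) (h : InC k l c) (hmn : m ≤ n) :
    stateStart k l c m ≤ stateStart k l c n := by
  refine Int.leInduction (m := m) (motive := fun n _ => stateStart k l c m ≤ stateStart k l c n)
    le_rfl (fun n _ ih => ?_) n hmn
  have h1 := le_stateEnd hlk h n
  have h2 := stateStart_succ hlk h n
  omega

/-- Energies can be lowered at will, so a violation may be assumed to exceed the bound by exactly
one. One more move then reaches the energy of the bound, hence by `Ext.inj` the state at the end of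
the last non-empty stage, which contradicts `stuck`. -/
theorem Ext.le_stateStart {k l p ρ : ℤ} {c c' : ℤ → ℤ} (hl : 1 ≤ l) (hlk : l ≤ k)
    (h : InC k l c) (hp : IsFirst k l c p) (he : Ext k l c' c ρ) :
    ρ ≤ stateStart k l c (p + 1) := by
  by_contra hlt
  push Not at hlt
  obtain ⟨b, hb⟩ := he.lower hl hlk (ρ - (stateStart k l c (p + 1) + 1)).toNat
  rw [show ρ - ((ρ - (stateStart k l c (p + 1) + 1)).toNat : ℤ) = stateStart k l c (p + 1) + 1 by
    omega] at hb
  obtain ⟨lo, hlo⟩ := exists_zero_below h.fin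
  have hex : ∃ n ≤ p, c (n - 1) < stateEnd k l c n := by
    refine ⟨min p (lo - 1), by omega, ?_⟩
    have h1 := hlo (min p (lo - 1) - 1) (by omega)
    have h2 := hlo (min p (lo - 1)) (by omega)
    have h3 := hlo (min p (lo - 1) + 1) (by omega)
    have h4 := (h.isSplit (s := k - l) (by omega)).facts h (by omega) (min p (lo - 1) + 1)
    unfold stateEnd
    omega
  -- The last non-empty stage up to `p`. Non-empty stages exist, since those far to the left have
  -- length `l`.
  obtain ⟨n, ⟨hnp, hR⟩, hmax⟩ := Int.exists_greatest_of_bdd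
    (P := fun n => n ≤ p ∧ c (n - 1) < stateEnd k l c n) ⟨p, fun _ hz => hz.1⟩ hex
  have hz : ∀ m, n < m → m ≤ p + 1 → c (m - 1) = stateEnd k l c m := by
    intro m h1 h2
    rcases h2.eq_or_lt with rfl | h2
    · rw [add_sub_cancel_right]
      exact eq_stateEnd_of_tight hlk h hp.1
    · have h3 := le_stateEnd hlk h m
      by_contra hne
      have := hmax m ⟨by omega, by omega⟩
      omega
  have hs : stateStart k l c (p + 1) = stateStart k l c (n + 1) := by
    refine Int.leInduction (m := n + 1) (motive := fun m _ => m ≤ p + 1 →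
      stateStart k l c m = stateStart k l c (n + 1)) (fun _ => rfl) (fun m hm ih hm' => ?_) (p + 1)
      (by omega) le_rfl
    rw [stateStart_succ hlk h, ← hz m (by omega) (by omega), ih (by omega)]
    ring
  have hE := ext_state hl hlk h (fun q hq => hp.2 q (by omega)) hR.le le_rfl
  rw [← add_sub_assoc, ← stateStart_succ hlk h, ← hs] at hE
  obtain ⟨q, hq⟩ := hb.isFirst hl hlk
  have hb' := hb.move hl hlk hq
  rw [add_sub_cancel_right] at hb'
  refine stuck hlk h (fun q hq => hp.2 q (by omega)) hR ?_ (fun hnt => ?_) hb.inC hq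
    (hb'.inj hl hlk hE)
  · have := hz (n + 1) (by omega) (by omega)
    rwa [add_sub_cancel_right] at this
  · have hne : n ≠ p := fun h => hnt (h ▸ hp.1)
    have := hz (n + 2) (by omega) (by omega)
    rwa [show n + 2 - 1 = n + 1 by ring] at this

theorem stateStart_of_zero_above {k l N n : ℤ} {c : ℤ → ℤ} (hlk : l ≤ k) (h : InC k l c)
    (hN : ∀ i > N, c i = 0) (hn : N + 2 ≤ n) :
    stateStart k l c n = (n - 2) * l - 2 * mass c - mass (c - spl k (k - l) c) := by
  unfold stateStart
  rw [hN _ (by omega), cum_eq_mass fun i hi => hN i (by omega), cum_eq_mass fun i hi => ?_]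
  · ring
  · have := (h.isSplit (s := k - l) (by omega)).facts h (by omega) i
    have := hN i (by omega)
    rw [Pi.sub_apply]
    omega

/-- Some state has the given energy, and by `Ext.inj` it is the given configuration. The energy is
in reach by `Ext.le_stateStart`, or because the stages are unbounded when `c` has no tight window.
-/
theorem Ext.eq_state {k l ρ : ℤ} {c c' : ℤ → ℤ} (hl : 1 ≤ l) (hlk : l ≤ k)
    (he : Ext k l c' c ρ) : ∃ n y, (∀ q < n, ¬ Tight k l c q) ∧ c (n - 1) ≤ y ∧
      y ≤ stateEnd k l c n ∧ c' = state k l c n y ∧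
      ρ = stateStart k l c n + (y - c (n - 1)) := by
  have h := he.inC_right hl
  have key : ∀ p, (∀ q < p, ¬ Tight k l c q) → ρ ≤ stateStart k l c (p + 1) →
      ∃ n y, (∀ q < n, ¬ Tight k l c q) ∧ c (n - 1) ≤ y ∧ y ≤ stateEnd k l c n ∧
        c' = state k l c n y ∧ ρ = stateStart k l c n + (y - c (n - 1)) := by
    intro p hp hρ
    obtain ⟨n, hn, y, h1, h2, h3⟩ := exists_state hl hlk h hρ
    have := ext_state hl hlk h (fun q hq => hp q (by omega)) h1 h2
    rw [← h3] at this
    exact ⟨n, y, fun q hq => hp q (by omega), h1, h2, he.inj hl hlk this, h3⟩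
  by_cases ht : ∃ p, Tight k l c p
  · obtain ⟨p, hp⟩ := exists_isFirst h hl ht.choose_spec
    exact key p hp.2 (he.le_stateStart hl hlk h hp)
  · push Not at ht
    obtain ⟨N, hN⟩ := exists_zero_above h.fin
    -- Beyond the support, `stateStart` at `x + 2` equals `x * l` minus the two masses; with `1 ≤ l`
    -- this choice makes it at least `ρ`.
    set x := max (max N 0) (ρ + 2 * mass c + mass (c - spl k (k - l) c)) with hx
    refine key (x + 1) (fun q _ => ht q) ?_
    rw [stateStart_of_zero_above (N := N) hlk h (fun i hi => hN i (by omega)) (by omega)]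
    have : x * 1 ≤ x * l := mul_le_mul_of_nonneg_left hl (by omega)
    rw [show x + 1 + 1 - 2 = x by ring]
    omega

/-- The energies of the particles that can be inserted into `c`. -/
theorem exists_ext_iff {k l ρ : ℤ} {c : ℤ → ℤ} (hl : 1 ≤ l) (hlk : l ≤ k) (h : InC k l c) :
    (∃ c', Ext k l c' c ρ) ↔ ∀ d σ, Ext k l c d σ → ρ ≤ σ - (2 * l + max (2 * l - k) 0) := by
  constructor
  · rintro ⟨c', he⟩ d σ hd
    obtain ⟨p, hp⟩ := hd.isFirst hl hlk
    rw [← hd.stateStart_eq hl hlk hp]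
    exact he.le_stateStart hl hlk h hp
  · intro hρ
    have key : ∀ p, (∀ q < p, ¬ Tight k l c q) → ρ ≤ stateStart k l c (p + 1) →
        ∃ c', Ext k l c' c ρ := by
      intro p hp hρ
      obtain ⟨n, hn, y, h1, h2, h3⟩ := exists_state hl hlk h hρ
      have := ext_state hl hlk h (fun q hq => hp q (by omega)) h1 h2
      rw [← h3] at this
      exact ⟨_, this⟩
    by_cases hc : InC k (l - 1) c
    · obtain ⟨N, hN⟩ := exists_zero_above h.fin
      set x := max (max N 0) (ρ + 2 * mass c + mass (c - spl k (k - l) c)) with hx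
      refine key (x + 1) (fun q _ => (inC_pred_iff.1 hc).2 q) ?_
      rw [stateStart_of_zero_above (N := N) hlk h (fun i hi => hN i (by omega)) (by omega)]
      have : x * 1 ≤ x * l := mul_le_mul_of_nonneg_left hl (by omega)
      rw [show x + 1 + 1 - 2 = x by ring]
      omega
    · obtain ⟨d, σ, hd⟩ := exists_ext hl hlk h hc
      obtain ⟨p, hp⟩ := hd.isFirst hl hlk
      refine key p hp.2 ?_
      rw [hd.stateStart_eq hl hlk hp]
      exact hρ d σ hd

/-! ### The right boundary -/

/-- The bound is `stateStart k l c (N + 2)`, the energy at which the whole particle sits on the site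
`N`. If `c` still contains a particle of weight `l`, then the leftmost tight window of `c` stops the
inserted one before `N`, and no condition on `ρ` is left. -/
theorem Ext.zero_above_iff {k l ρ N : ℤ} {c c' : ℤ → ℤ} (hl : 1 ≤ l) (hlk : l ≤ k)
    (he : Ext k l c' c ρ) : (∀ i > N, c' i = 0) ↔ (∀ i > N, c i = 0) ∧
      (InC k (l - 1) c → ρ ≤ l * N - 2 * mass c - mass (c - spl k (k - l) c)) := by
  have h := he.inC_right hl
  have hs : 0 ≤ k - l := by omega
  have hv := h.isSplit hs
  obtain ⟨n, y, hn, hy, hy', rfl, rfl⟩ := he.eq_state hl hlk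
  clear he
  obtain ⟨m, rfl⟩ : ∃ m, n = m + 5 := ⟨n - 5, by ring⟩
  obtain ⟨s1, s2, s3, s4⟩ := state_values k l c m y
  set S := state k l c (m + 5) y
  have h5 := hv.facts h hs (m + 5)
  have hsucc := stateStart_succ hlk h (m + 5)
  constructor
  · intro hS
    have hnN : m + 3 ≤ N := by
      by_contra hlt
      have := hS (m + 3) (by omega)
      have := hS (m + 4) (by omega)
      have := hS (m + 5) (by omega)
      have := s4 (m + 5) le_rfl
      omega
    have hcN : ∀ i > N, c i = 0 := by
      intro i hi
      rcases le_or_gt (m + 5) i with h1 | h1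
      · rw [← s4 i h1]
        exact hS i hi
      · obtain rfl : i = m + 4 := by omega
        have h2 := hS (m + 4) hi
        have h3 := h.nn (m + 4)
        rw [show m + 5 - 1 = m + 4 by ring] at hy
        omega
    refine ⟨hcN, fun _ => ?_⟩
    have hT := stateStart_of_zero_above hlk h hcN le_rfl
    rw [show (N + 2 - 2) * l = l * N by ring] at hT
    rw [← hT]
    rcases le_or_gt (m + 4) N with h1 | h1
    · have := stateStart_mono hlk h (show m + 5 + 1 ≤ N + 2 by omega)
      omega
    · obtain rfl : N = m + 3 := by omega
      have h2 := hS (m + 4) (by omega)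
      have h3 := h.nn (m + 5 - 1)
      rw [show m + 3 + 2 = m + 5 by ring]
      omega
  · rintro ⟨hcN, hρ⟩
    have hT : ∀ n ≥ N + 2, _ := fun n hn => stateStart_of_zero_above hlk h hcN hn
    have hnN : m + 3 < N ∨ (m + 3 = N ∧ y = 0) := by
      by_cases hc : InC k (l - 1) c
      · have h1 := hρ hc
        by_contra hcon
        push Not at hcon
        rw [show m + 5 - 1 = m + 4 by ring] at hy h1
        have h2 := hT (m + 5) (by omega)
        have h3 := hcN (m + 4) (by omega)
        rw [show m + 5 - 2 = m + 3 by ring] at h2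
        rcases hcon.1.eq_or_lt with h4 | h4
        · have h5 := hcon.2 h4.symm
          rw [h2, h4, mul_comm] at h1
          omega
        · have h5 : (N + 1) * l ≤ (m + 3) * l := mul_le_mul_of_nonneg_right (by omega) (by omega)
          have h6 : (N + 1) * l = l * N + l := by ring
          omega
      · obtain ⟨d, σ, hd⟩ := exists_ext hl hlk h hc
        obtain ⟨p, hp⟩ := hd.isFirst hl hlk
        have h1 := hp.one_le h
        have h2 : ¬ p < m + 5 := fun h2 => hn p h2 hp.1
        have h3 : ¬ N < p + 1 := fun h3 => by
          have := hcN _ h3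
          omega
        omega
    intro i hi
    rcases le_or_gt (m + 5) i with h1 | h1
    · rw [s4 i h1]
      exact hcN i hi
    · obtain rfl : i = m + 4 := by omega
      omega

/-! ### The left boundary -/

/-- The conditions at the left boundary. -/
structure InP (a b : ℤ) (c : ℤ → ℤ) : Prop where
  neg : ∀ i < 0, c i = 0
  zero : c 0 ≤ a
  one : 2 * c 0 + c 1 ≤ 2 * a + b

/-- An entry of `kap` is a sum of two non-negative parts, so where it vanishes the splitting
vanishes and nothing is left to be shifted in from the right. -/
theorem InP.zero_of_shift {k l s a b : ℤ} {c : ℤ → ℤ} (h : InC k l c) (hs : 0 ≤ s)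
    (hP : InP a b fun j => kap k s c (j + 2)) :
    (∀ i ≤ 1, c i = 0) ∧ c 2 = spl k s c 2 := by
  have hv := h.isSplit hs
  have key : ∀ i ≤ 1, spl k s c i = 0 ∧ c (i + 1) = spl k s c (i + 1) := by
    intro i hi
    have h1 := hP.neg (i - 2) (by omega)
    have h2 := hv.facts h hs i
    have h3 := hv.facts h hs (i + 1)
    rw [show i - 2 + 2 = i by ring] at h1
    unfold kap at h1
    omega
  refine ⟨fun i hi => ?_, (key 1 le_rfl).2⟩
  have h1 := (key (i - 1) (by omega)).2
  rw [sub_add_cancel, (key i hi).1] at h1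
  exact h1

theorem inP_state_iff_of_two_le {k l n y a b : ℤ} {c : ℤ → ℤ} (hl : 1 ≤ l) (hlk : l ≤ k)
    (hb : 0 ≤ b) (h : InC k l c) (hn : 2 ≤ n) (hy : c (n - 1) ≤ y) (hy' : y ≤ stateEnd k l c n) :
    InP a b (state k l c n y) ↔ InP a b (fun j => kap k (k - l) c (j + 2)) ∧
      max (l - a) 0 + max (l - a - b) 0 ≤ stateStart k l c n + (y - c (n - 1)) := by
  have hs : 0 ≤ k - l := by omega
  have hv := h.isSplit hs
  obtain ⟨m, rfl⟩ : ∃ m, n = m + 5 := ⟨n - 5, by ring⟩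
  obtain ⟨s1, s2, s3, s4⟩ := state_values k l c m y
  set S := state k l c (m + 5) y
  have K : ∀ i, kap k (k - l) c i = spl k (k - l) c i + (c (i + 1) - spl k (k - l) c (i + 1)) := fun i => rfl
  have f1 := hv.facts h hs 1
  have f2 := hv.facts h hs 2
  have f3 := hv.facts h hs 3
  have f4 := hv.facts h hs 4
  have K0 := K 2
  have K1 := K 3
  have e2 := le_stateEnd hlk h 2
  have e3 := le_stateEnd hlk h 3
  simp only [Int.reduceAdd] at K0 K1 f1 f2 f3 f4
  have hP : InP a b (fun j => kap k (k - l) c (j + 2)) → (∀ i ≤ 1, c i = 0) ∧ c 2 = spl k (k - l) c 2 ∧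
      stateStart k l c 2 = 0 ∧ stateStart k l c 3 = l - c 2 - (c 3 - spl k (k - l) c 3) ∧
      kap k (k - l) c 2 ≤ a ∧ 2 * kap k (k - l) c 2 + kap k (k - l) c 3 ≤ 2 * a + b := by
    intro hP
    obtain ⟨h1, h2⟩ := hP.zero_of_shift h hs
    have h3 := hP.zero
    have h4 := hP.one
    simp only [Int.reduceAdd] at h3 h4
    have h5 : stateStart k l c 2 = 0 := by
      unfold stateStart
      have hu : ∀ i < 2 + 1, (c - spl k (k - l) c) i = 0 := by
        intro i hi
        have := hv.facts h hs i
        rcases (show i ≤ 1 ∨ i = 2 by omega) with h6 | rfl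
        · have := h1 i h6
          rw [Pi.sub_apply]
          omega
        · rw [Pi.sub_apply]
          omega
      rw [cum_eq_zero fun i hi => h1 i (by omega), cum_eq_zero hu, h1 _ (by omega)]
      ring
    have h6 := stateStart_succ hlk h 2
    unfold stateEnd at h6
    simp only [Int.reduceAdd, Int.reduceSub] at h6
    rw [h5, h1 1 le_rfl] at h6
    refine ⟨h1, h2, h5, by rw [h6]; ring, h3, h4⟩
  unfold stateEnd at hy' e2 e3
  simp only [Int.reduceAdd, Int.reduceSub] at e2 e3
  -- The particle itself touches the sites `0` and `1` only for `n = 2` and `n = 3`; later these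
  -- sites show the shifted `kap`. As `0 ≤ b`, the bound on the energy is the largest of `0`, `l -
  -- a` and `2 * (l - a) - b`, which are the demands of the boundary conditions.
  rcases (show m + 5 = 2 ∨ m + 5 = 3 ∨ 4 ≤ m + 5 by omega) with hm | hm | hm
  · obtain rfl : m = -3 := by omega
    simp only [Int.reduceAdd, Int.reduceNeg, Int.reduceSub] at *
    constructor
    · intro hS
      have h1 := hS.zero
      have h2 := hS.one
      have hPK : InP a b (fun j => kap k (k - l) c (j + 2)) := by
        refine ⟨fun i hi => ?_, ?_, ?_⟩
        · rw [← s1 i (by omega)]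
          exact hS.neg i hi
        · simp only [Int.reduceAdd]
          omega
        · simp only [Int.reduceAdd]
          omega
      obtain ⟨g1, g2, g3, g4, g5, g6⟩ := hP hPK
      have := g1 1 le_rfl
      exact ⟨hPK, by omega⟩
    · rintro ⟨hPK, hr⟩
      obtain ⟨g1, g2, g3, g4, g5, g6⟩ := hP hPK
      have := g1 1 le_rfl
      refine ⟨fun i hi => ?_, by omega, by omega⟩
      rw [s1 i (by omega)]
      exact hPK.neg i hi
  · obtain rfl : m = -2 := by omega
    simp only [Int.reduceAdd, Int.reduceNeg, Int.reduceSub] at *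
    have s0 := s1 0 le_rfl
    simp only [Int.reduceAdd] at s0
    constructor
    · intro hS
      have h1 := hS.zero
      have h2 := hS.one
      have hPK : InP a b (fun j => kap k (k - l) c (j + 2)) := by
        refine ⟨fun i hi => ?_, ?_, ?_⟩
        · rw [← s1 i (by omega)]
          exact hS.neg i hi
        · simp only [Int.reduceAdd]
          omega
        · simp only [Int.reduceAdd]
          omega
      obtain ⟨g1, g2, g3, g4, g5, g6⟩ := hP hPK
      have := g1 1 le_rfl
      exact ⟨hPK, by omega⟩
    · rintro ⟨hPK, hr⟩
      obtain ⟨g1, g2, g3, g4, g5, g6⟩ := hP hPK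
      have := g1 1 le_rfl
      refine ⟨fun i hi => ?_, by omega, by omega⟩
      rw [s1 i (by omega)]
      exact hPK.neg i hi
  · have s0 := s1 0 (by omega)
    have s1' := s1 1 (by omega)
    simp only [Int.reduceAdd] at s0 s1'
    constructor
    · intro hS
      have h1 := hS.zero
      have h2 := hS.one
      have hPK : InP a b (fun j => kap k (k - l) c (j + 2)) := by
        refine ⟨fun i hi => ?_, ?_, ?_⟩
        · rw [← s1 i (by omega)]
          exact hS.neg i hi
        · simp only [Int.reduceAdd]
          omega
        · simp only [Int.reduceAdd]
          omega
      obtain ⟨g1, g2, g3, g4, g5, g6⟩ := hP hPK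
      have h4 := stateStart_mono hlk h hm
      have h6 := stateStart_succ hlk h 3
      unfold stateEnd at h6
      simp only [Int.reduceAdd, Int.reduceSub] at h6
      have := g1 1 le_rfl
      exact ⟨hPK, by omega⟩
    · rintro ⟨hPK, hr⟩
      obtain ⟨g1, g2, g3, g4, g5, g6⟩ := hP hPK
      refine ⟨fun i hi => ?_, by omega, by omega⟩
      rw [s1 i (by omega)]
      exact hPK.neg i hi

/-- For `n < 2` both sides fail until the end of the stage: the state has a positive entry at a
negative site, and the energy is negative. The end of a stage is the start of the next, so the claim
descends from `n = 2`. -/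
theorem inP_state_iff {k l n y a b : ℤ} {c : ℤ → ℤ} (hl : 1 ≤ l) (hlk : l ≤ k)
    (hb : 0 ≤ b) (h : InC k l c) (hy : c (n - 1) ≤ y) (hy' : y ≤ stateEnd k l c n) :
    InP a b (state k l c n y) ↔ InP a b (fun j => kap k (k - l) c (j + 2)) ∧
      max (l - a) 0 + max (l - a - b) 0 ≤ stateStart k l c n + (y - c (n - 1)) := by
  have hs : 0 ≤ k - l := by omega
  have hv := h.isSplit hs
  rcases le_or_gt 2 n with hn | hn
  · exact inP_state_iff_of_two_le hl hlk hb h hn hy hy'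
  obtain ⟨m, rfl⟩ : ∃ m : ℕ, n = 2 - m := ⟨(2 - n).toNat, by omega⟩
  clear hn
  induction m generalizing y with
  | zero => exact inP_state_iff_of_two_le hl hlk hb h (by simp) hy hy'
  | succ m ih =>
    obtain ⟨p, hp⟩ : ∃ p : ℤ, 2 - ((m + 1 : ℕ) : ℤ) = p + 5 := ⟨2 - ((m + 1 : ℕ) : ℤ) - 5, by ring⟩
    have hp' : (2 : ℤ) - m = p + 6 := by push_cast at hp; omega
    rw [hp] at hy hy' ⊢
    rw [hp'] at ih
    have hp1 : p + 5 ≤ 1 := by omega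
    rcases hy'.eq_or_lt with rfl | hlt
    · have h1 := ih (y := c (p + 5)) (by rw [show p + 6 - 1 = p + 5 by ring])
        (by have := le_stateEnd hlk h (p + 6); rwa [show p + 6 - 1 = p + 5 by ring] at this)
      rw [show p + 6 - 1 = p + 5 by ring] at h1
      have h2 := state_end k l c (p + 5)
      have h3 := stateStart_succ hlk h (p + 5)
      rw [show p + 5 + 1 = p + 6 by ring] at h2 h3
      rw [h2]
      refine h1.trans (and_congr_right fun _ => ?_)
      omega
    · have f0 := hv.facts h hs (p + 5)
      have f1 := hv.facts h hs (p + 6)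
      have f2 := h.nn (p + 4)
      constructor
      · intro hS
        exfalso
        obtain ⟨s1, s2, s3, s4⟩ := state_values k l c p y
        have h1 := hS.neg (p + 3) (by omega)
        unfold stateEnd at hlt
        rw [show p + 5 + 1 = p + 6 by ring] at hlt
        rw [show p + 5 - 1 = p + 4 by ring] at hy
        have h2 := h.nn (p + 6)
        omega
      · rintro ⟨hPK, hr⟩
        exfalso
        obtain ⟨h1, h2⟩ := hPK.zero_of_shift h hs
        rw [stateStart_eq hlk h fun i hi => h1 i (by omega), h1 _ (by omega)] at hr
        unfold stateEnd at hlt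
        rw [show p + 5 + 1 = p + 6 by ring] at hlt
        have h3 : (p + 5 - 2) * l ≤ (-1) * l := mul_le_mul_of_nonneg_right (by omega) (by omega)
        omega

theorem Ext.inP_iff {k l ρ a b : ℤ} {c c' : ℤ → ℤ} (hl : 1 ≤ l) (hlk : l ≤ k) (hb : 0 ≤ b)
    (he : Ext k l c' c ρ) : InP a b c' ↔ InP a b (fun j => RiggedConfig.kap k (k - l) c (j + 2)) ∧
      max (l - a) 0 + max (l - a - b) 0 ≤ ρ := by
  obtain ⟨n, y, hn, hy, hy', rfl, rfl⟩ := he.eq_state hl hlk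
  exact inP_state_iff hl hlk hb (he.inC_right hl) hy hy'

/-! ### Sequences of carriers -/

/-- Apply carriers one after the other. -/
noncomputable def kapL (k : ℤ) (M : List ℤ) (c : ℤ → ℤ) : ℤ → ℤ :=
  M.foldl (fun c s => kap k s c) c

theorem InC.kapL {k l : ℤ} {M : List ℤ} {c : ℤ → ℤ} (h : InC k l c)
    (hM : ∀ s ∈ M, 0 ≤ s ∧ s ≤ k - l) : InC k l (kapL k M c) := by
  induction M generalizing c with
  | nil => exact h
  | cons s M ih =>
    have hs := hM s List.mem_cons_self
    exact ih (h.kap hs.1 hs.2) fun t ht => hM t (List.mem_cons_of_mem _ ht)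

theorem Ext.kapL {k l ρ : ℤ} {M : List ℤ} {c d : ℤ → ℤ} (hl : 1 ≤ l) (hlk : l ≤ k)
    (hM : ∀ s ∈ M, 0 ≤ s ∧ s ≤ k - l) (h : Ext k l c d ρ) :
    Ext k l (kapL k M c) (kapL k M d) (ρ - (M.map fun s => max (l - s) 0).sum) := by
  induction M generalizing c d ρ with
  | nil => simpa [RiggedConfig.kapL] using h
  | cons s M ih =>
    have hs := hM s List.mem_cons_self
    have := ih (fun t ht => hM t (List.mem_cons_of_mem _ ht)) (h.kap hl hlk hs.1 hs.2)
    rw [List.map_cons, List.sum_cons, ← sub_sub]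
    exact this

theorem kap_zero_left {k l : ℤ} {c : ℤ → ℤ} (h : InC k l c) : kap k 0 c = fun i => c (i + 1) := by
  have hv := h.isSplit le_rfl
  have : ∀ i, spl k 0 c i = 0 := fun i => by
    have := hv.bounds h le_rfl i
    omega
  funext i
  rw [kap, this, this]
  ring

theorem kap_zero_right {k l s : ℤ} (h : InC k l 0) (hs : 0 ≤ s) : kap k s 0 = 0 := by
  have hv := h.isSplit hs
  have : ∀ i, spl k s 0 i = 0 := fun i => by
    have := hv.facts h hs i
    simp only [Pi.zero_apply] at this
    omega
  funext i
  rw [kap, this, this]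
  rfl

theorem kapL_zero {k l : ℤ} {M : List ℤ} (h : InC k l 0) (hM : ∀ s ∈ M, 0 ≤ s) :
    kapL k M 0 = 0 := by
  induction M with
  | nil => rfl
  | cons s M ih =>
    have hs := hM s List.mem_cons_self
    rw [kapL, List.foldl_cons, kap_zero_right h hs]
    exact ih fun t ht => hM t (List.mem_cons_of_mem _ ht)

/-- The minimal energy of a particle of weight `j` in a configuration that satisfies the boundary
conditions after the carriers in `M` have been applied. -/
def rmin (a b : ℤ) (M : List ℤ) (j : ℤ) : ℤ :=
  max (j - a) 0 + max (j - a - b) 0 + (M.map fun s => max (j - s) 0).sum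

/-- A carrier of capacity `0` is a shift by one (`kap_zero_left`), so the shift by two that an
extraction causes is absorbed by two such carriers. The boundary condition keeps its form, with a
longer list `M`, and the recursion can continue. -/
theorem Ext.inP_kapL_iff {k l ρ a b : ℤ} {M : List ℤ} {c d : ℤ → ℤ} (hl : 1 ≤ l) (hlk : l ≤ k)
    (hb : 0 ≤ b) (hM : ∀ s ∈ M, 0 ≤ s ∧ s ≤ k - l) (h : Ext k l c d ρ) :
    InP a b (RiggedConfig.kapL k M c) ↔
      InP a b (RiggedConfig.kapL k (M ++ [k - l, 0, 0]) d) ∧ rmin a b M l ≤ ρ := by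
  have h1 := (h.kapL hl hlk hM).inP_iff (a := a) hl hlk hb
  have hd := (h.inC_right hl).kapL hM
  have h2 := hd.kap (s := k - l) (by omega) le_rfl
  have h3 : RiggedConfig.kapL k (M ++ [k - l, 0, 0]) d =
      fun j => RiggedConfig.kap k (k - l) (RiggedConfig.kapL k M d) (j + 2) := by
    have h4 := h2.kap (s := 0) le_rfl (by omega)
    unfold RiggedConfig.kapL at *
    rw [List.foldl_append, List.foldl_cons, List.foldl_cons, List.foldl_cons, List.foldl_nil,
      kap_zero_left h4, kap_zero_left h2]
    funext j
    beta_reduce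
    rw [show j + 1 + 1 = j + 2 by ring]
  rw [h1, h3]
  refine and_congr_right fun _ => ?_
  unfold rmin
  omega

/-- For `j ≤ l` the increment is `A k j l`; this is how the quadratic form enters the lower bounds.
-/
theorem rmin_append {k l j a b : ℤ} (M : List ℤ) (hj : 0 ≤ j) :
    rmin a b (M ++ [k - l, 0, 0]) j = rmin a b M j + (2 * j + max (j + l - k) 0) := by
  unfold rmin
  rw [List.map_append, List.sum_append, List.map_cons, List.map_cons, List.map_cons, List.map_nil,
    List.sum_cons, List.sum_cons, List.sum_cons, List.sum_nil,
    show j - (k - l) = j + l - k by ring]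
  omega

/-! ### The content of a configuration -/

/-- `HasContent k l c m`: extracting all particles of weight `l`, then those of weight `l - 1`, and
so on, from `c` yields `m j` particles of weight `j` for all `j`. -/
inductive HasContent (k : ℕ) : ℕ → (ℤ → ℤ) → (ℕ →₀ ℕ) → Prop
  | zero : HasContent k 0 0 0
  | pred (l : ℕ) (c : ℤ → ℤ) (m : ℕ →₀ ℕ) (h : HasContent k l c m) : HasContent k (l + 1) c m
  | ext (l : ℕ) (c d : ℤ → ℤ) (m : ℕ →₀ ℕ) (ρ : ℤ) (he : Ext k (l + 1) c d ρ)
      (h : HasContent k (l + 1) d m) : HasContent k (l + 1) c (m + Finsupp.single (l + 1) 1)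

theorem inC_zero (k l : ℕ) : InC k l 0 := by
  refine ⟨by simp, fun _ => le_rfl, fun _ => ?_, fun _ => ?_, fun _ => ?_⟩ <;> simp
  omega

theorem HasContent.inC {k l : ℕ} {c : ℤ → ℤ} {m : ℕ →₀ ℕ} (h : HasContent k l c m) :
    InC k l c := by
  induction h with
  | zero => exact inC_zero k 0
  | pred l c m h ih => exact ih.mono (by push_cast; omega)
  | ext l c d m ρ he h ih => exact_mod_cast he.inC

theorem HasContent.eq_zero {k l j : ℕ} {c : ℤ → ℤ} {m : ℕ →₀ ℕ} (h : HasContent k l c m)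
    (hj : l < j) : m j = 0 := by
  induction h with
  | zero => rfl
  | pred l c m h ih => exact ih (by omega)
  | ext l c d m ρ he h ih =>
    rw [Finsupp.add_apply, ih hj, Finsupp.single_eq_of_ne (by omega), add_zero]

theorem HasContent.eq_zero_zero {k l : ℕ} {c : ℤ → ℤ} {m : ℕ →₀ ℕ} (h : HasContent k l c m) :
    m 0 = 0 := by
  induction h with
  | zero => rfl
  | pred l c m h ih => exact ih
  | ext l c d m ρ he h ih => rw [Finsupp.add_apply, ih, Finsupp.single_eq_of_ne (by omega), add_zero]

theorem hasContent_succ_iff {k l : ℕ} {c : ℤ → ℤ} {m : ℕ →₀ ℕ} (hm : m (l + 1) = 0) :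
    HasContent k (l + 1) c m ↔ HasContent k l c m := by
  refine ⟨fun h => ?_, .pred l c m⟩
  generalize hL : l + 1 = L at h
  cases h with
  | zero => omega
  | pred l' c m h =>
    obtain rfl : l = l' := by omega
    exact h
  | ext l' c d m ρ he h =>
    obtain rfl : l = l' := by omega
    simp at hm

theorem hasContent_add_single_iff {k l : ℕ} {c : ℤ → ℤ} {m : ℕ →₀ ℕ} :
    HasContent k (l + 1) c (m + Finsupp.single (l + 1) 1) ↔
      ∃ d ρ, Ext k (l + 1) c d ρ ∧ HasContent k (l + 1) d m := by
  refine ⟨fun h => ?_, fun ⟨d, ρ, he, h⟩ => .ext l c d m ρ he h⟩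
  generalize hL : l + 1 = L at h
  generalize hM : m + Finsupp.single L 1 = M at h
  cases h with
  | zero => omega
  | pred l' c m' h =>
    have := h.eq_zero (j := l' + 1) (by omega)
    rw [← hM] at this
    simp at this
  | ext l' c d m' ρ he h =>
    obtain rfl : l = l' := by omega
    obtain rfl := add_right_cancel hM
    exact ⟨d, ρ, he, h⟩

theorem exists_hasContent {k l : ℕ} (hlk : l ≤ k) {c : ℤ → ℤ} (h : InC k l c) :
    ∃ m, HasContent k l c m := by
  induction l generalizing c with
  | zero =>
    have : c = 0 := by
      funext i
      have := h.nn i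
      have := h.nn (i + 1)
      have := h.two i
      simp only [Nat.cast_zero] at this
      rw [Pi.zero_apply]
      omega
    exact ⟨0, this ▸ .zero⟩
  | succ l ih =>
    have key : ∀ (n : ℕ) (c : ℤ → ℤ), InC k (l + 1 : ℕ) c → mass c ≤ n →
        ∃ m, HasContent k (l + 1) c m := by
      intro n
      induction n with
      | zero =>
        intro c h hn
        by_cases hc : InC k l c
        · obtain ⟨m, hm⟩ := ih (by omega) hc
          exact ⟨m, .pred l c m hm⟩
        · exfalso
          obtain ⟨d, ρ, he⟩ := exists_ext (l := (l + 1 : ℕ)) (by push_cast; omega)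
            (by exact_mod_cast hlk) h (by push_cast; simpa using hc)
          have h1 := he.mass_eq (by push_cast; omega)
          have h2 := mass_nonneg (he.inC_right (by push_cast; omega))
          push_cast at h1 hn
          omega
      | succ n ihn =>
        intro c h hn
        by_cases hc : InC k l c
        · obtain ⟨m, hm⟩ := ih (by omega) hc
          exact ⟨m, .pred l c m hm⟩
        · obtain ⟨d, ρ, he⟩ := exists_ext (l := (l + 1 : ℕ)) (by push_cast; omega)
            (by exact_mod_cast hlk) h (by push_cast; simpa using hc)
          have h1 := he.mass_eq (by push_cast; omega)
          obtain ⟨m, hm⟩ := ihn d (he.inC_right (by push_cast; omega)) (by push_cast at h1 hn; omega)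
          exact ⟨_, .ext l c d m ρ (by exact_mod_cast he) hm⟩
    exact key (mass c).toNat c h (by omega)

theorem HasContent.unique {k l : ℕ} (hlk : l ≤ k) {c : ℤ → ℤ} {m m' : ℕ →₀ ℕ}
    (h : HasContent k l c m) (h' : HasContent k l c m') : m = m' := by
  induction h generalizing m' with
  | zero =>
    generalize hc : (0 : ℤ → ℤ) = c at h'
    generalize hl : 0 = l at h'
    cases h' with
    | zero => rfl
    | pred => omega
    | ext => omega
  | pred l c m h ih =>
    generalize hL : l + 1 = L at h'
    cases h' with
    | zero => omega
    | pred l' c m' h' =>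
      obtain rfl : l = l' := by omega
      exact ih (by omega) h'
    | ext l' c d m' ρ he h' =>
      obtain rfl : l = l' := by omega
      exfalso
      refine he.not_pred (by omega) (by omega) ?_
      rw [add_sub_cancel_right]
      exact h.inC
  | ext l c d m ρ he h ih =>
    generalize hL : l + 1 = L at h'
    cases h' with
    | zero => omega
    | pred l' c m' h' =>
      obtain rfl : l = l' := by omega
      exfalso
      refine he.not_pred (by omega) (by omega) ?_
      rw [add_sub_cancel_right]
      exact h'.inC
    | ext l' c d' m' ρ' he' h' =>
      obtain rfl : l = l' := by omega
      obtain ⟨rfl, -⟩ := he.unique (by omega) (by omega) he'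
      rw [ih hlk h']

/-- The mass outside the splitting is the loss of energy under the carrier (`deg_kap`), and by
`Ext.kap` each particle of weight `j` contributes `max (j - s) 0` to it. For `s = k - l` the
coefficients are those of row `l` of `A`. -/
theorem HasContent.mass_add {k l : ℕ} {s : ℤ} (hlk : l ≤ k) {c : ℤ → ℤ} {m : ℕ →₀ ℕ}
    (h : HasContent k l c m) (hs : 0 ≤ s) (hsl : s ≤ k - l) :
    2 * mass c + mass (c - spl k s c) =
      ∑ j ∈ Finset.Icc 1 k, (2 * (j : ℤ) + max (j - s) 0) * (m j : ℤ) := by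
  have hdeg : ∀ c, InC k l c → mass (c - spl k s c) = deg c - deg (kap k s c) := fun c hc => by
    rw [deg_kap hc hs]
    ring
  rw [hdeg c h.inC]
  clear hdeg
  induction h with
  | zero =>
    rw [kap_zero_right (inC_zero k 0) hs]
    simp [mass, wsum]
  | pred l c m h ih => exact ih (by omega) (by push_cast at hsl; omega)
  | ext l c d m ρ he h ih =>
    push_cast at hsl
    have h1 := he.mass_eq (by omega)
    have h2 := he.deg_eq (by omega)
    have h3 := (he.kap (by omega) (by omega) hs hsl).deg_eq (by omega)
    have h4 := ih hlk (by push_cast; exact hsl)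
    simp only [Finsupp.add_apply]
    have h5 : ∀ j ∈ Finset.Icc 1 k, (2 * (j : ℤ) + max (j - s) 0) *
        ((m j + Finsupp.single (l + 1) 1 j : ℕ) : ℤ) =
          (2 * (j : ℤ) + max (j - s) 0) * (m j : ℤ) +
            if j = l + 1 then 2 * ((l + 1 : ℕ) : ℤ) + max (((l + 1 : ℕ) : ℤ) - s) 0 else 0 := by
      intro j _
      rw [Finsupp.single_apply]
      split_ifs with h6 h7 h7
      · subst h7
        push_cast
        ring
      · exact absurd h6.symm h7
      · exact absurd h7.symm h6
      · push_cast
        ring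
    rw [Finset.sum_congr rfl h5, Finset.sum_add_distrib, Finset.sum_ite_eq',
      if_pos (Finset.mem_Icc.2 ⟨by omega, hlk⟩), ← h4, h1, h2, h3]
    push_cast
    ring

/-! ### Gaussian binomial coefficients -/

theorem q_ne_zero : q ≠ 0 := RatFunc.X_ne_zero

theorem one_sub_q_pow_ne_zero {n : ℕ} (hn : n ≠ 0) : 1 - q ^ n ≠ 0 := by
  intro h
  have h1 : (algebraMap (Polynomial ℚ) (RatFunc ℚ)) (1 - Polynomial.X ^ n) = 0 := by
    simpa [q] using h
  have h2 := (map_eq_zero_iff _ (RatFunc.algebraMap_injective ℚ)).1 h1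
  have h3 := congrArg (Polynomial.eval 0) h2
  simp [hn] at h3

theorem qBinom_of_lt {m : ℤ} {n : ℕ} (h : m < n) : qBinom m n = 0 := if_neg (by omega)

theorem qBinom_self (n : ℕ) : qBinom n n = 1 := by
  unfold qBinom
  rw [if_pos le_rfl]
  refine Finset.prod_eq_one fun i hi => ?_
  rw [sub_self, zero_add, zpow_natCast]
  exact div_self (one_sub_q_pow_ne_zero (by have := (Finset.mem_Icc.1 hi).1; omega))

theorem prod_Icc_shift (f : ℕ → RatFunc ℚ) (n : ℕ) :
    ∏ i ∈ Finset.Icc 1 (n + 1), f (i - 1) = f 0 * ∏ i ∈ Finset.Icc 1 n, f i := by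
  induction n with
  | zero => simp
  | succ n ih =>
    rw [Finset.prod_Icc_succ_top (by omega), ih, Finset.prod_Icc_succ_top (by omega),
      add_tsub_cancel_right, mul_assoc]

theorem qBinom_succ_succ {x : ℤ} {n : ℕ} (hx : 0 ≤ x) :
    qBinom (x + n + 1) (n + 1) = qBinom (x + n) n + q ^ (n + 1) * qBinom (x - 1 + n + 1) (n + 1) := by
  have h0 := one_sub_q_pow_ne_zero (n := n + 1) (by omega)
  have hn : ∀ n, ∏ i ∈ Finset.Icc 1 n, (1 - q ^ i) ≠ 0 := fun n => Finset.prod_ne_zero_iff.2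
    fun i hi => one_sub_q_pow_ne_zero (by have := (Finset.mem_Icc.1 hi).1; omega)
  set P := ∏ i ∈ Finset.Icc 1 n, (1 - q ^ (x + (i : ℤ))) with hP
  set D := ∏ i ∈ Finset.Icc 1 n, (1 - q ^ i) with hD
  have h1 : qBinom (x + n) n = P / D := by
    unfold qBinom
    rw [if_pos (by omega), Finset.prod_div_distrib]
    simp only [add_sub_cancel_right]
    rfl
  have h2 : qBinom (x + n + 1) (n + 1) = P * (1 - q ^ (x + n + 1)) / (D * (1 - q ^ (n + 1))) := by
    unfold qBinom
    rw [if_pos (by push_cast; omega), Finset.prod_div_distrib,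
      Finset.prod_Icc_succ_top (by omega), Finset.prod_Icc_succ_top (by omega)]
    push_cast
    rw [show x + n + 1 - (n + 1) = x by ring, ← add_assoc]
  have h3 : qBinom (x - 1 + n + 1) (n + 1) = (1 - q ^ x) * P / (D * (1 - q ^ (n + 1))) := by
    rcases hx.eq_or_lt with rfl | hx
    · rw [qBinom_of_lt (by push_cast; omega), zpow_zero, sub_self, zero_mul, zero_div]
    · unfold qBinom
      rw [if_pos (by push_cast; omega), Finset.prod_div_distrib,
        Finset.prod_Icc_succ_top (a := 1) (b := n) (by omega) (fun i => 1 - q ^ i)]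
      congr 1
      have := prod_Icc_shift (fun i => 1 - q ^ (x + (i : ℤ))) n
      simp only [Nat.cast_zero, add_zero] at this
      rw [← this]
      refine Finset.prod_congr rfl fun i hi => ?_
      have := (Finset.mem_Icc.1 hi).1
      congr 2
      push_cast [this]
      ring
  rw [h1, h2, h3]
  have h4 : q ^ (x + n + 1) = q ^ x * q ^ (n + 1) := by
    rw [add_assoc, zpow_add₀ q_ne_zero]
    norm_cast
  rw [h4]
  have := hn n
  field_simp
  ring

/-- The index `i` is the amount by which the smallest of `n + 1` energies exceeds its minimum. Terms
with `i > x` vanish, so any `K ≥ x` serves. -/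
theorem sum_qBinom {x : ℤ} {n : ℕ} (K : ℕ) (hx : x ≤ K) :
    ∑ i ∈ Finset.range (K + 1), q ^ (i * (n + 1)) * qBinom (x - i + n) n =
      qBinom (x + n + 1) (n + 1) := by
  induction K generalizing x with
  | zero =>
    simp only [zero_add, Finset.sum_range_one, zero_mul, pow_zero, one_mul, Nat.cast_zero, sub_zero]
    rcases (show x = 0 ∨ x < 0 by simp at hx; omega) with rfl | h
    · have := qBinom_self (n + 1)
      push_cast at this
      rw [zero_add, qBinom_self, this]
    · rw [qBinom_of_lt (by omega), qBinom_of_lt (by push_cast; omega)]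
  | succ K ih =>
    rw [Finset.sum_range_succ']
    have h1 : ∀ i ∈ Finset.range (K + 1), q ^ ((i + 1) * (n + 1)) *
        qBinom (x - (i + 1 : ℕ) + n) n =
          q ^ (n + 1) * (q ^ (i * (n + 1)) * qBinom (x - 1 - i + n) n) := by
      intro i _
      rw [add_mul, pow_add, one_mul, show x - ((i + 1 : ℕ) : ℤ) + n = x - 1 - i + n by
        push_cast; ring]
      ring
    rw [Finset.sum_congr rfl h1, ← Finset.mul_sum, ih (by push_cast at hx; omega)]
    simp only [zero_mul, pow_zero, one_mul, Nat.cast_zero, sub_zero]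
    rcases le_or_gt 0 x with h | h
    · rw [qBinom_succ_succ h, add_comm]
    · rw [qBinom_of_lt (m := x + n) (by omega), qBinom_of_lt (by push_cast; omega),
        qBinom_of_lt (by push_cast; omega), mul_zero, add_zero]

/-! ### Recursion for the fermionic summands -/

theorem fermTerm_congr {k N : ℕ} {r r' : ℕ → ℤ} {m : ℕ →₀ ℕ}
    (h : ∀ j ∈ Finset.Icc 1 k, m j ≠ 0 → r j = r' j) : fermTerm k N r m = fermTerm k N r' m := by
  unfold fermTerm
  congr 1
  · congr 2
    refine Finset.sum_congr rfl fun i hi => ?_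
    by_cases h0 : m i = 0
    · simp [h0]
    · rw [h i hi h0]
  · refine Finset.prod_congr rfl fun j hj => ?_
    rw [h j (Finset.mem_filter.1 hj).1 (Finset.mem_filter.1 hj).2]

/-- The factor of the fermionic summand that belongs to `j`. -/
noncomputable def fermFactor (k N : ℕ) (r : ℕ → ℤ) (m : ℕ →₀ ℕ) (j : ℕ) : RatFunc ℚ :=
  if m j ≠ 0 then
    qBinom ((j : ℤ) * (N : ℤ) - (∑ i ∈ Finset.Icc 1 k, A k j i * (m i : ℤ)) + A k j j - r j
        + (m j : ℤ)) (m j)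
  else 1

theorem fermTerm_eq {k l : ℕ} (hl : l ∈ Finset.Icc 1 k) (N : ℕ) (r : ℕ → ℤ) (m : ℕ →₀ ℕ) :
    fermTerm k N r m =
      q ^ (Q k m + (r l * m l + ∑ i ∈ (Finset.Icc 1 k).erase l, r i * (m i : ℤ))) *
        (fermFactor k N r m l * ∏ j ∈ (Finset.Icc 1 k).erase l, fermFactor k N r m j) := by
  unfold fermTerm
  rw [Finset.add_sum_erase _ (fun i => r i * (m i : ℤ)) hl,
    Finset.mul_prod_erase _ (fermFactor k N r m) hl, Finset.prod_filter]
  rfl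

theorem sum_add_single {k l : ℕ} (hl : l ∈ Finset.Icc 1 k) (f : ℕ → ℤ) (m : ℕ →₀ ℕ) :
    ∑ i ∈ Finset.Icc 1 k, f i * (((m + Finsupp.single l 1 : ℕ →₀ ℕ) i : ℕ) : ℤ) =
      ∑ i ∈ Finset.Icc 1 k, f i * (m i : ℤ) + f l := by
  have : ∀ i ∈ Finset.Icc 1 k, f i * (((m + Finsupp.single l 1 : ℕ →₀ ℕ) i : ℕ) : ℤ) =
      f i * (m i : ℤ) + if i = l then f l else 0 := by
    intro i _
    rw [Finsupp.add_apply, Finsupp.single_apply]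
    split_ifs with h1 h2 h2
    · subst h1
      push_cast
      ring
    · exact absurd h1.symm h2
    · exact absurd h2.symm h1
    · push_cast
      ring
  rw [Finset.sum_congr rfl this, Finset.sum_add_distrib, Finset.sum_ite_eq', if_pos hl]

theorem Q_add_single {k l : ℕ} (hl : l ∈ Finset.Icc 1 k) (m : ℕ →₀ ℕ) :
    Q k (m + Finsupp.single l 1) = Q k m + ∑ i ∈ Finset.Icc 1 k, A k l i * (m i : ℤ) := by
  have h1 := two_mul_Q k m
  have h2 := two_mul_Q k (m + Finsupp.single l 1)
  have e : ∀ m' : ℕ →₀ ℕ, ∑ i ∈ Finset.Icc 1 k, ∑ j ∈ Finset.Icc 1 k, A k i j * (m' i : ℤ) *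
      (m' j : ℤ) =
      ∑ i ∈ Finset.Icc 1 k, (∑ j ∈ Finset.Icc 1 k, A k i j * (m' j : ℤ)) * (m' i : ℤ) := fun m' =>
    Finset.sum_congr rfl fun i _ => by
      rw [Finset.sum_mul]
      exact Finset.sum_congr rfl fun j _ => by ring
  rw [e] at h1 h2
  rw [sum_add_single hl, sum_add_single hl] at h2
  simp only [sum_add_single hl, add_mul, Finset.sum_add_distrib] at h2
  have h3 : ∑ i ∈ Finset.Icc 1 k, A k i l * (m i : ℤ) = ∑ i ∈ Finset.Icc 1 k, A k l i * (m i : ℤ) :=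
    Finset.sum_congr rfl fun i _ => by rw [A_comm]
  rw [h3] at h2
  linarith

/-- The algebraic counterpart of removing the first particle of weight `l` with energy `r l + i`. If
`m l = 0`, the summand contains no binomial for `l`, so the upper bound on the energy has to be
imposed as a condition; otherwise the vanishing of the binomial takes care of it. -/
theorem sum_fermTerm {k l N K : ℕ} (hl : l ∈ Finset.Icc 1 k) {r r' : ℕ → ℤ} (m : ℕ →₀ ℕ)
    (hr : ∀ j ∈ Finset.Icc 1 k, j ≠ l → r' j = r j + A k j l)
    (hK : (l : ℤ) * N - (∑ i ∈ Finset.Icc 1 k, A k l i * (m i : ℤ)) - r l ≤ K) :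
    ∑ i ∈ Finset.range (K + 1), q ^ (r l + i) *
      (if m l = 0 → r l + i ≤ (l : ℤ) * N - ∑ i ∈ Finset.Icc 1 k, A k l i * (m i : ℤ) then
        fermTerm k N (Function.update r' l (r l + i + A k l l)) m else 0) =
      fermTerm k N r (m + Finsupp.single l 1) := by
  set n := m l with hn
  set Y := ∑ i ∈ Finset.Icc 1 k, A k l i * (m i : ℤ) with hY
  set X := (l : ℤ) * N - Y - r l with hX
  set S := ∑ i ∈ (Finset.Icc 1 k).erase l, r i * (m i : ℤ) with hS
  set R := ∏ j ∈ (Finset.Icc 1 k).erase l, fermFactor k N r' m j with hR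
  have hSA : ∑ i ∈ (Finset.Icc 1 k).erase l, r' i * (m i : ℤ) = S + Y - A k l l * n := by
    have h1 : Y = A k l l * (m l : ℤ) + ∑ i ∈ (Finset.Icc 1 k).erase l, A k l i * (m i : ℤ) :=
      (Finset.add_sum_erase _ _ hl).symm
    rw [h1, hS, hn, show S + (A k l l * (m l : ℤ) + ∑ i ∈ (Finset.Icc 1 k).erase l,
      A k l i * (m i : ℤ)) - A k l l * (m l : ℤ) = S + ∑ i ∈ (Finset.Icc 1 k).erase l,
      A k l i * (m i : ℤ) by ring, hS, ← Finset.sum_add_distrib]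
    refine Finset.sum_congr rfl fun i hi => ?_
    rw [hr i (Finset.mem_of_mem_erase hi) (Finset.ne_of_mem_erase hi), A_comm k i l]
    ring
  have hterm : ∀ i ∈ Finset.range (K + 1), q ^ (r l + i) *
      (if n = 0 → r l + i ≤ (l : ℤ) * N - Y then
        fermTerm k N (Function.update r' l (r l + i + A k l l)) m else 0) =
      q ^ (Q k m + Y + S + r l * (n + 1)) * R * (q ^ (i * (n + 1)) * qBinom (X - i + n) n) := by
    intro i _
    have h1 : fermFactor k N (Function.update r' l (r l + i + A k l l)) m l =
        if n ≠ 0 then qBinom (X - i + n) n else 1 := by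
      unfold fermFactor
      rw [Function.update_self, ← hn, ← hY]
      congr 2
      ring
    have h2 : ∏ j ∈ (Finset.Icc 1 k).erase l,
        fermFactor k N (Function.update r' l (r l + i + A k l l)) m j = R := by
      refine Finset.prod_congr rfl fun j hj => ?_
      unfold fermFactor
      rw [Function.update_of_ne (Finset.ne_of_mem_erase hj)]
    have h3 : ∑ j ∈ (Finset.Icc 1 k).erase l,
        Function.update r' l (r l + i + A k l l) j * (m j : ℤ) = S + Y - A k l l * n := by
      rw [← hSA]
      refine Finset.sum_congr rfl fun j hj => ?_
      rw [Function.update_of_ne (Finset.ne_of_mem_erase hj)]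
    rw [fermTerm_eq hl, h1, h2, h3, Function.update_self, ← hn]
    have h4 : q ^ (r l + i) * q ^ (Q k m + ((r l + i + A k l l) * n + (S + Y - A k l l * n))) =
        q ^ (Q k m + Y + S + r l * (n + 1)) * q ^ (i * (n + 1)) := by
      rw [← zpow_natCast, ← zpow_add₀ q_ne_zero, ← zpow_add₀ q_ne_zero]
      congr 1
      push_cast
      ring
    by_cases h0 : n = 0
    · simp only [h0, ne_eq, not_true_eq_false, if_false, forall_const] at h4 ⊢
      split_ifs with h5
      · have h6 : qBinom (X - i + (0 : ℕ)) 0 = 1 := by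
          unfold qBinom
          rw [if_pos (by push_cast; omega)]
          simp
        rw [h6, ← mul_assoc, h4]
        ring
      · rw [qBinom_of_lt (by push_cast; omega)]
        ring
    · rw [if_pos (fun h => absurd h h0), if_pos h0, ← mul_assoc, h4]
      ring
  rw [Finset.sum_congr rfl hterm, ← Finset.mul_sum, sum_qBinom K hK, fermTerm_eq hl,
    Q_add_single hl, ← hY]
  have h1 : (m + Finsupp.single l 1 : ℕ →₀ ℕ) l = n + 1 := by simp [hn]
  have h2 : ∀ j ∈ (Finset.Icc 1 k).erase l, (m + Finsupp.single l 1 : ℕ →₀ ℕ) j = m j := fun j hj => by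
    simp [Finsupp.single_apply, (Finset.ne_of_mem_erase hj).symm]
  have h3 : fermFactor k N r (m + Finsupp.single l 1) l = qBinom (X + n + 1) (n + 1) := by
    unfold fermFactor
    rw [h1, if_pos (by omega), sum_add_single hl, ← hY]
    congr 1
    push_cast
    ring
  have h4 : ∏ j ∈ (Finset.Icc 1 k).erase l, fermFactor k N r (m + Finsupp.single l 1) j = R := by
    refine Finset.prod_congr rfl fun j hj => ?_
    unfold fermFactor
    rw [h2 j hj, sum_add_single hl,
      hr j (Finset.mem_of_mem_erase hj) (Finset.ne_of_mem_erase hj)]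
    congr 2
    ring
  have h5 : ∑ i ∈ (Finset.Icc 1 k).erase l, r i * (((m + Finsupp.single l 1 : ℕ →₀ ℕ) i : ℕ) : ℤ) = S :=
    Finset.sum_congr rfl fun j hj => by rw [h2 j hj]
  rw [h3, h4, h5, h1]
  have h6 : Q k m + Y + (r l * ((n + 1 : ℕ) : ℤ) + S) = Q k m + Y + S + r l * (n + 1) := by
    push_cast
    ring
  rw [h6]
  ring

/-! ### Generating functions of configurations with given content -/

theorem finsum_mem_eq_of_rel {α β γ : Type*} [AddCommMonoid γ] {S : Set α} {T : Set β}
    (R : α → β → Prop) {f : α → γ} {g : β → γ} (h1 : ∀ x ∈ S, ∃ y ∈ T, R x y)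
    (h2 : ∀ y ∈ T, ∃ x ∈ S, R x y) (h3 : ∀ x x' y, R x y → R x' y → x = x')
    (h4 : ∀ x y y', R x y → R x y' → y = y') (hf : ∀ x y, R x y → f x = g y) :
    ∑ᶠ x ∈ S, f x = ∑ᶠ y ∈ T, g y := by
  classical
  rcases S.eq_empty_or_nonempty with rfl | ⟨x₀, hx₀⟩
  · have : T = ∅ := Set.eq_empty_of_forall_notMem fun y hy => by
      obtain ⟨x, hx, -⟩ := h2 y hy
      exact hx
    rw [this, finsum_mem_empty, finsum_mem_empty]
  have : ∀ x, ∃ y, x ∈ S → y ∈ T ∧ R x y := fun x => by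
    by_cases hx : x ∈ S
    · obtain ⟨y, hy, hR⟩ := h1 x hx
      exact ⟨y, fun _ => ⟨hy, hR⟩⟩
    · exact ⟨(h1 x₀ hx₀).choose, fun h => absurd h hx⟩
  choose φ hφ using this
  refine finsum_mem_eq_of_bijOn φ ⟨fun x hx => (hφ x hx).1, fun x hx x' hx' he => ?_, fun y hy => ?_⟩
    fun x hx => hf x _ (hφ x hx).2
  · exact h3 x x' _ (hφ x hx).2 (he ▸ (hφ x' hx').2)
  · obtain ⟨x, hx, hR⟩ := h2 y hy
    exact ⟨x, hx, h4 x _ _ (hφ x hx).2 hR⟩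

/-- The configurations of given content that satisfy the boundary conditions, the left one after
the carriers in `M` have been applied. -/
def gSet (k N : ℕ) (a b : ℤ) (M : List ℤ) (l : ℕ) (m : ℕ →₀ ℕ) : Set (ℤ → ℤ) :=
  {c | HasContent k l c m ∧ InP a b (kapL k M c) ∧ ∀ i > (N : ℤ), c i = 0}

/-- The configurations in `gSet` whose first particle of weight `l` has energy at least `t`. -/
def gSetT (k N : ℕ) (a b : ℤ) (M : List ℤ) (l : ℕ) (m : ℕ →₀ ℕ) (t : ℤ) : Set (ℤ → ℤ) :=
  {c | c ∈ gSet k N a b M l m ∧ (m l ≠ 0 → ∀ d ρ, Ext k l c d ρ → t ≤ ρ)}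

/-- The two parts of `c i` end up at the sites `i` and `i - 1` of `kap`. This yields finiteness of
the sets below. -/
theorem zero_below_of_kapL {k l : ℤ} {M : List ℤ} {c : ℤ → ℤ} (h : InC k l c)
    (hM : ∀ s ∈ M, 0 ≤ s ∧ s ≤ k - l) (h0 : ∀ i < 0, kapL k M c i = 0) : ∀ i < 0, c i = 0 := by
  induction M generalizing c with
  | nil => exact h0
  | cons s M ih =>
    have hs := hM s List.mem_cons_self
    have h1 := ih (h.kap hs.1 hs.2) (fun t ht => hM t (List.mem_cons_of_mem _ ht)) h0
    intro i hi
    have h2 := h1 i hi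
    have h3 := h1 (i - 1) (by omega)
    have h4 := (h.isSplit hs.1).facts h hs.1 i
    have h5 := (h.isSplit hs.1).facts h hs.1 (i + 1)
    have h6 := (h.isSplit hs.1).facts h hs.1 (i - 1)
    unfold kap at h2 h3
    rw [sub_add_cancel] at h3
    omega

theorem finite_bounded (k N : ℤ) : {c : ℤ → ℤ | (∀ i, 0 ≤ c i ∧ c i ≤ k) ∧ (∀ i < 0, c i = 0) ∧
    ∀ i > N, c i = 0}.Finite := by
  classical
  refine (Set.finite_range fun (f : Set.Icc 0 N → Set.Icc 0 k) (i : ℤ) =>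
    if h : i ∈ Set.Icc 0 N then (f ⟨i, h⟩ : ℤ) else 0).subset ?_
  rintro c ⟨h1, h2, h3⟩
  refine ⟨fun i => ⟨c i, h1 i⟩, ?_⟩
  funext i
  beta_reduce
  split_ifs with h
  · rfl
  · rw [Set.mem_Icc] at h
    rcases lt_or_ge i 0 with hi | hi
    · exact (h2 i hi).symm
    · exact (h3 i (by omega)).symm

theorem InC.le {k l : ℤ} {c : ℤ → ℤ} (h : InC k l c) (i : ℤ) : c i ≤ k := by
  have := h.three i
  have := h.nn (i + 1)
  have := h.nn (i + 2)
  omega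

theorem finite_gSet {k N l : ℕ} {a b : ℤ} {M : List ℤ} (hM : ∀ s ∈ M, 0 ≤ s ∧ s ≤ (k : ℤ) - l)
    (m : ℕ →₀ ℕ) : (gSet k N a b M l m).Finite := by
  refine (finite_bounded k N).subset fun c hc => ⟨fun i => ⟨hc.1.inC.nn i, hc.1.inC.le i⟩, ?_, hc.2.2⟩
  exact zero_below_of_kapL hc.1.inC hM hc.2.1.neg

theorem finite_gSetT {k N l : ℕ} {a b : ℤ} {M : List ℤ} (hM : ∀ s ∈ M, 0 ≤ s ∧ s ≤ (k : ℤ) - l)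
    (m : ℕ →₀ ℕ) (t : ℤ) : (gSetT k N a b M l m t).Finite :=
  (finite_gSet hM m).subset fun _ hc => hc.1

theorem fermTerm_zero (k N : ℕ) (r : ℕ → ℤ) : fermTerm k N r 0 = 1 := by
  simp [fermTerm, Q]

theorem hasContent_zero_iff {k : ℕ} {c : ℤ → ℤ} {m : ℕ →₀ ℕ} :
    HasContent k 0 c m ↔ c = 0 ∧ m = 0 := by
  refine ⟨fun h => ?_, fun ⟨h1, h2⟩ => h1 ▸ h2 ▸ .zero⟩
  generalize hl : 0 = l at h
  cases h with
  | zero => exact ⟨rfl, rfl⟩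
  | pred => omega
  | ext => omega

theorem finsum_gSetT_zero {k N : ℕ} {a b : ℤ} (ha : 0 ≤ a) (hb : 0 ≤ b) {M : List ℤ}
    (hM : ∀ s ∈ M, 0 ≤ s ∧ s ≤ (k : ℤ)) (t : ℤ) :
    ∑ᶠ c ∈ gSetT k N a b M 0 0 t, q ^ deg c = 1 := by
  have : gSetT k N a b M 0 0 t = {0} := by
    ext c
    simp only [gSetT, gSet, Set.mem_ofPred_eq, hasContent_zero_iff, Finsupp.coe_zero, Pi.zero_apply,
      ne_eq, not_true_eq_false, false_imp_iff, and_true, Set.mem_singleton_iff]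
    refine ⟨fun h => h.1, ?_⟩
    rintro rfl
    refine ⟨rfl, ?_, fun _ _ => rfl⟩
    rw [kapL_zero (inC_zero k 0) fun s hs => (hM s hs).1]
    exact ⟨fun _ _ => rfl, ha, by simp; omega⟩
  rw [this, finsum_mem_singleton]
  simp [deg, wsum]

theorem append_bounds {k l : ℤ} {M : List ℤ} (hl : 0 ≤ l) (hlk : l ≤ k)
    (hM : ∀ s ∈ M, 0 ≤ s ∧ s ≤ k - l) : ∀ s ∈ M ++ [k - l, 0, 0], 0 ≤ s ∧ s ≤ k - l := by
  intro s hs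
  rw [List.mem_append] at hs
  rcases hs with hs | hs
  · exact hM s hs
  · simp only [List.mem_cons, List.not_mem_nil, or_false] at hs
    omega

theorem A_self (k l : ℕ) : A k l l = 2 * (l : ℤ) + max (2 * (l : ℤ) - k) 0 := by
  unfold A
  omega

/-- Removing the first particle of weight `l`. -/
theorem finsum_gSetT_fiber {k N l : ℕ} {a b : ℤ} (hb : 0 ≤ b) (hlk : l + 1 ≤ k)
    {M : List ℤ} (hM : ∀ s ∈ M, 0 ≤ s ∧ s ≤ (k : ℤ) - (l + 1 : ℕ)) {m : ℕ →₀ ℕ} {t ρ : ℤ}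
    (ht : rmin a b M (l + 1 : ℕ) ≤ t) (hρ : t ≤ ρ) :
    ∑ᶠ c ∈ {c | c ∈ gSetT k N a b M (l + 1) (m + Finsupp.single (l + 1) 1) t ∧
        ∃ d, Ext k (l + 1 : ℕ) c d ρ}, q ^ deg c =
      q ^ ρ * (if m (l + 1) = 0 → ρ ≤ ((l + 1 : ℕ) : ℤ) * N -
          ∑ i ∈ Finset.Icc 1 k, A k (l + 1) i * (m i : ℤ) then
        ∑ᶠ d ∈ gSetT k N a b (M ++ [(k : ℤ) - (l + 1 : ℕ), 0, 0]) (l + 1) m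
          (ρ + A k (l + 1) (l + 1)), q ^ deg d else 0) := by
  have hL : (1 : ℤ) ≤ (l + 1 : ℕ) := by push_cast; omega
  have hLk : ((l + 1 : ℕ) : ℤ) ≤ k := by exact_mod_cast hlk
  have hM' := append_bounds (by omega) hLk hM
  -- Row `l + 1` of `A` agrees with the coefficients of `HasContent.mass_add` only for `j ≤ l + 1`;
  -- for larger `j` the content vanishes.
  have hmass : ∀ d, HasContent k (l + 1) d m →
      2 * mass d + mass (d - spl k ((k : ℤ) - (l + 1 : ℕ)) d) =
        ∑ i ∈ Finset.Icc 1 k, A k (l + 1) i * (m i : ℤ) := by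
    intro d hd
    rw [hd.mass_add hlk (by omega) le_rfl]
    refine Finset.sum_congr rfl fun j _ => ?_
    by_cases hj : l + 1 < j
    · rw [hd.eq_zero hj]
      simp
    · congr 1
      unfold A
      omega
  -- This identifies the case in which the right boundary bounds `ρ`: the extracted particle was the
  -- only one of weight `l + 1`.
  have hpred : ∀ d, HasContent k (l + 1) d m → (InC k ((l + 1 : ℕ) - 1) d ↔ m (l + 1) = 0) := by
    intro d hd
    constructor
    · intro h
      rw [Nat.cast_add, Nat.cast_one, add_sub_cancel_right] at h
      obtain ⟨m', hm'⟩ := exists_hasContent (by omega) h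
      rw [hd.unique hlk (.pred l d m' hm')]
      exact hm'.eq_zero (by omega)
    · intro h
      rw [Nat.cast_add, Nat.cast_one, add_sub_cancel_right]
      exact ((hasContent_succ_iff h).1 hd).inC
  have hcast : ∀ c d σ, Ext k ((l + 1 : ℕ) : ℤ) c d σ ↔ Ext k (l + 1) c d σ := fun c d σ => by
    push_cast
    rfl
  -- the inserted configurations
  have key : ∀ c d, Ext k (l + 1 : ℕ) c d ρ →
      (c ∈ gSetT k N a b M (l + 1) (m + Finsupp.single (l + 1) 1) t ↔
        d ∈ gSetT k N a b (M ++ [(k : ℤ) - (l + 1 : ℕ), 0, 0]) (l + 1) m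
          (ρ + A k (l + 1) (l + 1)) ∧ (m (l + 1) = 0 → ρ ≤ ((l + 1 : ℕ) : ℤ) * N -
          ∑ i ∈ Finset.Icc 1 k, A k (l + 1) i * (m i : ℤ))) := by
    intro c d he
    have hP := he.inP_kapL_iff (a := a) hL hLk hb hM
    have hN := he.zero_above_iff (N := N) hL hLk
    -- The possibility of inserting `ρ` already forces the next energy of weight `l + 1` to be at
    -- least `ρ + A`, so the threshold for `d` holds automatically.
    have hthr : m (l + 1) ≠ 0 → ∀ e σ, Ext k (l + 1 : ℕ) d e σ →
        ρ + A k (l + 1) (l + 1) ≤ σ := by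
      intro _ e σ hde
      have := (exists_ext_iff hL hLk (he.inC_right hL)).1 ⟨c, he⟩ e σ hde
      rw [A_self]
      omega
    constructor
    · rintro ⟨⟨h1, h2, h3⟩, -⟩
      obtain ⟨d', ρ', he', hd'⟩ := hasContent_add_single_iff.1 h1
      obtain ⟨rfl, rfl⟩ := he.unique hL hLk ((hcast _ _ _).2 he')
      have h4 := hN.1 h3
      refine ⟨⟨⟨hd', (hP.1 h2).1, h4.1⟩, hthr⟩, fun h0 => ?_⟩
      have h5 := h4.2 ((hpred d hd').2 h0)
      have h6 := hmass d hd'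
      omega
    · rintro ⟨⟨⟨h1, h2, h3⟩, -⟩, h4⟩
      refine ⟨⟨hasContent_add_single_iff.2 ⟨d, ρ, (hcast _ _ _).1 he, h1⟩,
        hP.2 ⟨h2, by omega⟩, hN.2 ⟨h3, fun h0 => ?_⟩⟩, fun _ d' ρ' he' => ?_⟩
      · have h5 := h4 ((hpred d h1).1 h0)
        have h6 := hmass d h1
        omega
      · obtain ⟨-, rfl⟩ := he.unique hL hLk he'
        exact hρ
  split_ifs with hc
  · rw [mul_finsum_mem]
    refine finsum_mem_eq_of_rel (fun c d => Ext k (l + 1 : ℕ) c d ρ) ?_ ?_ ?_ ?_ ?_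
    · rintro c ⟨hc1, d, hd⟩
      exact ⟨d, ((key c d hd).1 hc1).1, hd⟩
    · intro d hd
      have hdC := hd.1.1.inC
      obtain ⟨c, he⟩ := (exists_ext_iff (ρ := ρ) hL hLk hdC).2 fun e σ hde => by
        by_cases h0 : m (l + 1) = 0
        · exact absurd ((hpred d hd.1.1).2 h0) (hde.not_pred hL hLk)
        · have := hd.2 h0 e σ hde
          rw [A_self] at this
          omega
      exact ⟨c, ⟨(key c d he).2 ⟨hd, hc⟩, d, he⟩, he⟩
    · exact fun c c' d h h' => h.inj hL hLk h'
    · exact fun c d d' h h' => (h.unique hL hLk h').1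
    · intro c d h
      rw [h.deg_eq hL, add_comm, zpow_add₀ q_ne_zero]
  · rw [mul_zero]
    refine finsum_mem_eq_zero_of_forall_eq_zero ?_
    rintro c ⟨hc1, d, hd⟩
    exact absurd ((key c d hd).1 hc1).2 hc

/-- The generating function of the configurations with given content is a fermionic summand. -/
theorem finsum_gSetT {k N : ℕ} {a b : ℤ} (ha : 0 ≤ a) (hb : 0 ≤ b) {l : ℕ} (hlk : l ≤ k)
    {M : List ℤ} (hM : ∀ s ∈ M, 0 ≤ s ∧ s ≤ (k : ℤ) - l) {m : ℕ →₀ ℕ}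
    (hm : ∀ j ∉ Finset.Icc 1 l, m j = 0) {t : ℤ} (ht : rmin a b M l ≤ t) :
    ∑ᶠ c ∈ gSetT k N a b M l m t, q ^ deg c =
      fermTerm k N (Function.update (fun j => rmin a b M j) l t) m := by
  induction l generalizing M m t with
  | zero =>
    obtain rfl : m = 0 := Finsupp.ext fun j => hm j (by simp)
    rw [fermTerm_zero, finsum_gSetT_zero ha hb (by simpa using hM)]
  | succ l ihl =>
    have hL : (1 : ℤ) ≤ (l + 1 : ℕ) := by push_cast; omega
    have hLk : ((l + 1 : ℕ) : ℤ) ≤ k := by exact_mod_cast hlk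
    have hl1 : l + 1 ∈ Finset.Icc 1 k := Finset.mem_Icc.2 ⟨by omega, hlk⟩
    obtain ⟨n, hn⟩ : ∃ n, m (l + 1) = n := ⟨_, rfl⟩
    induction n generalizing M m t with
    | zero =>
      -- Without particles of weight `l + 1` the threshold `t` is void, and the threshold `rmin a b
      -- M l` for weight `l` is implied by the left boundary condition.
      have hset : gSetT k N a b M (l + 1) m t = gSetT k N a b M l m (rmin a b M l) := by
        ext c
        simp only [gSetT, gSet, Set.mem_ofPred_eq, hasContent_succ_iff hn, hn, ne_eq,
          not_true_eq_false, false_imp_iff, and_true]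
        refine ⟨fun h => ⟨h, fun h0 d ρ he => ?_⟩, fun h => h.1⟩
        rcases l.eq_zero_or_pos with rfl | hl
        · exact absurd (hm 0 (by simp)) h0
        · exact ((he.inP_kapL_iff (a := a) (by omega) (by omega) hb fun s hs => by
            have := hM s hs
            push_cast at this
            omega).1 h.2.1).2
      rw [hset, ihl (by omega) (fun s hs => by
        have := hM s hs
        push_cast at this
        omega) (fun j hj => ?_) le_rfl]
      · refine fermTerm_congr fun j hj h0 => ?_
        have hne : j ≠ l + 1 := by
          rintro rfl
          exact h0 hn
        rw [Function.update_of_ne hne]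
        by_cases hjl : j = l
        · subst hjl
          rw [Function.update_self]
        · rw [Function.update_of_ne hjl]
      · by_cases hjl : j = l + 1
        · rw [hjl, hn]
        · exact hm j (by rw [Finset.mem_Icc] at hj ⊢; omega)
    | succ n ihn =>
      classical
      obtain ⟨m', rfl⟩ : ∃ m', m = m' + Finsupp.single (l + 1) 1 := by
        refine ⟨m - Finsupp.single (l + 1) 1, (tsub_add_cancel_of_le ?_).symm⟩
        rw [Finsupp.single_le_iff]
        omega
      have hn' : m' (l + 1) = n := by simpa using hn
      have hm' : ∀ j ∉ Finset.Icc 1 (l + 1), m' j = 0 := fun j hj => by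
        have := hm j hj
        simp only [Finsupp.add_apply, Nat.add_eq_zero_iff] at this
        exact this.1
      set S := gSetT k N a b M (l + 1) (m' + Finsupp.single (l + 1) 1) t with hS
      have hfin : S.Finite := finite_gSetT hM _ _
      have hM' := append_bounds (by omega) hLk hM
      set M' := M ++ [(k : ℤ) - (l + 1 : ℕ), 0, 0] with hMd
      have hr' : ∀ j : ℕ, j ≤ l + 1 → rmin a b M' j = rmin a b M j + A k j (l + 1) := fun j hj => by
        rw [hMd, rmin_append M (by omega)]
        unfold A
        omega
      -- The set is finite, so the energies of the first particle are bounded and only finitely many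
      -- fibres occur.
      obtain ⟨B, hB⟩ : ∃ B, ∀ c ∈ S, ∀ d ρ, Ext k (l + 1 : ℕ) c d ρ → ρ ≤ B := by
        obtain ⟨B, hB⟩ := (hfin.image fun c => if h : ∃ x : (ℤ → ℤ) × ℤ, Ext k (l + 1 : ℕ) c x.1 x.2
          then h.choose.2 else 0).bddAbove
        refine ⟨B, fun c hc d ρ he => ?_⟩
        have hex : ∃ x : (ℤ → ℤ) × ℤ, Ext k (l + 1 : ℕ) c x.1 x.2 := ⟨(d, ρ), he⟩
        have := hB ⟨c, hc, rfl⟩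
        beta_reduce at this
        rw [dif_pos hex] at this
        rwa [((he.unique hL hLk hex.choose_spec).2 : ρ = _)]
      -- Large enough for the energies `t, …, t + K` to exhaust the fibres and for the hypothesis of
      -- `sum_fermTerm`.
      set K := (max (B - t) (((l + 1 : ℕ) : ℤ) * N -
        ∑ i ∈ Finset.Icc 1 k, A k (l + 1) i * (m' i : ℤ) - t)).toNat with hK
      have hunion : S = ⋃ i ∈ (Finset.range (K + 1) : Set ℕ),
          {c | c ∈ S ∧ ∃ d, Ext k (l + 1 : ℕ) c d (t + (i : ℤ))} := by
        ext c
        simp only [Set.mem_iUnion, Finset.coe_range, Set.mem_Iio, Set.mem_ofPred_eq, exists_prop]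
        refine ⟨fun hc => ?_, fun ⟨i, _, hc, _⟩ => hc⟩
        obtain ⟨d, ρ, he, -⟩ := hasContent_add_single_iff.1 hc.1.1
        have he' : Ext k (l + 1 : ℕ) c d ρ := by exact_mod_cast he
        have h1 := hc.2 (by simp) d ρ he'
        have h2 := hB c hc d ρ he'
        refine ⟨(ρ - t).toNat, by omega, hc, d, ?_⟩
        rwa [show t + ((ρ - t).toNat : ℤ) = ρ by omega]
      have hsum := finsum_mem_biUnion (f := fun c => q ^ deg c)
        (I := (Finset.range (K + 1) : Set ℕ))
        (t := fun i => {c | c ∈ S ∧ ∃ d, Ext k (l + 1 : ℕ) c d (t + (i : ℤ))}) (fun i _ j _ hij => by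
          rw [Function.onFun, Set.disjoint_left]
          rintro c ⟨-, d, hd⟩ ⟨-, d', hd'⟩
          have := (hd.unique hL hLk hd').2
          omega) (Finset.finite_toSet _) (fun i _ => hfin.subset fun c hc => hc.1)
      rw [← hunion] at hsum
      rw [hsum, finsum_mem_coe_finset]
      have hrec := sum_fermTerm (K := K) (N := N) hl1
        (r := Function.update (fun j : ℕ => rmin a b M j) (l + 1) t)
        (r' := fun j : ℕ => Function.update (fun j : ℕ => rmin a b M j) (l + 1) t j + A k j (l + 1)) m'
        (fun _ _ _ => rfl) (by rw [Function.update_self]; omega)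
      rw [← hrec]
      refine Finset.sum_congr rfl fun i _ => ?_
      have hf := finsum_gSetT_fiber (N := N) (m := m') (ρ := t + i) hb hlk hM ht (by omega)
      rw [← hS] at hf
      rw [hf, Function.update_self]
      congr 1
      refine if_congr Iff.rfl ?_ rfl
      rw [ihn hM' hm' (by rw [hr' _ le_rfl]; omega) hn']
      refine fermTerm_congr fun j hj h0 => ?_
      by_cases hjl : j = l + 1
      · subst hjl
        rw [Function.update_self, Function.update_self]
      · rw [Function.update_of_ne hjl, Function.update_of_ne hjl, Function.update_of_ne hjl]
        refine hr' j ?_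
        by_contra hlt
        exact h0 (hm' j (by rw [Finset.mem_Icc]; omega))

/-! ### Fermionic polynomials as generating functions -/

/-- The configurations of maximal weight at most `l` that satisfy the boundary conditions. -/
def pSet (k l N : ℕ) (a b : ℤ) : Set (ℤ → ℤ) :=
  {c | InC k l c ∧ InP a b c ∧ ∀ i > (N : ℤ), c i = 0}

theorem finite_pSet (k l N : ℕ) (a b : ℤ) : (pSet k l N a b).Finite :=
  (finite_bounded k N).subset fun _ hc => ⟨fun i => ⟨hc.1.nn i, hc.1.le i⟩, hc.2.1.neg, hc.2.2⟩

theorem finsum_pSet_eq_finsum_gSet {k l : ℕ} (hlk : l ≤ k) (N : ℕ) (a b : ℤ)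
    (f : (ℤ → ℤ) → RatFunc ℚ) :
    ∑ᶠ c ∈ pSet k l N a b, f c = ∑ᶠ m ∈ multIndices l, ∑ᶠ c ∈ gSet k N a b [] l m, f c := by
  have hfin := finite_pSet k l N a b
  set T : Set (ℕ →₀ ℕ) := {m | (gSet k N a b [] l m).Nonempty} with hT
  have hsub : ∀ m, gSet k N a b [] l m ⊆ pSet k l N a b := fun m c hc => ⟨hc.1.inC, hc.2⟩
  have hex : ∀ c, ∃ m, c ∈ pSet k l N a b → HasContent k l c m := fun c => by
    by_cases hc : c ∈ pSet k l N a b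
    · obtain ⟨m, hm⟩ := exists_hasContent hlk hc.1
      exact ⟨m, fun _ => hm⟩
    · exact ⟨0, fun h => absurd h hc⟩
  choose φ hφ using hex
  have hTfin : T.Finite := (hfin.image φ).subset fun m ⟨c, hc⟩ =>
    ⟨c, hsub m hc, (hφ c (hsub m hc)).unique hlk hc.1⟩
  have hU : pSet k l N a b = ⋃ m ∈ T, gSet k N a b [] l m := by
    ext c
    simp only [Set.mem_iUnion, exists_prop]
    exact ⟨fun hc => ⟨φ c, ⟨c, hφ c hc, hc.2⟩, hφ c hc, hc.2⟩, fun ⟨m, _, hc⟩ => hsub m hc⟩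
  rw [hU, finsum_mem_biUnion (fun m _ m' _ hne => Set.disjoint_left.2 fun c h h' =>
    hne (h.1.unique hlk h'.1)) hTfin fun m _ => hfin.subset (hsub m)]
  refine finsum_mem_inter_support_eq' _ _ _ fun m hm => ?_
  have hmT : m ∈ T := by
    by_contra h
    refine hm ?_
    beta_reduce
    rw [Set.not_nonempty_iff_eq_empty.1 h, finsum_mem_empty]
  refine ⟨fun _ j hj => ?_, fun _ => hmT⟩
  obtain ⟨c, hc⟩ := hmT
  rcases j.eq_zero_or_pos with rfl | h0
  · exact hc.1.eq_zero_zero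
  · exact hc.1.eq_zero (by
      rw [Finset.mem_Icc] at hj
      omega)

theorem finsum_gSet {k l : ℕ} (hlk : l ≤ k) (N : ℕ) {a b : ℤ} (ha : 0 ≤ a) (hb : 0 ≤ b)
    {m : ℕ →₀ ℕ} (hm : m ∈ multIndices l) :
    ∑ᶠ c ∈ gSet k N a b [] l m, q ^ deg c =
      fermTerm k N (fun j => max ((j : ℤ) - a) 0 + max ((j : ℤ) - a - b) 0) m := by
  have hr : ∀ j : ℕ, rmin a b [] j = max ((j : ℤ) - a) 0 + max ((j : ℤ) - a - b) 0 := fun j => by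
    simp [rmin]
  have h1 : gSet k N a b [] l m = gSetT k N a b [] l m (rmin a b [] l) := by
    ext c
    refine ⟨fun h => ⟨h, fun h0 d ρ he => ?_⟩, fun h => h.1⟩
    have hl : l ≠ 0 := by
      rintro rfl
      exact h0 (hm 0 (by simp))
    exact ((he.inP_kapL_iff (by omega) (by omega) hb (by simp)).1 h.2.1).2
  rw [h1, finsum_gSetT ha hb hlk (by simp) hm le_rfl]
  refine fermTerm_congr fun j _ _ => ?_
  rcases eq_or_ne j l with rfl | hj
  · rw [Function.update_self, hr]
  · rw [Function.update_of_ne hj, hr]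

/-- For `j ≤ l` the entry `r_j` is `max (j - a) 0 + max (j - a - b) 0`. Replacing `b` by `k - a`
when `a + b = k + 1` changes nothing, because `j ≤ k`. For negative `a` no configuration qualifies,
in accordance with `chi = 0`. -/
theorem chi_eq {k l : ℕ} (hlk : l ≤ k) (N : ℕ) {a b : ℤ} (hb : 0 ≤ b)
    (hab : a + b ≤ l + 1) :
    chi k l N a b = ∑ᶠ c ∈ pSet k l N a b, q ^ deg c := by
  unfold chi
  split_ifs with ha
  · have : pSet k l N a b = ∅ := Set.eq_empty_of_forall_notMem fun c hc => by
      have h1 := hc.1.nn 0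
      have h2 := hc.2.1.zero
      omega
    rw [this, finsum_mem_empty]
  rw [finsum_pSet_eq_finsum_gSet hlk]
  refine finsum_mem_congr rfl fun m hm => ?_
  rw [finsum_gSet hlk N (by omega) hb hm]
  refine fermTerm_congr fun j _ h0 => ?_
  have hj : j ∈ Finset.Icc 1 l := by
    by_contra h
    exact h0 (hm j h)
  rw [Finset.mem_Icc] at hj
  unfold rVec
  split_ifs <;> omega

/-! ### Inclusion-exclusion over the initial values -/

/-- The configurations with given initial values. -/
def iSet (k l N : ℕ) (a b : ℤ) : Set (ℤ → ℤ) :=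
  {c | InC k l c ∧ (∀ i < 0, c i = 0) ∧ (∀ i > (N : ℤ), c i = 0) ∧ c 0 = a ∧ c 1 = b}

/-- The configurations with given value at `0` and bounded value at `1`. -/
def jSet (k l N : ℕ) (a b : ℤ) : Set (ℤ → ℤ) :=
  {c | InC k l c ∧ (∀ i < 0, c i = 0) ∧ (∀ i > (N : ℤ), c i = 0) ∧ c 0 = a ∧ c 1 ≤ b}

theorem finite_jSet (k l N : ℕ) (a b : ℤ) : (jSet k l N a b).Finite :=
  (finite_bounded k N).subset fun _ hc => ⟨fun i => ⟨hc.1.nn i, hc.1.le i⟩, hc.2.1, hc.2.2.1⟩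

/-- Passing from `(a, b)` to `(a - 1, b + 2)` keeps `2 * a + b` and only sharpens `c 0 ≤ a` to `c 0
≤ a - 1`. The difference is `c 0 = a`, where the other condition reads `c 1 ≤ b`. -/
theorem finsum_jSet (k l N : ℕ) (a b : ℤ) (f : (ℤ → ℤ) → RatFunc ℚ) :
    ∑ᶠ c ∈ jSet k l N a b, f c =
      ∑ᶠ c ∈ pSet k l N a b, f c - ∑ᶠ c ∈ pSet k l N (a - 1) (b + 2), f c := by
  have hd : Disjoint (jSet k l N a b) (pSet k l N (a - 1) (b + 2)) :=
    Set.disjoint_left.2 fun c h h' => by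
      have h1 := h.2.2.2.1
      have h2 := h'.2.1.zero
      omega
  have hU : pSet k l N a b = jSet k l N a b ∪ pSet k l N (a - 1) (b + 2) := by
    ext c
    constructor
    · rintro ⟨h1, ⟨h2, h3, h4⟩, h5⟩
      rcases eq_or_ne (c 0) a with h | h
      · exact .inl ⟨h1, h2, h5, h, by omega⟩
      · exact .inr ⟨h1, ⟨h2, by omega, by omega⟩, h5⟩
    · rintro (⟨h1, h2, h3, h4, h5⟩ | ⟨h1, ⟨h2, h3, h4⟩, h5⟩)
      · exact ⟨h1, ⟨h2, by omega, by omega⟩, h3⟩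
      · exact ⟨h1, ⟨h2, by omega, by omega⟩, h5⟩
  rw [hU, finsum_mem_union hd (finite_jSet k l N a b) (finite_pSet k l N _ _), add_sub_cancel_right]

theorem finsum_iSet (k l N : ℕ) (a b : ℤ) (f : (ℤ → ℤ) → RatFunc ℚ) :
    ∑ᶠ c ∈ iSet k l N a b, f c =
      ∑ᶠ c ∈ jSet k l N a b, f c - ∑ᶠ c ∈ jSet k l N a (b - 1), f c := by
  have hd : Disjoint (iSet k l N a b) (jSet k l N a (b - 1)) :=
    Set.disjoint_left.2 fun c h h' => by
      have h1 := h.2.2.2.2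
      have h2 := h'.2.2.2.2
      omega
  have hU : jSet k l N a b = iSet k l N a b ∪ jSet k l N a (b - 1) := by
    ext c
    constructor
    · rintro ⟨h1, h2, h3, h4, h5⟩
      rcases eq_or_ne (c 1) b with h | h
      · exact .inl ⟨h1, h2, h3, h4, h⟩
      · exact .inr ⟨h1, h2, h3, h4, by omega⟩
    · rintro (⟨h1, h2, h3, h4, h5⟩ | ⟨h1, h2, h3, h4, h5⟩)
      · exact ⟨h1, h2, h3, h4, by omega⟩
      · exact ⟨h1, h2, h3, h4, by omega⟩
  rw [hU, finsum_mem_union hd ((finite_jSet k l N a b).subset fun c hc => ⟨hc.1, hc.2.1, hc.2.2.1,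
    hc.2.2.2.1, hc.2.2.2.2.le⟩) (finite_jSet k l N _ _), add_sub_cancel_right]

/-! ### Finitely supported configurations as integer sequences -/

theorem mem_C_iff_inC {k l : ℕ} {c : Config} : c ∈ C k l ↔ InC k l fun i => (c i : ℤ) := by
  rw [mem_C_iff]
  refine ⟨fun ⟨h1, h2, h3⟩ => ⟨?_, fun i => by positivity, fun i => ?_, fun i => ?_, fun i => ?_⟩,
    fun h => ⟨fun i => ?_, fun i => ?_, fun i => ?_⟩⟩
  · refine c.support.finite_toSet.subset fun i hi => ?_
    simpa using hi
  · exact_mod_cast h1 i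
  · exact_mod_cast h2 i
  · have := h3 (i + 1)
    rw [show i + 1 - 1 = i by ring, show i + 1 + 1 = i + 2 by ring,
      show i + 1 + 2 = i + 3 by ring] at this
    exact_mod_cast this
  · exact_mod_cast h.three i
  · exact_mod_cast h.two i
  · have := h.four (i - 1)
    rw [show i - 1 + 1 = i by ring, show i - 1 + 2 = i + 1 by ring,
      show i - 1 + 3 = i + 2 by ring] at this
    exact_mod_cast this

theorem degree_eq_deg (c : Config) : degree c = deg fun i => (c i : ℤ) := by
  unfold degree deg wsum Finsupp.sum
  refine (finsum_eq_sum_of_support_subset _ fun i hi => ?_).symm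
  simp only [Function.mem_support, ne_eq, mul_eq_zero, not_or, Nat.cast_eq_zero] at hi
  exact Finsupp.mem_support_iff.2 hi.2

theorem finsum_CInitBdd (k l N a b : ℕ) :
    ∑ᶠ c ∈ CInitBdd k l N a b, q ^ degree c = ∑ᶠ c ∈ iSet k l N a b, q ^ deg c := by
  have hmem : ∀ c : Config, c ∈ CInitBdd k l N a b ↔ (fun i => (c i : ℤ)) ∈ iSet k l N a b := by
    intro c
    simp only [CInitBdd, CBdd, CInit, CPos, iSet, Set.mem_inter_iff, Set.mem_ofPred_eq,
      mem_C_iff_inC, Nat.cast_eq_zero, Nat.cast_inj, gt_iff_lt]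
    tauto
  refine finsum_mem_eq_of_bijOn (fun (c : Config) (i : ℤ) => (c i : ℤ))
    ⟨fun c hc => (hmem c).1 hc, fun c _ c' _ h => ?_, fun d hd => ?_⟩ fun c _ => ?_
  · exact Finsupp.ext fun i => Int.ofNat_inj.1 (congrFun h i)
  · have h1 : ∀ i, ((d i).toNat : ℤ) = d i := fun i => Int.toNat_of_nonneg (hd.1.nn i)
    have h2 : (fun i => (d i).toNat).support.Finite := hd.1.fin.subset fun i hi h0 => hi (by simp [h0])
    have h3 : (fun i => ((Finsupp.ofSupportFinite _ h2 i : ℕ) : ℤ)) = d := funext h1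
    exact ⟨Finsupp.ofSupportFinite _ h2, (hmem _).2 (by rwa [h3]), h3⟩
  · rw [degree_eq_deg]

end RiggedConfig

theorem mainTheorem8 (k l N a b : ℕ) (hl : 1 ≤ l) (hlk : l ≤ k) (hab : a + b ≤ l) :
    (0 < b →
      ∑ᶠ c ∈ RiggedConfig.CInitBdd k l N a b, RiggedConfig.q ^ RiggedConfig.degree c =
        RiggedConfig.chi k l N a b - RiggedConfig.chi k l N ((a : ℤ) - 1) ((b : ℤ) + 2)
          - RiggedConfig.chi k l N a ((b : ℤ) - 1)
          + RiggedConfig.chi k l N ((a : ℤ) - 1) ((b : ℤ) + 1)) ∧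
    (b = 0 →
      ∑ᶠ c ∈ RiggedConfig.CInitBdd k l N a b, RiggedConfig.q ^ RiggedConfig.degree c =
        RiggedConfig.chi k l N a 0 - RiggedConfig.chi k l N ((a : ℤ) - 1) 2) := by
  have hlk' : (l : ℤ) ≤ k := by exact_mod_cast hlk
  have hab' : (a : ℤ) + b ≤ l := by exact_mod_cast hab
  constructor
  · intro hb
    rw [RiggedConfig.finsum_CInitBdd, RiggedConfig.finsum_iSet, RiggedConfig.finsum_jSet,
      RiggedConfig.finsum_jSet, RiggedConfig.chi_eq hlk N (by omega) (by omega),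
      RiggedConfig.chi_eq hlk N (by omega) (by omega),
      RiggedConfig.chi_eq hlk N (by omega) (by omega),
      RiggedConfig.chi_eq hlk N (by omega) (by omega), show (b : ℤ) - 1 + 2 = b + 1 by ring]
    ring
  · rintro rfl
    -- For `b = 0` the bound `c 1 ≤ 0` is already an equality, so no second subtraction is needed.
    have h : RiggedConfig.iSet k l N a (0 : ℕ) = RiggedConfig.jSet k l N a 0 := by
      ext c
      refine ⟨fun ⟨h1, h2, h3, h4, h5⟩ => ⟨h1, h2, h3, h4, h5.le⟩,
        fun ⟨h1, h2, h3, h4, h5⟩ => ⟨h1, h2, h3, h4, ?_⟩⟩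
      have := h1.nn 1
      omega
    rw [RiggedConfig.finsum_CInitBdd, h, RiggedConfig.finsum_jSet,
      RiggedConfig.chi_eq hlk N (by omega) (by omega),
      RiggedConfig.chi_eq hlk N (by omega) (by omega), zero_add]
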